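/- **Gaussian-filtered quantum phase estimation (GQPE).** Notation. For $m\in\mathbb N$, $\gamma>0$, $\kappa\ge 1$ put $N=2^{2m}$, $h=2^{-m}$, $\omega_j=(j-\tfrac N2)h$ and $\xi_\ell=(\ell-\tfrac N2)h$ for $0\le j,\ell\le N-1$, let $\widehat g_\gamma(\xi)=(2\sqrt{2\pi}\,\gamma)^{1/2}e^{-4\pi^2\gamma^2\xi^2}$ be the Fourier transform of the Gaussian filter $g_\gamma(\omega)=(\gamma\sqrt{2\pi})^{-1/2}e^{-\omega^2/4\gamma^2}$, and let $c_N=\big(h\sum_{\ell=1}^{N-1}\widehat g_\gamma(\xi_\ell)^2\big)^{1/2}$. For an observable (Hermitian matrix) $O$ on $n$ qubits, the GQPE instrument $\mathcal M=\mathcal M_{\kappa,\gamma,m}$ is the following. Prepare the resource state $\frac1{c_N}\sum_{\ell=1}^{N-1}\sqrt h\,\widehat g_\gamma(\xi_\ell)|\ell\rangle$ on a readout register of $2m$ qubits; apply $\sum_\ell e^{-2\pi i\xi_\ell O/\kappa}\otimes|\ell\rangle\langle \ell|$; apply to the register the shifted quantum Fourier transform $|\ell\rangle\mapsto N^{-1/2}\sum_j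 e^{2\pi i(\ell-N/2)(j-N/2)/N}|j\rangle$; measure the register in the computational basis. The readout $j$ is recorded as the outcome $v_j=\kappa\omega_j$ if $|\omega_j|\le 2$ and as $v_j=0$ otherwise. Thus $\mathcal M$ has the Kraus operators $$O_j=\frac{h^{3/2}}{c_N}\sum_{\ell=1}^{N-1}\widehat g_\gamma(\xi_\ell)\,e^{2\pi i\xi_\ell(\omega_j-O/\kappa)},\qquad \mathcal M[\rho]=\sum_jO_j\rho O_j^\dagger .$$ For a state (density matrix) $\rho$ write $\mathbb E_\rho[\mathcal M]=\sum_jv_j\operatorname{tr}(O_j\rho O_j^\dagger)$, $\mathbb V_\rho[\mathcal M]=\sum_j(v_j-\mathbb E_\rho[\mathcal M])^2\operatorname{tr}(O_j\rho O_j^\dagger)$ and $\mathrm{Cov}_\rho(\mathcal M)=\sum_{i,j}(v_i-\mathbb E_\rho[\mathcal M])(v_j-\mathbb E_\rho[\mathcal M])\operatorname{tr}(O_jO_i\rho O_i^\dagger O_j^\dagger)$, and $\mathbb V_\rho[O]=\operatorname{tr}(O^2\rho)-(\operatorname{tr}O\rho)^2$. Elementary gates are unitaries acting on at most two qubits; controlled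 evolution of time $|\tau|$ is $e^{-i\tau O}$ ($\tau\in\mathbb R$) on the system, controlled by one ancilla qubit. **Theorem.** There are universal constants $C\in\mathbb R$ and $p\in\mathbb N$ such that for all real $\kappa\ge 1$ and $0<\varepsilon\le\frac14$ there are $m,w\in\mathbb N$, $\gamma>0$ and a circuit on $a=2m+w$ ancilla qubits ($2m$ readout and $w$ work qubits, initialized in $|0\cdots0\rangle$), made of elementary gates on the ancillas and controlled evolutions of the system, all of them depending on $\kappa$ and $\varepsilon$ only, with $$a\le C\big(\log\kappa+\log\log\varepsilon^{-1}\big),\qquad t\le C\big(\log\kappa+\log\varepsilon^{-1}\big),\qquad \#\{\text{operations of the circuit}\}\le C\,a^p,$$ where $t$ is the total controlled evolution time, such that for every $n$ and every observable $O$ on $n$ qubits with operator norm $\|O\|\le\kappa$: * $\sum_jO_j^\dagger O_j=I$, so that $\mathcal M=\mathcal M_{\kappa,\gamma,m}$ is a quantum channel, and the circuit, followed by measuring the readout register and discarding the work qubits, implements $\mathcal M$ exactly: readout $j$ maps the system state $\rho$ to $O_j\rho O_j^\dagger$; * for every state $\rho$: $\ |\mathbb E_\rho[\mathcal M]-\operatorname{tr}(\rho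 O)|\le\varepsilon$, $\ |\mathbb V_\rho[\mathcal M]-\mathbb V_\rho[O]|\le C$, $\ |\mathrm{Cov}_\rho(\mathcal M)|\le\mathbb V_\rho[\mathcal M]$; * if moreover $\|O\|\le1$, then for every state $\rho$, with the trace norm $\|\cdot\|_1$, $$\|\mathcal M[\rho]-\rho\|_1\le\varepsilon^{-1}\,C(\log\varepsilon^{-1})^p\,\|[O,\rho]\|_1+5\varepsilon .$$ -/

import Mathlib

open scoped Matrix Matrix.Norms.L2Operator ComplexOrder

noncomputable section

namespace GQPE

/-! ## Matrices, states and Kraus families -/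

/-- Labels of the computational basis of `k` qubits. -/
abbrev Qubits (k : ℕ) : Type := Fin k → Fin 2

section Kraus

variable {S : Type*} [Fintype S] [DecidableEq S]

/-- Quantum states: density matrices. -/
def IsState (ρ : Matrix S S ℂ) : Prop := ρ.PosSemidef ∧ ρ.trace = 1

/-- The trace norm: the sum of the singular values. -/
def traceNorm (A : Matrix S S ℂ) : ℝ :=
  ∑ i, Real.sqrt ((Matrix.isHermitian_conjTranspose_mul_self A).eigenvalues i)

/-- Expectation of the observable `O` in the state `ρ`, that is `tr (ρ O)` (a real number). -/
def obsExpectation (O ρ : Matrix S S ℂ) : ℝ := (ρ * O).trace.re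

/-- Variance of the observable `O` in the state `ρ`. -/
def obsVariance (O ρ : Matrix S S ℂ) : ℝ :=
  (O * O * ρ).trace.re - (obsExpectation O ρ) ^ 2

variable {ι : Type*} [Fintype ι]

/-- The Kraus family `K` defines a quantum channel, hence an instrument. -/
def IsKrausFamily (K : ι → Matrix S S ℂ) : Prop := ∑ i, (K i)ᴴ * K i = 1

/-- The map with Kraus operators `K`. -/
def krausMap (K : ι → Matrix S S ℂ) (ρ : Matrix S S ℂ) : Matrix S S ℂ :=
  ∑ i, K i * ρ * (K i)ᴴ

/-- Expectation of the outcome when the instrument with Kraus operators `K i`, whose `i`-th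
result is recorded as the real number `v i`, is applied to `ρ`. -/
def outcomeExpectation (K : ι → Matrix S S ℂ) (v : ι → ℝ) (ρ : Matrix S S ℂ) : ℝ :=
  ∑ i, v i * (K i * ρ * (K i)ᴴ).trace.re

/-- Variance of the outcome. -/
def outcomeVariance (K : ι → Matrix S S ℂ) (v : ι → ℝ) (ρ : Matrix S S ℂ) : ℝ :=
  ∑ i, (v i - outcomeExpectation K v ρ) ^ 2 * (K i * ρ * (K i)ᴴ).trace.re

/-- Covariance of the outcomes of two successive applications of the instrument to `ρ`. -/
def outcomeCovariance (K : ι → Matrix S S ℂ) (v : ι → ℝ) (ρ : Matrix S S ℂ) : ℝ :=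
  ∑ i, ∑ j, (v i - outcomeExpectation K v ρ) * (v j - outcomeExpectation K v ρ) *
    (K j * K i * ρ * (K i)ᴴ * (K j)ᴴ).trace.re

end Kraus

/-! ## Discretized Gaussian-filtered phase estimation

The readout register consists of `2 m` qubits, so it has `N = 2 ^ (2 m)` basis states; the step
size is `h = 2 ^ (-m)`, so that `N h ^ 2 = 1`. -/

/-- The step size `h`. -/
def step (m : ℕ) : ℝ := (2 ^ m)⁻¹

/-- The quadrature point `(j - N / 2) h`; it is used both for the frequencies `ξ_ℓ` and for the
readout values `ω_j`. -/
def gridPoint (m : ℕ) (j : Fin (2 ^ (2 * m))) : ℝ :=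
  ((j : ℝ) - 2 ^ (2 * m) / 2) * step m

/-- Fourier transform `ξ ↦ ∫ exp (-2 π i ξ ω) g ω dω` of the Gaussian filter
`g ω = (γ √(2π)) ^ (-1/2) * exp (-ω ^ 2 / (4 γ ^ 2))`, in closed form. -/
def gaussHat (γ ξ : ℝ) : ℝ :=
  Real.sqrt (2 * Real.sqrt (2 * Real.pi) * γ) * Real.exp (-(4 * Real.pi ^ 2 * γ ^ 2 * ξ ^ 2))

/-- The normalization constant of the resource state; the sum runs over `1 ≤ ℓ ≤ N - 1`. -/
def normConst (γ : ℝ) (m : ℕ) : ℝ :=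
  Real.sqrt (step m *
    ∑ ℓ : Fin (2 ^ (2 * m)), if (ℓ : ℕ) = 0 then 0 else gaussHat γ (gridPoint m ℓ) ^ 2)

/-- Amplitudes of the Gaussian resource state on the readout register. -/
def resource (γ : ℝ) (m : ℕ) (ℓ : Fin (2 ^ (2 * m))) : ℂ :=
  if (ℓ : ℕ) = 0 then 0
  else ((Real.sqrt (step m) * gaussHat γ (gridPoint m ℓ) / normConst γ m : ℝ) : ℂ)

/-- The shifted quantum Fourier transform on the readout register: the entry in row `j` and
column `ℓ` is `N ^ (-1/2) exp (2 π i (ℓ - N / 2) (j - N / 2) / N)`. -/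
def shiftedQFT (m : ℕ) : Matrix (Fin (2 ^ (2 * m))) (Fin (2 ^ (2 * m))) ℂ := fun j ℓ =>
  ((Real.sqrt (2 ^ (2 * m)))⁻¹ : ℝ) *
    Complex.exp (2 * Real.pi * Complex.I * ((ℓ : ℂ) - 2 ^ (2 * m) / 2) *
      ((j : ℂ) - 2 ^ (2 * m) / 2) / 2 ^ (2 * m))

section Channel

variable {S : Type*} [Fintype S] [DecidableEq S]

/-- The time evolution `exp (-i τ O)`. -/
def evolution (O : Matrix S S ℂ) (τ : ℝ) : Matrix S S ℂ :=
  NormedSpace.exp ((-(Complex.I * (τ : ℂ))) • O)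

/-- The Kraus operator of the readout `j`, that is `⟨j| (1 ⊗ shiftedQFT) W (1 ⊗ |resource⟩)` with
the select unitary `W = ∑ ℓ, exp (-2 π i ξ_ℓ (O / κ)) ⊗ |ℓ⟩⟨ℓ|`. -/
def krausOp (κ γ : ℝ) (m : ℕ) (O : Matrix S S ℂ) (j : Fin (2 ^ (2 * m))) : Matrix S S ℂ :=
  ∑ ℓ, (shiftedQFT m j ℓ * resource γ m ℓ) •
    evolution O (2 * Real.pi * gridPoint m ℓ / κ)

/-- The recorded outcome of the readout `j`: it is `κ ω_j` if `|ω_j| ≤ 2`, and `0` otherwise. -/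
def outcome (κ : ℝ) (m : ℕ) (j : Fin (2 ^ (2 * m))) : ℝ :=
  if |gridPoint m j| ≤ 2 then κ * gridPoint m j else 0

end Channel

/-! ## Circuits with controlled time evolution -/

/-- The operator `U` on `a` qubits acts on the qubits in `T` only. -/
def ActsOn {a : ℕ} (T : Finset (Fin a)) (U : Matrix (Qubits a) (Qubits a) ℂ) : Prop :=
  ∃ u : Matrix (T → Fin 2) (T → Fin 2) ℂ, ∀ x y : Qubits a,
    U x y = if ∀ k, k ∉ T → x k = y k then u (fun k => x k) (fun k => y k) else 0

/-- Elementary gates: unitaries that act on at most two qubits. -/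
def IsElementaryGate {a : ℕ} (U : Matrix (Qubits a) (Qubits a) ℂ) : Prop :=
  U ∈ Matrix.unitaryGroup (Qubits a) ℂ ∧ ∃ T : Finset (Fin a), T.card ≤ 2 ∧ ActsOn T U

/-- Operations of a circuit with `a` ancilla qubits and a system on which the observable `O`
lives: an elementary gate on the ancillas, or the evolution `exp (-i τ O)` of the system
controlled by one ancilla qubit. -/
inductive Op (a : ℕ) : Type
  | gate (U : {U : Matrix (Qubits a) (Qubits a) ℂ // IsElementaryGate U}) : Op a
  | ctrlEvolution (i : Fin a) (τ : ℝ) : Op a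

/-- The amount of controlled evolution time that an operation uses. -/
def Op.time {a : ℕ} : Op a → ℝ
  | .gate _ => 0
  | .ctrlEvolution _ τ => |τ|

/-- The total controlled evolution time of a circuit. -/
def evolutionTime {a : ℕ} (c : List (Op a)) : ℝ := (c.map Op.time).sum

section Semantics

variable {S : Type*} [Fintype S] [DecidableEq S]

/-- The unitary of an operation, on the system and the ancillas. -/
def Op.toMatrix {a : ℕ} (O : Matrix S S ℂ) :
    Op a → Matrix (S × Qubits a) (S × Qubits a) ℂ
  | .gate U => Matrix.kronecker (1 : Matrix S S ℂ) U.1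
  | .ctrlEvolution i τ => fun r q =>
      if r.2 = q.2 then
        (if r.2 i = 1 then evolution O τ r.1 q.1 else (1 : Matrix S S ℂ) r.1 q.1)
      else 0

/-- The unitary of a circuit, whose operations are applied from left to right. -/
def circuitMatrix {a : ℕ} (O : Matrix S S ℂ) :
    List (Op a) → Matrix (S × Qubits a) (S × Qubits a) ℂ
  | [] => 1
  | g :: c => circuitMatrix O c * g.toMatrix O

/-- The operator that a circuit applies to the system when its ancillas start in `|0 ⋯ 0⟩` and
are found in the basis state `z` in the end. -/
def circuitKraus {a : ℕ} (O : Matrix S S ℂ) (c : List (Op a)) (z : Qubits a) : Matrix S S ℂ :=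
  fun s s' => circuitMatrix O c (s, z) (s', fun _ => 0)

/-- The number that the first `k` of `k + w` qubits encode in binary. -/
def readout (k w : ℕ) (z : Qubits (k + w)) : Fin (2 ^ k) :=
  finFunctionFinEquiv fun i => z (Fin.castAdd w i)

/-- The circuit `c` (with `k` readout qubits and `w` work qubits, all initially `|0⟩`) implements
exactly the instrument with Kraus operators `K`: for each `j` and each input `ρ`, the unnormalized
state of the system upon reading out `j` and discarding the work qubits is `K j * ρ * (K j)ᴴ`. -/
def Implements {k w : ℕ} (O : Matrix S S ℂ) (c : List (Op (k + w)))
    (K : Fin (2 ^ k) → Matrix S S ℂ) : Prop :=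
  ∀ (j : Fin (2 ^ k)) (ρ : Matrix S S ℂ),
    ∑ z ∈ Finset.univ.filter (fun z => readout k w z = j),
      circuitKraus O c z * ρ * (circuitKraus O c z)ᴴ = K j * ρ * (K j)ᴴ

end Semantics

end GQPE

end

/-! Statistics. All Kraus operators are functions of `O`, so in its eigenbasis the instrument is a
classical experiment: the state draws an eigenvalue κx, and given x the readout j has probability
`readoutProb`, the squared modulus of a truncated theta series at h(ω_j - x). Poisson summation
makes it a Gaussian in ω_j - x of standard deviation γ, up to errors of order exp(-4^r/8)
(`abs_readoutProb_sub_le`). Here γ = 2^(-s)/(2π) and m = s + r: the scale s sets the resolution of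
the readout, and r the margin by which the ranges and the fineness of the grids exceed the Gaussian
widths. The choice 4^s ~ κ² log ε⁻¹ keeps κγ bounded, hence the added variance, and makes the tail
|ω| > 2 negligible; 4^r ~ log κ + log ε⁻¹ makes the discretization errors smaller than ε even after
multiplication by κ² and by the number of readouts. The bias can be far below the width κγ because
the centred first moment of a Gaussian on a grid is exponentially small wherever its centre lies
(`abs_first_moment_le`, by duality of theta functions). Two successive outcomes are independent
given x, so their covariance is the variance of a conditional mean (`noisy_moments`).

Disturbance. When the outcome is forgotten the Fourier transform drops out and the channel is a
mixture of the evolutions by the times 2πξ_ℓ/κ (`krausMap_eq`). An evolution of time τ moves ρ by at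
most |τ| ‖[O,ρ]‖₁ in trace norm, and the mean of |τ| is O(2^s/κ) = O(log ε⁻¹) (`mean_time_le`).

Circuit. The controlled evolutions and the shifted Fourier transform are standard; the point is the
exact preparation of the resource state. Its amplitudes are exp(-αk²) with |k| a nonnegatively
weighted sum of bits in a sign-magnitude encoding. Expanding the square, the diagonal terms give a
product state, and each cross term is a damping factor applied when two given bits are 1, realized
by rotating a flag qubit and keeping the branch where it stays 0. One more filter removes the string
that stands for ℓ = 0 and tunes the success amplitude to exactly 1/2 = sin(π/6), where one round of
amplitude amplification succeeds with certainty (`amplitude_amplification`,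
`exists_gates_weightState`). This needs success probability at least 1/4 beforehand, an estimate
that holds uniformly in the scales (`prod_signedWeight_le`). -/

noncomputable section

namespace GQPE

/-! ### Controlled rotations as elementary gates -/

section Rotations

variable {a : ℕ}

/-- The basis state `x` with the qubit `t` flipped. -/
def flipBit (t : Fin a) (x : Qubits a) : Qubits a := Function.update x t (1 - x t)

lemma fin_two_one_sub_ne (b : Fin 2) : 1 - b ≠ b := by fin_cases b <;> decide

lemma fin_two_one_sub_one_sub (b : Fin 2) : 1 - (1 - b) = b := by fin_cases b <;> decide

lemma fin_two_eq_zero_or (b : Fin 2) : b = 0 ∨ b = 1 := by fin_cases b <;> decide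

@[simp] lemma flipBit_same (t : Fin a) (x : Qubits a) : flipBit t x t = 1 - x t := by
  simp [flipBit]

lemma flipBit_of_ne {t k : Fin a} (h : k ≠ t) (x : Qubits a) : flipBit t x k = x k := by
  simp [flipBit, h]

@[simp] lemma flipBit_flipBit (t : Fin a) (x : Qubits a) : flipBit t (flipBit t x) = x := by
  ext k
  by_cases h : k = t
  · subst h; simp
  · simp [flipBit_of_ne h]

lemma flipBit_comm (t u : Fin a) (x : Qubits a) :
    flipBit t (flipBit u x) = flipBit u (flipBit t x) := by
  by_cases h : t = u
  · rw [h]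
  · ext k
    by_cases h1 : k = t
    · subst h1; simp [flipBit_of_ne h]
    · by_cases h2 : k = u
      · subst h2; simp [flipBit_of_ne h1]
      · simp [flipBit_of_ne h1, flipBit_of_ne h2]

/-- Equivalence of basis states given by flipping one qubit. -/
def flipEquiv (t : Fin a) : Qubits a ≃ Qubits a where
  toFun := flipBit t
  invFun := flipBit t
  left_inv := flipBit_flipBit t
  right_inv := flipBit_flipBit t

/-- State vectors of `a` qubits. -/
abbrev Vec (a : ℕ) : Type := Qubits a → ℂ

/-- Rotation of the qubit `t` by the angle `f`, which may depend on the other qubits. -/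
def rot (t : Fin a) (f : Qubits a → ℝ) (ψ : Vec a) : Vec a := fun x =>
  (Real.cos (f x) : ℂ) * ψ x +
    (if x t = 0 then -(Real.sin (f x) : ℂ) else (Real.sin (f x) : ℂ)) * ψ (flipBit t x)

/-- The function `f` does not depend on the qubit `t`. -/
def Indep {β : Type*} (t : Fin a) (f : Qubits a → β) : Prop := ∀ x, f (flipBit t x) = f x

lemma rot_apply_zero {t : Fin a} {f : Qubits a → ℝ} {ψ : Vec a} {x : Qubits a} (h : x t = 0) :
    rot t f ψ x = (Real.cos (f x) : ℂ) * ψ x - (Real.sin (f x) : ℂ) * ψ (flipBit t x) := by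
  simp [rot, h]; ring

lemma rot_apply_one {t : Fin a} {f : Qubits a → ℝ} {ψ : Vec a} {x : Qubits a} (h : x t = 1) :
    rot t f ψ x = (Real.cos (f x) : ℂ) * ψ x + (Real.sin (f x) : ℂ) * ψ (flipBit t x) := by
  simp [rot, h]

lemma rot_of_angle_zero {t : Fin a} {f : Qubits a → ℝ} {ψ : Vec a} {x : Qubits a} (h : f x = 0) :
    rot t f ψ x = ψ x := by
  simp [rot, h]

lemma rot_zero (t : Fin a) (ψ : Vec a) : rot t (fun _ => 0) ψ = ψ := by
  ext x; exact rot_of_angle_zero rfl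

lemma rot_rot (t : Fin a) {f g : Qubits a → ℝ} (hg : Indep t g)
    (ψ : Vec a) : rot t f (rot t g ψ) = rot t (f + g) ψ := by
  ext x
  rcases fin_two_eq_zero_or (x t) with h | h
  · have h1 : flipBit t x t = 1 := by simp [h]
    simp only [rot_apply_zero h, rot_apply_one h1, flipBit_flipBit, hg x, Pi.add_apply,
      Real.cos_add, Real.sin_add]
    push_cast; ring
  · have h1 : flipBit t x t = 0 := by simp [h]
    simp only [rot_apply_one h, rot_apply_zero h1, flipBit_flipBit, hg x, Pi.add_apply,
      Real.cos_add, Real.sin_add]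
    push_cast; ring

lemma rot_neg_rot (t : Fin a) {f : Qubits a → ℝ} (hf : Indep t f) (ψ : Vec a) :
    rot t (-f) (rot t f ψ) = ψ := by
  rw [rot_rot t hf, neg_add_cancel]; exact rot_zero t ψ

lemma rot_rot_neg (t : Fin a) {f : Qubits a → ℝ} (hf : Indep t f) (ψ : Vec a) :
    rot t f (rot t (-f) ψ) = ψ := by
  rw [rot_rot t (fun x => by simp [hf x]), add_neg_cancel]; exact rot_zero t ψ

lemma rot_add (t : Fin a) (f : Qubits a → ℝ) (ψ φ : Vec a) :
    rot t f (ψ + φ) = rot t f ψ + rot t f φ := by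
  ext x; simp only [rot, Pi.add_apply]; ring

lemma rot_smul (t : Fin a) (f : Qubits a → ℝ) (c : ℂ) (ψ : Vec a) :
    rot t f (c • ψ) = c • rot t f ψ := by
  ext x; simp only [rot, Pi.smul_apply, smul_eq_mul]; ring

/-- A rotation is orthogonal for the bilinear pairing of state vectors. -/
lemma sum_rot_mul (t : Fin a) {f : Qubits a → ℝ} (hf : Indep t f) (ψ φ : Vec a) :
    ∑ x, rot t f ψ x * φ x = ∑ x, ψ x * rot t (-f) φ x := by
  simp only [rot, add_mul, mul_add, Finset.sum_add_distrib]
  congr 1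
  · refine Finset.sum_congr rfl fun x _ => ?_
    simp; ring
  -- Substituting the flipped basis state moves the flip from ψ to φ. The sign of the sine changes
  -- with the bit, which is the passage from f to -f.
  · rw [← (flipEquiv t).sum_comp]
    refine Finset.sum_congr rfl fun x _ => ?_
    change (if flipBit t x t = 0 then _ else _) * ψ (flipBit t (flipBit t x)) * φ (flipBit t x) = _
    rw [flipBit_flipBit]
    rcases fin_two_eq_zero_or (x t) with h | h <;> simp [h, hf x, flipEquiv] <;> ring

/-- Elementary gates on `a` qubits. -/
abbrev Gate (a : ℕ) : Type := {U : Matrix (Qubits a) (Qubits a) ℂ // IsElementaryGate U}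

/-- The unitary of a list of gates, applied from left to right. -/
def gatesMatrix : List (Gate a) → Matrix (Qubits a) (Qubits a) ℂ
  | [] => 1
  | g :: c => gatesMatrix c * g.1

lemma gatesMatrix_append (c d : List (Gate a)) :
    gatesMatrix (c ++ d) = gatesMatrix d * gatesMatrix c := by
  induction c with
  | nil => simp [gatesMatrix]
  | cons g c ih => simp [gatesMatrix, ih, Matrix.mul_assoc]

/-- The state vector `ψ` is supported in `D`. -/
def SuppIn (D : Set (Qubits a)) (ψ : Vec a) : Prop := ∀ x, x ∉ D → ψ x = 0

/-- On states supported in `D`, the map `T` is the action of a list of at most `n` gates. -/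
def Realizes (D : Set (Qubits a)) (n : ℕ) (T : Vec a → Vec a) : Prop :=
  ∃ c : List (Gate a), c.length ≤ n ∧ ∀ ψ, SuppIn D ψ → gatesMatrix c *ᵥ ψ = T ψ

lemma Realizes.mono {D D' : Set (Qubits a)} {n n' : ℕ} {T T' : Vec a → Vec a}
    (h : Realizes D n T) (hD : D' ⊆ D) (hn : n ≤ n') (hT : ∀ ψ, SuppIn D' ψ → T ψ = T' ψ) :
    Realizes D' n' T' := by
  obtain ⟨c, hc, h⟩ := h
  exact ⟨c, hc.trans hn, fun ψ hψ => (h ψ fun x hx => hψ x fun h' => hx (hD h')).trans (hT ψ hψ)⟩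

lemma Realizes.comp {D D' : Set (Qubits a)} {n n' : ℕ} {T T' : Vec a → Vec a}
    (h' : Realizes D' n' T') (h : Realizes D n T) (hD : ∀ ψ, SuppIn D ψ → SuppIn D' (T ψ)) :
    Realizes D (n + n') (fun ψ => T' (T ψ)) := by
  obtain ⟨c, hc, h⟩ := h
  obtain ⟨c', hc', h'⟩ := h'
  refine ⟨c ++ c', by simp; omega, fun ψ hψ => ?_⟩
  rw [gatesMatrix_append, ← Matrix.mulVec_mulVec, h ψ hψ, h' _ (hD ψ hψ)]

lemma realizes_id (D : Set (Qubits a)) : Realizes D 0 (fun ψ => ψ) :=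
  ⟨[], le_rfl, fun ψ _ => by simp [gatesMatrix]⟩

lemma realizes_of_gate {U : Matrix (Qubits a) (Qubits a) ℂ} (hU : IsElementaryGate U)
    {T : Vec a → Vec a} (h : ∀ ψ, U *ᵥ ψ = T ψ) (D : Set (Qubits a)) : Realizes D 1 T :=
  ⟨[⟨U, hU⟩], le_rfl, fun ψ _ => by simp [gatesMatrix, h]⟩

/-- The matrix of `rot`. -/
def rotMatrix (t : Fin a) (f : Qubits a → ℝ) : Matrix (Qubits a) (Qubits a) ℂ := fun x y =>
  if y = x then (Real.cos (f x) : ℂ)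
  else if y = flipBit t x then
    (if x t = 0 then -(Real.sin (f x) : ℂ) else (Real.sin (f x) : ℂ))
  else 0

lemma flipBit_ne (t : Fin a) (x : Qubits a) : flipBit t x ≠ x := fun h =>
  fin_two_one_sub_ne (x t) (by simpa using congrFun h t)

lemma rotMatrix_mulVec (t : Fin a) (f : Qubits a → ℝ) (ψ : Vec a) :
    rotMatrix t f *ᵥ ψ = rot t f ψ := by
  ext x
  have h : ∀ y, rotMatrix t f x y * ψ y = (if y = x then (Real.cos (f x) : ℂ) * ψ x else 0) +
      (if y = flipBit t x then
        (if x t = 0 then -(Real.sin (f x) : ℂ) else (Real.sin (f x) : ℂ)) * ψ (flipBit t x)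
        else 0) := by
    intro y
    by_cases h1 : y = x
    · subst h1; simp [rotMatrix, (flipBit_ne t y).symm]
    · by_cases h2 : y = flipBit t x
      · subst h2; simp [rotMatrix, flipBit_ne]
      · simp [rotMatrix, h1, h2]
  simp only [Matrix.mulVec, dotProduct, h, Finset.sum_add_distrib, Finset.sum_ite_eq',
    Finset.mem_univ, if_true, rot]

lemma matrix_eq_of_mulVec {n : Type*} [Fintype n] [DecidableEq n] {A B : Matrix n n ℂ}
    (h : ∀ v, A *ᵥ v = B *ᵥ v) : A = B := by
  ext i j
  have := congrFun (h (Pi.single j 1)) i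
  simpa using this

lemma rotMatrix_conjTranspose (t : Fin a) {f : Qubits a → ℝ} (hf : Indep t f) :
    (rotMatrix t f)ᴴ = rotMatrix t (-f) := by
  ext x y
  rw [Matrix.conjTranspose_apply]
  by_cases h1 : x = y
  · subst h1; simp [rotMatrix, -Complex.ofReal_cos]
  · by_cases h2 : x = flipBit t y
    · subst h2
      rcases fin_two_eq_zero_or (y t) with h | h <;>
        simp [rotMatrix, h, flipBit_ne, (flipBit_ne t y).symm, hf y, -Complex.ofReal_sin]
    · have h3 : y ≠ flipBit t x := fun h => h2 (by rw [h, flipBit_flipBit])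
      simp [rotMatrix, h1, h2, h3, Ne.symm h1]

lemma rotMatrix_mem_unitaryGroup (t : Fin a) {f : Qubits a → ℝ} (hf : Indep t f) :
    rotMatrix t f ∈ Matrix.unitaryGroup (Qubits a) ℂ := by
  rw [Matrix.mem_unitaryGroup_iff, Matrix.star_eq_conjTranspose, rotMatrix_conjTranspose t hf]
  refine matrix_eq_of_mulVec fun v => ?_
  rw [← Matrix.mulVec_mulVec, rotMatrix_mulVec, rotMatrix_mulVec, rot_rot_neg t hf,
    Matrix.one_mulVec]

lemma indep_apply {β : Type*} {t c : Fin a} (h : c ≠ t) (θ : Fin 2 → β) :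
    Indep t (fun x : Qubits a => θ (x c)) := fun x => congrArg θ (flipBit_of_ne h x)

/-- Target and control make two qubits. A constant θ gives an uncontrolled rotation, for which `c`
can be any other qubit. -/
lemma realizes_rot {t c : Fin a} (h : c ≠ t) (θ : Fin 2 → ℝ) (D : Set (Qubits a)) :
    Realizes D 1 (rot t fun x => θ (x c)) := by
  refine realizes_of_gate ⟨rotMatrix_mem_unitaryGroup t (indep_apply h θ), {t, c},
    Finset.card_le_two, ?_⟩ (rotMatrix_mulVec t _) D
  have ht : t ∈ ({t, c} : Finset (Fin a)) := by simp
  have hc : c ∈ ({t, c} : Finset (Fin a)) := by simp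
  refine ⟨fun p q => if q = p then (Real.cos (θ (p ⟨c, hc⟩)) : ℂ)
    else if q ⟨t, ht⟩ = 1 - p ⟨t, ht⟩ ∧ q ⟨c, hc⟩ = p ⟨c, hc⟩ then
      (if p ⟨t, ht⟩ = 0 then -(Real.sin (θ (p ⟨c, hc⟩)) : ℂ) else (Real.sin (θ (p ⟨c, hc⟩)) : ℂ))
    else 0, fun x y => ?_⟩
  by_cases hxy : ∀ k, k ∉ ({t, c} : Finset (Fin a)) → x k = y k
  · rw [if_pos hxy]
    have e1 : ((fun k : ({t, c} : Finset (Fin a)) => y k.1) = fun k => x k.1) ↔ y = x := by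
      refine ⟨fun h => funext fun k => ?_, fun h => by rw [h]⟩
      by_cases hk : k ∈ ({t, c} : Finset (Fin a))
      · exact congrFun h ⟨k, hk⟩
      · exact (hxy k hk).symm
    have e2 : (y t = 1 - x t ∧ y c = x c) ↔ y = flipBit t x := by
      refine ⟨fun h' => funext fun k => ?_, fun h' => ?_⟩
      · by_cases h1 : k = t
        · subst h1; simp [h'.1]
        · rw [flipBit_of_ne h1]
          by_cases h2 : k = c
          · subst h2; exact h'.2
          · exact (hxy k (by simp [h1, h2])).symm
      · subst h'; simp [flipBit_of_ne h]
    simp only [rotMatrix, e1, e2]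
  · rw [if_neg hxy]
    push Not at hxy
    obtain ⟨k, hk, hne⟩ := hxy
    have hkt : k ≠ t := fun h => hk (by simp [h])
    have h1 : y ≠ x := fun h => hne (by rw [h])
    have h2 : y ≠ flipBit t x := fun h => hne (by rw [h, flipBit_of_ne hkt])
    simp [rotMatrix, h1, h2]

/-- The case c = d is included and yields phases of a single qubit. -/
lemma realizes_diag (c d : Fin a) (g : Fin 2 → Fin 2 → ℂ) (hg : ∀ i j, ‖g i j‖ = 1)
    (D : Set (Qubits a)) : Realizes D 1 (fun ψ x => g (x c) (x d) * ψ x) := by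
  refine realizes_of_gate (U := Matrix.diagonal fun x => g (x c) (x d))
    ⟨?_, {c, d}, Finset.card_le_two, ?_⟩ (fun ψ => by ext x; simp [Matrix.mulVec_diagonal]) D
  · rw [Matrix.mem_unitaryGroup_iff, Matrix.star_eq_conjTranspose, Matrix.diagonal_conjTranspose,
      Matrix.diagonal_mul_diagonal, ← Matrix.diagonal_one]
    congr 1; ext x
    have := Complex.mul_conj (g (x c) (x d))
    rw [Complex.normSq_eq_norm_sq, hg] at this
    simpa using this
  · have hc : c ∈ ({c, d} : Finset (Fin a)) := by simp
    have hd : d ∈ ({c, d} : Finset (Fin a)) := by simp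
    refine ⟨fun p q => if p = q then g (p ⟨c, hc⟩) (p ⟨d, hd⟩) else 0, fun x y => ?_⟩
    by_cases hxy : ∀ k, k ∉ ({c, d} : Finset (Fin a)) → x k = y k
    · rw [if_pos hxy]
      have e1 : ((fun k : ({c, d} : Finset (Fin a)) => x k.1) = fun k => y k.1) ↔ x = y := by
        refine ⟨fun h => funext fun k => ?_, fun h => by rw [h]⟩
        by_cases hk : k ∈ ({c, d} : Finset (Fin a))
        · exact congrFun h ⟨k, hk⟩
        · exact hxy k hk
      simp only [Matrix.diagonal_apply, e1]
    · rw [if_neg hxy, Matrix.diagonal_apply_ne]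
      rintro rfl; exact hxy fun _ _ => rfl

lemma SuppIn.rot {D : Set (Qubits a)} {t : Fin a} (hD : ∀ x, flipBit t x ∈ D → x ∈ D)
    (f : Qubits a → ℝ) {ψ : Vec a} (h : SuppIn D ψ) : SuppIn D (rot t f ψ) := fun x hx => by
  simp [GQPE.rot, h x hx, h _ fun h' => hx (hD x h')]

/-- Rotation of a qubit controlled by two others. -/
lemma realizes_rot_two {t c d : Fin a} (hc : c ≠ t) (hd : d ≠ t) (p q : Fin 2) (φ : ℝ)
    (D : Set (Qubits a)) :
    Realizes D 4 (rot t fun x => if x c = p ∧ x d = q then φ else 0) := by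
  set sg : Vec a → Vec a := fun ψ x => (if x d = q ∧ x t = 1 then -1 else 1) * ψ x
  have hs : Realizes Set.univ 1 sg :=
    (realizes_diag d t (fun i j => if i = q ∧ j = 1 then -1 else 1)
      (fun i j => by split_ifs <;> simp) Set.univ)
  have hr : ∀ φ, Realizes Set.univ 1 (rot t fun x => if x c = p then φ else 0) := fun φ =>
    realizes_rot hc (fun i => if i = p then φ else 0) Set.univ
  have hu : ∀ ψ : Vec a, SuppIn Set.univ ψ := fun ψ x hx => absurd (Set.mem_univ x) hx
  -- In order of application: sign, rotation by -φ/2, sign, rotation by φ/2. Conjugation by the sign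
  -- on the target reverses a rotation, so the half angles add up where qubit `d` holds `q` and
  -- cancel elsewhere.
  refine ((((hr (φ / 2)).comp hs fun _ _ => hu _).comp (hr (-(φ / 2))) fun _ _ => hu _).comp hs
    fun _ _ => hu _).mono (Set.subset_univ D) le_rfl fun ψ _ => ?_
  have key : ∀ f : Qubits a → ℝ, Indep t f → ∀ ψ, sg (rot t f (sg ψ)) =
      rot t (fun x => if x d = q then - f x else f x) ψ := by
    intro f hf ψ
    ext x
    by_cases h : x d = q <;> rcases fin_two_eq_zero_or (x t) with h1 | h1 <;>
      simp [sg, rot, h, h1, flipBit_of_ne hd] <;> ring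
  rw [key _ (indep_apply hc fun i => if i = p then -(φ / 2) else 0), rot_rot t]
  · congr 1
    ext x
    by_cases h : x c = p <;> by_cases h' : x d = q <;> simp [h, h']
  · intro x; simp [flipBit_of_ne hc, flipBit_of_ne hd]

end Rotations

/-! ### Rotations with many controls -/

section MultiControlled

variable {a : ℕ}

/-- The basis states in which all qubits of the list `ls` are `0`. -/
def clean (ls : List (Fin a)) : Set (Qubits a) := {x | ∀ l ∈ ls, x l = 0}

/-- All the literals `qubit b.1 has value b.2` of the list `B` hold in `x`. -/
def AllHold (B : List (Fin a × Fin 2)) (x : Qubits a) : Prop := ∀ b ∈ B, x b.1 = b.2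

instance (B : List (Fin a × Fin 2)) (x : Qubits a) : Decidable (AllHold B x) :=
  inferInstanceAs (Decidable (∀ b ∈ B, x b.1 = b.2))

lemma allHold_flipBit {B : List (Fin a × Fin 2)} {t : Fin a} (h : ∀ b ∈ B, b.1 ≠ t)
    (x : Qubits a) : AllHold B (flipBit t x) ↔ AllHold B x :=
  forall₂_congr fun b hb => by rw [flipBit_of_ne (h b hb)]

lemma allHold_cons {b : Fin a × Fin 2} {B : List (Fin a × Fin 2)} {x : Qubits a} :
    AllHold (b :: B) x ↔ x b.1 = b.2 ∧ AllHold B x := by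
  simp [AllHold]

/-- Computing the conjunction of two literals into a clean qubit, controlling by that qubit and
uncomputing it amounts to controlling by both literals. -/
lemma rot_ladder {t l c b : Fin a} {q p : Fin 2} {B : List (Fin a × Fin 2)} (φ : ℝ)
    (hlt : l ≠ t) (hlc : l ≠ c) (hlb : l ≠ b) (hct : c ≠ t) (hbt : b ≠ t)
    (hB : ∀ d ∈ B, d.1 ≠ l) {ψ : Vec a} (hψ : SuppIn (clean [l]) ψ) :
    rot l (fun x => if x c = q ∧ x b = p then -(Real.pi / 2) else 0)
      (rot t (fun x => if x l = 1 ∧ AllHold B x then φ else 0)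
        (rot l (fun x => if x c = q ∧ x b = p then Real.pi / 2 else 0) ψ)) =
    rot t (fun x => if x c = q ∧ AllHold ((b, p) :: B) x then φ else 0) ψ := by
  have h0 : ∀ x : Qubits a, x l = 1 → ψ x = 0 := fun x hx => hψ x fun h => by
    have := h l (by simp); rw [hx] at this; exact absurd this (by decide)
  ext x
  -- If both literals hold, the outer rotations flip `l`: the final amplitude at l = 0 comes from
  -- the branch l = 1, where the middle rotation is active, and the amplitude at l = 1 stays 0.
  -- Otherwise the outer rotations are trivial and the middle one is idle on l = 0.
  by_cases h : x c = q ∧ x b = p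
  · rcases fin_two_eq_zero_or (x l) with h1 | h1
    · have h2 : (flipBit l x) l = 1 := by simp [h1]
      rw [rot_apply_zero h1]
      have e : rot l (fun x => if x c = q ∧ x b = p then Real.pi / 2 else 0) ψ (flipBit l x)
          = ψ x := by
        rw [rot_apply_one h2]
        simp [flipBit_of_ne hlc.symm, flipBit_of_ne hlb.symm, h]
      have e' : rot l (fun x => if x c = q ∧ x b = p then Real.pi / 2 else 0) ψ
          (flipBit t (flipBit l x)) = ψ (flipBit t x) := by
        rw [rot_apply_one (by rw [flipBit_of_ne hlt]; exact h2), flipBit_comm]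
        simp [flipBit_of_ne hlc.symm, flipBit_of_ne hlb.symm, flipBit_of_ne hct,
          flipBit_of_ne hbt, h]
      generalize rot l (fun x => if x c = q ∧ x b = p then Real.pi / 2 else 0) ψ = X at e e' ⊢
      simp only [h, and_self, if_true, Real.cos_neg, Real.cos_pi_div_two, Real.sin_neg,
        Real.sin_pi_div_two]
      simp only [rot, e, e', h2, allHold_flipBit hB, flipBit_of_ne hlt.symm, true_and,
        allHold_cons, h]
      simp
    · have h2 : (flipBit l x) l = 0 := by simp [h1]
      rw [rot_apply_one h1]
      have e : rot t (fun x => if x l = 1 ∧ AllHold B x then φ else 0)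
          (rot l (fun x => if x c = q ∧ x b = p then Real.pi / 2 else 0) ψ) (flipBit l x)
          = 0 := by
        rw [rot_of_angle_zero (by simp only [h2]; simp), rot_apply_zero h2]
        simp [flipBit_of_ne hlc.symm, flipBit_of_ne hlb.symm, h, h0 x h1]
      rw [e]
      simp only [rot, h0 x h1, h0 (flipBit t x) (by rw [flipBit_of_ne hlt]; exact h1)]
      simp [h]
  · rw [rot_of_angle_zero (by simp [h])]
    have e : ∀ y : Qubits a, ¬ (y c = q ∧ y b = p) →
        rot l (fun x => if x c = q ∧ x b = p then Real.pi / 2 else 0) ψ y = ψ y :=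
      fun y hy => rot_of_angle_zero (by simp [hy])
    have h' : ¬ (flipBit t x c = q ∧ flipBit t x b = p) := by
      rwa [flipBit_of_ne hct, flipBit_of_ne hbt]
    have h3 : ¬ (x c = q ∧ AllHold ((b, p) :: B) x) := fun h' =>
      h ⟨h'.1, (allHold_cons.1 h'.2).1⟩
    rw [rot_of_angle_zero (f := fun x => if x c = q ∧ AllHold ((b, p) :: B) x then φ else 0)
      (by simp [h3])]
    have e1 := e x h
    have e2 := e _ h'
    generalize rot l (fun x => if x c = q ∧ x b = p then Real.pi / 2 else 0) ψ = X at e1 e2 ⊢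
    simp only [rot, e1, e2]
    rcases fin_two_eq_zero_or (x l) with h1 | h1
    · simp [h1]
    · simp [h0 x h1, h0 (flipBit t x) (by rw [flipBit_of_ne hlt]; exact h1)]

lemma flipBit_mem_clean {t : Fin a} {ls : List (Fin a)} (ht : t ∉ ls) {x : Qubits a} :
    flipBit t x ∈ clean ls ↔ x ∈ clean ls :=
  forall₂_congr fun l hl => by rw [flipBit_of_ne (by rintro rfl; exact ht hl)]

lemma SuppIn.mono {D D' : Set (Qubits a)} {ψ : Vec a} (h : SuppIn D ψ) (hD : D ⊆ D') :
    SuppIn D' ψ := fun x hx => h x fun h' => hx (hD h')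

lemma SuppIn.rot_clean {ls : List (Fin a)} {t : Fin a} (ht : t ∉ ls) (f : Qubits a → ℝ)
    {ψ : Vec a} (h : SuppIn (clean ls) ψ) : SuppIn (clean ls) (GQPE.rot t f ψ) :=
  h.rot (fun _ => (flipBit_mem_clean ht).1) f

/-- Recursion on the ladder: the current control and the next literal are merged into a clean qubit,
which becomes the control for the remaining literals. Each literal costs one clean qubit and two
doubly controlled rotations of 4 gates, hence the 8. -/
lemma realizes_rot_literals (φ : ℝ) {t : Fin a} (B : List (Fin a × Fin 2)) :
    ∀ (ls : List (Fin a)) (c : Fin a) (q : Fin 2), B.length ≤ ls.length → ls.Nodup → t ∉ ls →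
      c ≠ t → c ∉ ls → (∀ b ∈ B, b.1 ≠ t) → (∀ b ∈ B, b.1 ∉ ls) →
      Realizes (clean ls) (1 + 8 * B.length)
        (rot t fun x => if x c = q ∧ AllHold B x then φ else 0) := by
  induction B with
  | nil =>
    intro ls c q _ _ _ hct _ _ _
    refine (realizes_rot hct (fun i => if i = q then φ else 0) (clean ls)).mono
      subset_rfl le_rfl fun ψ _ => ?_
    simp [AllHold]
  | cons b B ih =>
    intro ls c q hlen hnd ht hct hc hBt hBl
    obtain ⟨b, p⟩ := b
    cases ls with
    | nil => simp at hlen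
    | cons l ls =>
      simp only [List.length_cons, Nat.add_le_add_iff_right, List.nodup_cons, List.mem_cons,
        not_or, forall_eq_or_imp] at hlen hnd ht hc hBt hBl
      have h1 := realizes_rot_two (t := l) (Ne.intro hc.1) (Ne.intro hBl.1.1) q p (Real.pi / 2)
        (clean (l :: ls))
      have h2 := ih ls l 1 hlen hnd.2 ht.2 (Ne.symm ht.1) hnd.1 hBt.2 fun b hb => (hBl.2 b hb).2
      have h3 := realizes_rot_two (t := l) (Ne.intro hc.1) (Ne.intro hBl.1.1) q p
        (-(Real.pi / 2)) Set.univ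
      have hsub : clean (l :: ls) ⊆ clean ls := fun x hx k hk => hx k (List.mem_cons_of_mem _ hk)
      refine (h3.comp (h2.comp h1 fun ψ hψ => (hψ.mono hsub).rot_clean hnd.1 _)
        fun ψ _ x hx => absurd (Set.mem_univ x) hx).mono subset_rfl (by simp; omega)
        fun ψ hψ => ?_
      exact rot_ladder φ (Ne.symm ht.1) (Ne.symm hc.1) (Ne.symm hBl.1.1) hct hBt.1
        (fun d hd => (hBl.2 d hd).1) (hψ.mono fun x hx k hk => hx k (by simp at hk; simp [hk]))

/-- A rotation controlled by a list of literals, with clean work qubits `ls`. -/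
lemma realizes_rot_allHold (φ : ℝ) {t : Fin a} {B : List (Fin a × Fin 2)} {ls : List (Fin a)}
    (hB : B ≠ []) (hlen : B.length ≤ ls.length) (hnd : ls.Nodup) (ht : t ∉ ls)
    (hBt : ∀ b ∈ B, b.1 ≠ t) (hBl : ∀ b ∈ B, b.1 ∉ ls) :
    Realizes (clean ls) (8 * B.length) (rot t fun x => if AllHold B x then φ else 0) := by
  cases B with
  | nil => exact absurd rfl hB
  | cons b B =>
    simp only [List.mem_cons, forall_eq_or_imp, List.length_cons] at hBt hBl hlen
    refine (realizes_rot_literals φ B ls b.1 b.2 (by omega) hnd ht hBt.1 hBl.1 hBt.2 hBl.2).mono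
      subset_rfl (by simp; omega) fun ψ _ => ?_
    simp only [allHold_cons]

end MultiControlled

/-! ### Exact amplitude amplification -/

section RotationCircuits

variable {a : ℕ}

/-- Apply a list of rotations from left to right. -/
def act : List (Fin a × (Qubits a → ℝ)) → Vec a → Vec a
  | [], ψ => ψ
  | g :: c, ψ => act c (rot g.1 g.2 ψ)

/-- The inverse of a list of rotations. -/
def invRots (c : List (Fin a × (Qubits a → ℝ))) : List (Fin a × (Qubits a → ℝ)) :=
  (c.map fun g => (g.1, -g.2)).reverse

/-- Each angle is independent of the rotated qubit. -/
def GoodRots (c : List (Fin a × (Qubits a → ℝ))) : Prop := ∀ g ∈ c, Indep g.1 g.2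

lemma act_append (c d : List (Fin a × (Qubits a → ℝ))) (ψ : Vec a) :
    act (c ++ d) ψ = act d (act c ψ) := by
  induction c generalizing ψ with
  | nil => rfl
  | cons g c ih => exact ih _

lemma act_sub (c : List (Fin a × (Qubits a → ℝ))) (ψ φ : Vec a) :
    act c (ψ - φ) = act c ψ - act c φ := by
  induction c generalizing ψ φ with
  | nil => rfl
  | cons g c ih =>
    simp only [act]
    rw [← ih, sub_eq_add_neg, rot_add, ← neg_one_smul ℂ φ, rot_smul, neg_one_smul, ← sub_eq_add_neg]

lemma invRots_cons (g : Fin a × (Qubits a → ℝ)) (c : List (Fin a × (Qubits a → ℝ))) :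
    invRots (g :: c) = invRots c ++ [(g.1, -g.2)] := by simp [invRots]

lemma act_act_invRots {c : List (Fin a × (Qubits a → ℝ))} (hc : GoodRots c) (ψ : Vec a) :
    act c (act (invRots c) ψ) = ψ := by
  induction c generalizing ψ with
  | nil => rfl
  | cons g c ih =>
    rw [invRots_cons, act_append]
    simp only [act]
    rw [rot_rot_neg _ (hc g (by simp)), ih fun g hg => hc g (by simp [hg])]

lemma act_invRots_act {c : List (Fin a × (Qubits a → ℝ))} (hc : GoodRots c) (ψ : Vec a) :
    act (invRots c) (act c ψ) = ψ := by
  induction c generalizing ψ with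
  | nil => rfl
  | cons g c ih =>
    rw [invRots_cons, act_append]
    simp only [act]
    rw [ih fun g hg => hc g (by simp [hg]), rot_neg_rot _ (hc g (by simp))]

/-- The matrix entries of rotations are real, so the transpose is the inverse circuit and a bilinear
pairing without conjugation suffices. -/
lemma sum_act_mul {c : List (Fin a × (Qubits a → ℝ))} (hc : GoodRots c) (ψ φ : Vec a) :
    ∑ x, act c ψ x * φ x = ∑ x, ψ x * act (invRots c) φ x := by
  induction c generalizing ψ φ with
  | nil => rfl
  | cons g c ih =>
    rw [invRots_cons, act_append]
    simp only [act]
    rw [ih fun g hg => hc g (by simp [hg]), sum_rot_mul _ (hc g (by simp))]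

lemma SuppIn.act {ls : List (Fin a)} {c : List (Fin a × (Qubits a → ℝ))}
    (hc : ∀ g ∈ c, g.1 ∉ ls) {ψ : Vec a} (h : SuppIn (clean ls) ψ) :
    SuppIn (clean ls) (act c ψ) := by
  induction c generalizing ψ with
  | nil => exact h
  | cons g c ih =>
    exact ih (fun g hg => hc g (by simp [hg])) (h.rot_clean (hc g (by simp)) _)

lemma realizes_act {ls : List (Fin a)} {c : List (Fin a × (Qubits a → ℝ))}
    (hc : ∀ g ∈ c, g.1 ∉ ls) {n : Fin a × (Qubits a → ℝ) → ℕ}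
    (h : ∀ g ∈ c, Realizes (clean ls) (n g) (rot g.1 g.2)) :
    Realizes (clean ls) (c.map n).sum (act c) := by
  induction c with
  | nil => exact realizes_id _
  | cons g c ih =>
    have := (ih (fun g hg => hc g (by simp [hg])) fun g hg => h g (by simp [hg])).comp
      (h g (by simp)) fun ψ hψ => hψ.rot_clean (hc g (by simp)) _
    simpa [GQPE.act] using this

/-- The basis state `|0 ⋯ 0⟩`. -/
def zeroVec (a : ℕ) : Vec a := Pi.single (fun _ => 0) 1

/-- Reflection that changes the sign of the basis states in which all literals of `B` hold. -/
lemma rot_pi_allHold {t : Fin a} {B : List (Fin a × Fin 2)} (ψ : Vec a) (x : Qubits a) :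
    rot t (fun x => if AllHold B x then Real.pi else 0) ψ x =
      if AllHold B x then -ψ x else ψ x := by
  by_cases h : AllHold B x <;> simp [rot, h]

/-- One round of exact amplitude amplification: if the part of `act c |0⟩` in which the literals
of `Bg` hold is half of a unit vector `G`, then `G` can be prepared. -/
theorem amplitude_amplification {ls : List (Fin a)} {c : List (Fin a × (Qubits a → ℝ))}
    (hc : GoodRots c) {t u : Fin a} (hut : u ≠ t) (hcl : ∀ g ∈ c, g.1 ∉ t :: ls)
    {Bg B0 : List (Fin a × Fin 2)}
    (hBg : Bg ≠ []) (hBgl : Bg.length ≤ ls.length) (hBgc : ∀ b ∈ Bg, b.1 ∉ t :: ls)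
    (hB0 : B0 ≠ []) (hB0l : B0.length ≤ ls.length) (hB0c : ∀ b ∈ B0, b.1 ∉ t :: ls)
    (hnd : (t :: ls).Nodup)
    (hB0' : ∀ x ∈ clean (t :: ls), AllHold B0 x ↔ x = fun _ => 0)
    {N : ℕ} (hN : Realizes (clean ls) N (act c)) (hN' : Realizes (clean ls) N (act (invRots c)))
    {G : Vec a} (hG : ∀ x, (if AllHold Bg x then act c (zeroVec a) x else 0) = (1 / 2) * G x)
    (hG1 : ∑ x, G x * G x = 1) :
    ∃ d : List (Gate a), d.length ≤ 3 * N + 8 * Bg.length + 8 * B0.length + 1 ∧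
      gatesMatrix d *ᵥ zeroVec a = G := by
  simp only [List.nodup_cons] at hnd
  have hcl' : ∀ g ∈ c, g.1 ∉ ls := fun g hg h => hcl g hg (by simp [h])
  have hci : ∀ g ∈ invRots c, g.1 ∉ t :: ls := fun g hg => by
    simp only [invRots, List.mem_reverse, List.mem_map] at hg
    obtain ⟨g', hg', rfl⟩ := hg
    exact hcl g' hg'
  have hsg := realizes_rot_allHold Real.pi (t := t) hBg hBgl hnd.2 hnd.1
    (fun b hb h => hBgc b hb (by simp [h])) (fun b hb h => hBgc b hb (by simp [h]))
  have hs0 := realizes_rot_allHold Real.pi (t := t) hB0 hB0l hnd.2 hnd.1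
    (fun b hb h => hB0c b hb (by simp [h])) (fun b hb h => hB0c b hb (by simp [h]))
  -- A rotation of the spare qubit by π is multiplication by -1; it corrects the global sign at the
  -- end.
  have hneg := realizes_rot hut (fun _ => Real.pi) (clean ls)
  have h1 := hsg.comp hN fun ψ hψ => hψ.act hcl'
  have h2 := hN'.comp h1 fun ψ hψ => (hψ.act hcl').rot_clean hnd.1 _
  have hci' : ∀ g ∈ invRots c, g.1 ∉ ls := fun g hg h => hci g hg (by simp [h])
  have h3 := hs0.comp h2 fun ψ hψ => ((hψ.act hcl').rot_clean hnd.1 _).act hci'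
  have h4 := hN.comp h3 fun ψ hψ => (((hψ.act hcl').rot_clean hnd.1 _).act hci').rot_clean hnd.1 _
  have h5 := hneg.comp h4 fun ψ hψ =>
    ((((hψ.act hcl').rot_clean hnd.1 _).act hci').rot_clean hnd.1 _).act hcl'
  obtain ⟨d, hd, hdT⟩ := h5
  refine ⟨d, by omega, ?_⟩
  have hz : SuppIn (clean (t :: ls)) (zeroVec a) := fun x hx => by
    refine Pi.single_eq_of_ne ?_ _
    rintro rfl
    exact hx fun _ _ => rfl
  rw [hdT _ (hz.mono fun x hx k hk => hx k (by simp [hk]))]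
  set A0 := act c (zeroVec a) with hA0
  -- The good part of the state is G/2, so reversing its sign subtracts G.
  have hsgA : rot t (fun x => if AllHold Bg x then Real.pi else 0) A0 = A0 - G := by
    ext x
    rw [rot_pi_allHold, Pi.sub_apply]
    have := hG x
    split_ifs at this ⊢
    · linear_combination (-2 : ℂ) * this
    · linear_combination (-2 : ℂ) * this
  beta_reduce
  rw [← hA0, hsgA, act_sub, hA0, act_invRots_act hc]
  have hGs : SuppIn (clean (t :: ls)) G := fun x hx => by
    have := hG x
    rw [hA0, hz.act hcl x hx] at this
    simpa using this
  set χ := zeroVec a - act (invRots c) G with hχ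
  have hχs : SuppIn (clean (t :: ls)) χ := fun x hx => by
    rw [hχ, Pi.sub_apply, hz x hx, hGs.act hci x hx, sub_zero]
  have hAG : ∑ x, A0 x * G x = 1 / 2 := by
    have : ∀ x, A0 x * G x = (1 / 2) * (G x * G x) := fun x => by
      have := hG x
      split_ifs at this
      · rw [this]; ring
      · have h0 : G x = 0 := by simpa using this.symm
        simp [h0]
    simp_rw [this, ← Finset.mul_sum, hG1, mul_one]
  -- This amplitude is 1 - ⟨A0, G⟩, and the pairing is 1/2 because the success amplitude is. Hence
  -- the reflection about the zero state subtracts exactly that basis vector, and what is left is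
  -- minus the preimage of G.
  have hχ0 : χ (fun _ => 0) = 1 / 2 := by
    rw [hA0, sum_act_mul hc] at hAG
    have e : ∑ x, zeroVec a x * act (invRots c) G x = act (invRots c) G fun _ => 0 := by
      simp [zeroVec, Pi.single_apply]
    rw [hχ, Pi.sub_apply, ← e, hAG]
    simp [zeroVec]; norm_num
  have hs : rot t (fun x => if AllHold B0 x then Real.pi else 0) χ = χ - zeroVec a := by
    ext x
    rw [rot_pi_allHold, Pi.sub_apply]
    by_cases hx : x ∈ clean (t :: ls)
    · by_cases h : x = fun _ => 0
      · rw [if_pos ((hB0' x hx).2 h), h, hχ0]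
        simp [zeroVec]; norm_num
      · rw [if_neg fun h' => h ((hB0' x hx).1 h'), zeroVec, Pi.single_eq_of_ne h, sub_zero]
    · simp [hχs x hx, hz x hx]
  rw [hs, hχ, act_sub, act_sub, act_act_invRots hc]
  ext x
  simp [rot]

end RotationCircuits

/-! ### Filters that multiply amplitudes by cosines -/

section FilteredStates

variable {a : ℕ}

/-- The basis state `x` with the qubits of the list `ts` reset to `0`. -/
def zeroOut (ts : List (Fin a)) (x : Qubits a) : Qubits a := fun k => if k ∈ ts then 0 else x k

lemma zeroOut_of_clean {ts : List (Fin a)} {x : Qubits a} (h : x ∈ clean ts) :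
    zeroOut ts x = x := by
  ext k
  by_cases hk : k ∈ ts
  · simp [zeroOut, hk, h k hk]
  · simp [zeroOut, hk]

/-- Rotations of different qubits, all initially `0`. -/
lemma act_product (fs : List (Fin a × (Qubits a → ℝ))) (hnd : (fs.map Prod.fst).Nodup)
    (x : Qubits a)
    (hf : ∀ g ∈ fs, ∀ y : Qubits a, (∀ k ∉ fs.map Prod.fst, y k = x k) → g.2 y = g.2 x)
    (ψ : Vec a) (hψ : ∀ y : Qubits a, (∀ k ∉ fs.map Prod.fst, y k = x k) →
      (∃ t ∈ fs.map Prod.fst, y t ≠ 0) → ψ y = 0) :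
    act fs ψ x = (fs.map fun g => if x g.1 = 0 then (Real.cos (g.2 x) : ℂ)
      else (Real.sin (g.2 x) : ℂ)).prod * ψ (zeroOut (fs.map Prod.fst) x) := by
  induction fs generalizing ψ with
  | nil =>
    have : zeroOut [] x = x := by ext k; simp [zeroOut]
    simp [act, this]
  | cons g fs ih =>
    obtain ⟨t, f⟩ := g
    simp only [List.map_cons, List.nodup_cons, List.mem_cons, not_or] at hnd hf hψ
    simp only [act, List.map_cons, List.prod_cons]
    rw [ih hnd.2 (fun g hg y hy => hf g (Or.inr hg) y fun k hk => hy k hk.2)]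
    · set z := zeroOut (fs.map Prod.fst) x with hz
      have hzx : ∀ k ∉ fs.map Prod.fst, z k = x k := fun k hk => by simp only [hz, zeroOut, if_neg hk]
      have hzt : z t = x t := hzx t hnd.1
      have hfz : f z = f x := hf _ (Or.inl rfl) z fun k hk => hzx k hk.2
      rcases fin_two_eq_zero_or (x t) with h | h
      · have e : zeroOut (t :: fs.map Prod.fst) x = z := by
          ext k
          by_cases hk : k = t
          · subst hk; simp [zeroOut, hzt, h]
          · simp only [hz, zeroOut, List.mem_cons, hk, false_or]
        rw [rot_apply_zero (hzt.trans h), hψ (flipBit t z), e, hfz, if_pos h]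
        · ring
        · intro k hk
          rw [flipBit_of_ne hk.1, hzx k hk.2]
        · exact ⟨t, Or.inl rfl, by simp [hzt, h]⟩
      · have e : zeroOut (t :: fs.map Prod.fst) x = flipBit t z := by
          ext k
          by_cases hk : k = t
          · subst hk; simp [zeroOut, hzt, h]
          · rw [flipBit_of_ne hk]; simp only [hz, zeroOut, List.mem_cons, hk, false_or]
        rw [rot_apply_one (hzt.trans h), hψ z, e, hfz, if_neg (by simp [h])]
        · ring
        · intro k hk
          exact hzx k hk.2
        · exact ⟨t, Or.inl rfl, by simp [hzt, h]⟩
    · rintro y hy ⟨u, hu, hyu⟩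
      have hut : u ≠ t := by rintro rfl; exact hnd.1 hu
      rw [rot, hψ y (fun k hk => hy k hk.2) ⟨u, Or.inr hu, hyu⟩, hψ (flipBit t y)
        (fun k hk => by rw [flipBit_of_ne hk.1, hy k hk.2])
        ⟨u, Or.inr hu, by rwa [flipBit_of_ne hut]⟩]
      simp

variable {M : ℕ}

/-- A round of filters: each flag `fl j` is rotated by the angle `θ j`; then the qubit `g` is set
to `1` unless all flags are `0`. -/
def filterRound (fl : Fin M → Fin a) (θ : Fin M → Qubits a → ℝ) (g : Fin a) :
    List (Fin a × (Qubits a → ℝ)) :=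
  (List.finRange M).map (fun j => (fl j, θ j)) ++
    [(g, fun _ => Real.pi / 2), (g, fun x =>
      if AllHold ((List.finRange M).map fun j => (fl j, 0)) x then -(Real.pi / 2) else 0)]

lemma allHold_flags {fl : Fin M → Fin a} {x : Qubits a} :
    AllHold ((List.finRange M).map fun j => (fl j, 0)) x ↔ ∀ j, x (fl j) = 0 := by
  simp [AllHold]

/-- A flag rotated by θ keeps amplitude cos θ on 0. The first rotation by π/2 sets `g` to 1 and the
second undoes this exactly when all flags are 0, so selecting g = 0 selects clean flags. The
condition `hψ` is local, restricted to states that agree with `x` off the flags, since flags may be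
dirty where an earlier round has failed. -/
lemma act_filterRound {fl : Fin M → Fin a} (hfl : Function.Injective fl) {g : Fin a}
    (hg : ∀ j, fl j ≠ g) {θ : Fin M → Qubits a → ℝ}
    (hθ : ∀ j (x y : Qubits a), (∀ k, (∀ i, k ≠ fl i) → y k = x k) → θ j y = θ j x)
    {ψ : Vec a} (hψg : ∀ x, x g ≠ 0 → ψ x = 0) (x : Qubits a) (hxg : x g = 0)
    (hψ : ∀ y, (∀ k, (∀ i, k ≠ fl i) → y k = x k) → (∃ j, y (fl j) ≠ 0) → ψ y = 0) :
    act (filterRound fl θ g) ψ x =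
      if ∀ j, x (fl j) = 0 then (∏ j, (Real.cos (θ j x) : ℂ)) * ψ x else 0 := by
  rw [filterRound, act_append]
  set fs := (List.finRange M).map fun j => (fl j, θ j) with hfs
  have hts : fs.map Prod.fst = (List.finRange M).map fl := by
    simp [hfs, Function.comp_def]
  have hχg : ∀ y, y g ≠ 0 → act fs ψ y = 0 := by
    have h : SuppIn (clean [g]) ψ := fun y hy => hψg y fun h => hy fun k hk => by
      simp only [List.mem_singleton] at hk; rw [hk, h]
    have h' := h.act (c := fs) fun p hp => by
      simp only [hfs, List.mem_map] at hp
      obtain ⟨j, _, rfl⟩ := hp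
      simpa using hg j
    exact fun y hy => h' y fun h'' => hy (h'' g (by simp))
  simp only [act]
  have h1 : flipBit g x g = 1 := by simp [hxg]
  rw [rot_apply_zero hxg, rot_apply_zero hxg, rot_apply_one h1, flipBit_flipBit]
  simp only [allHold_flags]
  by_cases hx : ∀ j, x (fl j) = 0
  · simp only [if_pos hx]
    have hz : zeroOut (fs.map Prod.fst) x = x := zeroOut_of_clean fun l hl => by
      rw [hts, List.mem_map] at hl
      obtain ⟨j, _, rfl⟩ := hl
      exact hx j
    rw [act_product fs (by rw [hts]; exact (List.nodup_finRange M).map hfl) x, hz]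
    · have hp : (fs.map fun p => if x p.1 = 0 then (Real.cos (p.2 x) : ℂ)
          else (Real.sin (p.2 x) : ℂ)).prod = ∏ j, (Real.cos (θ j x) : ℂ) := by
        rw [hfs, List.map_map, ← List.prod_ofFn, List.ofFn_eq_map]
        congr 1
        refine List.map_congr_left fun j _ => ?_
        simp [hx j]
      rw [hp]
      simp
    · intro p hp y hy
      simp only [hfs, List.mem_map] at hp
      obtain ⟨j, _, rfl⟩ := hp
      refine hθ j x y fun k hk => hy k ?_
      rw [hts, List.mem_map]
      rintro ⟨i, _, rfl⟩
      exact hk i rfl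
    · rintro y hy ⟨t, ht, hyt⟩
      rw [hts, List.mem_map] at ht
      obtain ⟨j, _, rfl⟩ := ht
      refine hψ y (fun k hk => hy k ?_) ⟨j, hyt⟩
      rw [hts, List.mem_map]
      rintro ⟨i, _, rfl⟩
      exact hk i rfl
  · simp only [if_neg hx]
    rw [hχg (flipBit g x) (by rw [h1]; decide)]
    simp

/-- Several rounds of filters, with one qubit `gs k` for each of them. -/
def filterRounds (fl : Fin M → Fin a) (θ : Fin M → Fin M → Qubits a → ℝ) (gs : Fin M → Fin a)
    (ks : List (Fin M)) : List (Fin a × (Qubits a → ℝ)) :=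
  ks.flatMap fun k => filterRound fl (θ k) (gs k)

/-- Flags are never reset. A branch with a dirty flag is marked by the qubit of its round, so where
all round qubits are 0 each round starts with clean flags; thus M flags serve M² filters. -/
lemma act_filterRounds {fl : Fin M → Fin a} (hfl : Function.Injective fl) {gs : Fin M → Fin a}
    (hgs : Function.Injective gs) (hg : ∀ j k, fl j ≠ gs k) {θ : Fin M → Fin M → Qubits a → ℝ}
    (hθ : ∀ k j (x y : Qubits a), (∀ i, (∀ l, i ≠ fl l) → y i = x i) → θ k j y = θ k j x)
    (ks : List (Fin M)) (hks : ks.Nodup) {ψ : Vec a}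
    (hψg : ∀ k ∈ ks, ∀ x, x (gs k) ≠ 0 → ψ x = 0)
    (hψ : ∀ y, (∀ k, y (gs k) = 0) → (∃ j, y (fl j) ≠ 0) → ψ y = 0) (x : Qubits a)
    (hxg : ∀ k, x (gs k) = 0) :
    act (filterRounds fl θ gs ks) ψ x =
      if ∀ j, x (fl j) = 0 then
        (ks.map fun k => ∏ j, (Real.cos (θ k j x) : ℂ)).prod * ψ x else 0 := by
  induction ks generalizing ψ with
  | nil =>
    simp only [filterRounds, List.flatMap_nil, act, List.map_nil, List.prod_nil, one_mul]
    split_ifs with h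
    · rfl
    · push Not at h; exact hψ x hxg h
  | cons k ks ih =>
    simp only [filterRounds, List.flatMap_cons, act_append] at ih ⊢
    simp only [List.nodup_cons] at hks
    have key : ∀ y : Qubits a, (∀ k, y (gs k) = 0) →
        act (filterRound fl (θ k) (gs k)) ψ y =
          if ∀ j, y (fl j) = 0 then (∏ j, (Real.cos (θ k j y) : ℂ)) * ψ y else 0 := by
      intro y hy
      refine act_filterRound hfl (fun j => hg j k) (hθ k)
        (hψg k (by simp)) y (hy k) fun z hz hzj => hψ z (fun i => ?_) hzj
      rw [hz _ fun l => (hg l i).symm, hy i]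
    rw [ih hks.2]
    · split_ifs with h
      · rw [key x hxg, if_pos h, List.map_cons, List.prod_cons]; ring
      · rfl
    · intro i hi
      have hik : gs i ≠ gs k := fun h => hks.1 (hgs h ▸ hi)
      have h : SuppIn (clean [gs i]) ψ := fun y hy =>
        hψg i (by simp [hi]) y fun h => hy fun l hl => by
          simp only [List.mem_singleton] at hl; rw [hl, h]
      have h' := h.act (c := filterRound fl (θ k) (gs k)) fun p hp => by
        simp only [filterRound, List.mem_append, List.mem_map, List.mem_cons, List.not_mem_nil,
          or_false] at hp
        rcases hp with ⟨j, _, rfl⟩ | rfl | rfl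
        · simpa using hg j i
        · simpa using hik.symm
        · simpa using hik.symm
      exact fun y hy => h' y fun h'' => hy (h'' _ (by simp))
    · rintro y hy ⟨j, hj⟩
      rw [key y hy, if_neg fun h => hj (h j)]

end FilteredStates

/-! ### Layout of the qubits and the filter circuit -/

section Preparation

/-- The number of work qubits of the circuit with `M` readout qubits. -/
abbrev workQubits (M : ℕ) : ℕ := 5 * M + 3

variable {M : ℕ}

/-- The readout qubits. -/
def regQ (r : Fin M) : Fin (M + workQubits M) := Fin.castAdd _ r

/-- The qubits that flag the failure of a filter within one round. -/
def flagQ (j : Fin M) : Fin (M + workQubits M) := ⟨M + j, by simp only [workQubits]; omega⟩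

/-- The qubits that flag the failure of a round. -/
def roundQ (k : Fin M) : Fin (M + workQubits M) := ⟨2 * M + k, by simp only [workQubits]; omega⟩

/-- The qubit of the last filter, which adjusts the total success amplitude. -/
def finalQ : Fin (M + workQubits M) := ⟨3 * M, by simp only [workQubits]; omega⟩

/-- The target of the reflections. -/
def spareQ : Fin (M + workQubits M) := ⟨3 * M + 1, by simp only [workQubits]; omega⟩

/-- The clean qubits used for multiply controlled rotations. -/
def ladderQ (i : Fin (3 * M + 1)) : Fin (M + workQubits M) :=
  ⟨3 * M + 2 + i, by simp only [workQubits]; omega⟩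

/-- The list of the clean qubits. -/
def ladder (M : ℕ) : List (Fin (M + workQubits M)) := (List.finRange (3 * M + 1)).map ladderQ

@[simp] lemma val_regQ (r : Fin M) : (regQ r).val = r := rfl
@[simp] lemma val_flagQ (j : Fin M) : (flagQ j).val = M + j := rfl
@[simp] lemma val_roundQ (k : Fin M) : (roundQ k).val = 2 * M + k := rfl
@[simp] lemma val_finalQ : (finalQ : Fin (M + workQubits M)).val = 3 * M := rfl
@[simp] lemma val_spareQ : (spareQ : Fin (M + workQubits M)).val = 3 * M + 1 := rfl
@[simp] lemma val_ladderQ (i : Fin (3 * M + 1)) : (ladderQ i).val = 3 * M + 2 + i := rfl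

lemma regQ_injective : Function.Injective (regQ (M := M)) := fun i j h => by
  have := congrArg Fin.val h; simp at this; omega

lemma flagQ_injective : Function.Injective (flagQ (M := M)) := fun i j h => by
  have := congrArg Fin.val h; simp at this; omega

lemma roundQ_injective : Function.Injective (roundQ (M := M)) := fun i j h => by
  have := congrArg Fin.val h; simp at this; omega

lemma mem_ladder {q : Fin (M + workQubits M)} : q ∈ ladder M ↔ 3 * M + 2 ≤ q.val := by
  simp only [ladder, List.mem_map, List.mem_finRange, true_and]
  refine ⟨?_, fun h => ⟨⟨q.val - (3 * M + 2), ?_⟩, ?_⟩⟩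
  · rintro ⟨i, rfl⟩; simp
  · have := q.isLt; simp only [workQubits] at this; omega
  · ext; simp; omega

lemma nodup_ladder : (ladder M).Nodup :=
  (List.nodup_finRange _).map fun i j h => by
    have := congrArg Fin.val h; simp at this; omega

lemma ne_of_val_ne {n : ℕ} {i j : Fin n} (h : i.val ≠ j.val) : i ≠ j := fun e => h (by rw [e])

/-- The literals stating that no filter has failed. -/
def successLits (M : ℕ) : List (Fin (M + workQubits M) × Fin 2) :=
  (List.finRange M).map (fun j => (flagQ j, 0)) ++ (List.finRange M).map (fun k => (roundQ k, 0)) ++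
    [(finalQ, 0)]

/-- The literals stating that all readout qubits have the value `b`. -/
def regLits (M : ℕ) (b : Fin 2) : List (Fin (M + workQubits M) × Fin 2) :=
  (List.finRange M).map fun r => (regQ r, b)

lemma allHold_successLits {x : Qubits (M + workQubits M)} :
    AllHold (successLits M) x ↔ (∀ j, x (flagQ j) = 0) ∧ (∀ k, x (roundQ k) = 0) ∧ x finalQ = 0 := by
  simp only [AllHold, successLits, List.mem_append, List.mem_map, List.mem_finRange, true_and,
    List.mem_singleton]
  constructor
  · intro h
    exact ⟨fun j => h _ (Or.inl (Or.inl ⟨j, rfl⟩)), fun k => h _ (Or.inl (Or.inr ⟨k, rfl⟩)),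
      h _ (Or.inr rfl)⟩
  · rintro ⟨h1, h2, h3⟩ b ((⟨j, rfl⟩ | ⟨k, rfl⟩) | rfl)
    exacts [h1 j, h2 k, h3]

lemma allHold_regLits {b : Fin 2} {x : Qubits (M + workQubits M)} :
    AllHold (regLits M b) x ↔ ∀ r, x (regQ r) = b := by
  simp [AllHold, regLits]

/-- All work qubits are `0`. -/
def WorkZero (x : Qubits (M + workQubits M)) : Prop := ∀ q, M ≤ q.val → x q = 0

instance (x : Qubits (M + workQubits M)) : Decidable (WorkZero x) :=
  inferInstanceAs (Decidable (∀ q, M ≤ q.val → x q = 0))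

/-- Rotations preparing the filtered state up to success of the filters. -/
def prepRots (θ : Fin M → ℝ) (φ : Fin M → Fin M → ℝ) (φ₀ : ℝ) :
    List (Fin (M + workQubits M) × (Qubits (M + workQubits M) → ℝ)) :=
  (List.finRange M).map (fun r => (regQ r, fun _ => θ r)) ++
    (filterRounds flagQ (fun k j x => if x (regQ j) = 1 ∧ x (regQ k) = 1 then φ k j else 0) roundQ
      (List.finRange M) ++
    [(finalQ, fun _ => φ₀),
      (finalQ, fun x => if AllHold (regLits M 1) x then Real.pi / 2 - φ₀ else 0)])

/-- Constant rotations, rotations with two controls and rotations controlled by a list of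
literals. -/
def SimpleRot (g : Fin (M + workQubits M) × (Qubits (M + workQubits M) → ℝ)) : Prop :=
  g.1 ∉ spareQ :: ladder M ∧
  ((∃ φ : ℝ, g.2 = fun _ => φ) ∨
    (∃ (φ : ℝ) (c d : Fin (M + workQubits M)) (p q : Fin 2), c ≠ g.1 ∧ d ≠ g.1 ∧
      g.2 = fun x => if x c = p ∧ x d = q then φ else 0) ∨
    (∃ (φ : ℝ) (B : List (Fin (M + workQubits M) × Fin 2)), B ≠ [] ∧ B.length ≤ M ∧
      (∀ b ∈ B, b.1 ≠ g.1) ∧ (∀ b ∈ B, b.1 ∉ ladder M) ∧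
      g.2 = fun x => if AllHold B x then φ else 0))

lemma SimpleRot.neg {g : Fin (M + workQubits M) × (Qubits (M + workQubits M) → ℝ)}
    (h : SimpleRot g) : SimpleRot (g.1, -g.2) := by
  refine ⟨h.1, ?_⟩
  rcases h.2 with ⟨φ, h⟩ | ⟨φ, c, d, p, q, hc, hd, h⟩ | ⟨φ, B, h1, h2, h3, h4, h⟩
  · exact Or.inl ⟨-φ, by rw [h]; rfl⟩
  · refine Or.inr (Or.inl ⟨-φ, c, d, p, q, hc, hd, ?_⟩)
    rw [h]; ext x; simp only [Pi.neg_apply]; split_ifs <;> simp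
  · refine Or.inr (Or.inr ⟨-φ, B, h1, h2, h3, h4, ?_⟩)
    rw [h]; ext x; simp only [Pi.neg_apply]; split_ifs <;> simp

lemma SimpleRot.indep {g : Fin (M + workQubits M) × (Qubits (M + workQubits M) → ℝ)}
    (h : SimpleRot g) : Indep g.1 g.2 := by
  rcases h.2 with ⟨φ, h⟩ | ⟨φ, c, d, p, q, hc, hd, h⟩ | ⟨φ, B, h1, h2, h3, h4, h⟩
  · intro x; rw [h]
  · intro x; rw [h]; simp only [flipBit_of_ne hc, flipBit_of_ne hd]
  · intro x; rw [h]; simp only [allHold_flipBit h3]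

lemma SimpleRot.realizes {g : Fin (M + workQubits M) × (Qubits (M + workQubits M) → ℝ)}
    (h : SimpleRot g) : Realizes (clean (ladder M)) (8 * M + 4) (rot g.1 g.2) := by
  obtain ⟨h0, h⟩ := h
  simp only [List.mem_cons, not_or] at h0
  rcases h with ⟨φ, h⟩ | ⟨φ, c, d, p, q, hc, hd, h⟩ | ⟨φ, B, h1, h2, h3, h4, h⟩
  · rw [h]
    exact (realizes_rot (Ne.symm h0.1) (fun _ => φ) _).mono subset_rfl (by omega) fun _ _ => rfl
  · rw [h]
    exact (realizes_rot_two hc hd p q φ _).mono subset_rfl (by omega) fun _ _ => rfl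
  · rw [h]
    refine (realizes_rot_allHold φ h1 ?_ nodup_ladder h0.2 h3 h4).mono subset_rfl (by omega)
      fun _ _ => rfl
    simp [ladder]; omega

lemma simpleRot_of_mem_prepRots (hM : 0 < M) {θ : Fin M → ℝ} {φ : Fin M → Fin M → ℝ} {φ₀ : ℝ}
    {g : Fin (M + workQubits M) × (Qubits (M + workQubits M) → ℝ)} (hg : g ∈ prepRots θ φ φ₀) :
    SimpleRot g := by
  have hne : List.finRange M ≠ [] := by
    intro h; have := congrArg List.length h; simp at this; omega
  simp only [prepRots, filterRounds, filterRound, List.mem_append, List.mem_map, List.mem_flatMap,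
    List.mem_finRange, true_and, List.mem_cons, List.not_mem_nil, or_false] at hg
  rcases hg with ⟨r, rfl⟩ | ⟨k, ⟨j, rfl⟩ | rfl | rfl⟩ | rfl | rfl
  · refine ⟨?_, Or.inl ⟨_, rfl⟩⟩
    simp [mem_ladder, Fin.ext_iff]; omega
  · refine ⟨?_, Or.inr (Or.inl ⟨_, regQ j, regQ k, 1, 1, ?_, ?_, rfl⟩)⟩
    · simp [mem_ladder, Fin.ext_iff]; omega
    · refine ne_of_val_ne ?_; simp; omega
    · refine ne_of_val_ne ?_; simp; omega
  · refine ⟨?_, Or.inl ⟨_, rfl⟩⟩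
    simp [mem_ladder, Fin.ext_iff]; omega
  · refine ⟨?_, Or.inr (Or.inr ⟨_, _, ?_, ?_, ?_, ?_, rfl⟩)⟩
    · simp [mem_ladder, Fin.ext_iff]; omega
    · simpa using hne
    · simp
    · simp only [List.mem_map, forall_exists_index, and_imp]
      rintro b j _ rfl; refine ne_of_val_ne ?_; simp; omega
    · simp only [List.mem_map, forall_exists_index, and_imp]
      rintro b j _ rfl; simp [mem_ladder]; omega
  · refine ⟨?_, Or.inl ⟨_, rfl⟩⟩
    simp [mem_ladder, Fin.ext_iff]
  · refine ⟨?_, Or.inr (Or.inr ⟨_, _, ?_, ?_, ?_, ?_, rfl⟩)⟩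
    · simp [mem_ladder, Fin.ext_iff]
    · simpa [regLits] using hne
    · simp [regLits]
    · simp only [regLits, List.mem_map, forall_exists_index, and_imp]
      rintro b j _ rfl; refine ne_of_val_ne ?_; simp; omega
    · simp only [regLits, List.mem_map, forall_exists_index, and_imp]
      rintro b j _ rfl; simp [mem_ladder]; omega

lemma length_prepRots (θ : Fin M → ℝ) (φ : Fin M → Fin M → ℝ) (φ₀ : ℝ) :
    (prepRots θ φ φ₀).length = M + (M * (M + 2) + 2) := by
  simp [prepRots, filterRounds, filterRound, List.length_flatMap]

lemma realizes_prepRots (hM : 0 < M) (θ : Fin M → ℝ) (φ : Fin M → Fin M → ℝ) (φ₀ : ℝ) :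
    Realizes (clean (ladder M)) ((M + (M * (M + 2) + 2)) * (8 * M + 4)) (act (prepRots θ φ φ₀)) ∧
    Realizes (clean (ladder M)) ((M + (M * (M + 2) + 2)) * (8 * M + 4))
      (act (invRots (prepRots θ φ φ₀))) := by
  have hs : ∀ g ∈ prepRots θ φ φ₀, SimpleRot g := fun g hg => simpleRot_of_mem_prepRots hM hg
  have hs' : ∀ g ∈ invRots (prepRots θ φ φ₀), SimpleRot g := fun g hg => by
    simp only [invRots, List.mem_reverse, List.mem_map] at hg
    obtain ⟨g', hg', rfl⟩ := hg
    exact (hs g' hg').neg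
  have key : ∀ c : List (Fin (M + workQubits M) × (Qubits (M + workQubits M) → ℝ)),
      (∀ g ∈ c, SimpleRot g) → Realizes (clean (ladder M)) (c.length * (8 * M + 4)) (act c) := by
    intro c hc
    have := realizes_act (ls := ladder M) (c := c) (n := fun _ => 8 * M + 4)
      (fun g hg h => (hc g hg).1 (by simp [h])) fun g hg => (hc g hg).realizes
    simpa using this
  have h1 := key _ hs
  have h2 := key _ hs'
  rw [length_prepRots] at h1
  rw [invRots, List.length_reverse, List.length_map, length_prepRots] at h2
  exact ⟨h1, h2⟩

/-- The factors are those of the last filter, the pair filters and the product state. The last two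
rotations share their target and their angles add up: φ₀ in general, and π/2 on the all-ones string,
whose amplitude is thereby removed. -/
lemma act_prepRots (θ : Fin M → ℝ) (φ : Fin M → Fin M → ℝ) (φ₀ : ℝ)
    {x : Qubits (M + workQubits M)} (hx : AllHold (successLits M) x) :
    act (prepRots θ φ φ₀) (zeroVec _) x =
      (if ∀ r, x (regQ r) = 1 then 0 else (Real.cos φ₀ : ℂ)) *
      ((∏ k, ∏ j, (Real.cos (if x (regQ j) = 1 ∧ x (regQ k) = 1 then φ k j else 0) : ℂ)) *
      ((∏ r, if x (regQ r) = 0 then (Real.cos (θ r) : ℂ) else (Real.sin (θ r) : ℂ)) *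
      if WorkZero x then 1 else 0)) := by
  rw [allHold_successLits] at hx
  obtain ⟨hx1, hx2, hx3⟩ := hx
  rw [prepRots, act_append, act_append]
  set c1 : List (Fin (M + workQubits M) × (Qubits (M + workQubits M) → ℝ)) :=
    (List.finRange M).map (fun r => (regQ r, fun _ => θ r)) with hc1
  have hts : c1.map Prod.fst = (List.finRange M).map regQ := by
    rw [hc1, List.map_map]; rfl
  have h1 : ∀ y, act c1 (zeroVec _) y =
      (∏ r, if y (regQ r) = 0 then (Real.cos (θ r) : ℂ) else (Real.sin (θ r) : ℂ)) *
      if WorkZero y then 1 else 0 := by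
    intro y
    rw [act_product c1 (by rw [hts]; exact (List.nodup_finRange M).map regQ_injective) y]
    · congr 1
      · rw [hc1, List.map_map, ← List.prod_ofFn, List.ofFn_eq_map]
        rfl
      · rw [hts, zeroVec, Pi.single_apply]
        congr 1
        rw [eq_iff_iff]
        constructor
        · intro h q hq
          have := congrFun h q
          rwa [zeroOut, if_neg] at this
          simp only [List.mem_map, not_exists, not_and]
          rintro r _ rfl
          simp at hq; omega
        · intro h; ext1 q
          simp only [zeroOut, List.mem_map, List.mem_finRange, true_and]
          split_ifs with h'
          · rfl
          · refine h q ?_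
            by_contra hq
            exact h' ⟨⟨q.val, by omega⟩, by ext; simp⟩
    · intro g hg y _
      simp only [hc1, List.mem_map] at hg
      obtain ⟨r, _, rfl⟩ := hg
      rfl
    · rintro z _ ⟨t, _, ht⟩
      refine Pi.single_eq_of_ne ?_ _
      rintro rfl; exact ht rfl
  have hz1 : ∀ y : Qubits (M + workQubits M), ¬ WorkZero y → act c1 (zeroVec _) y = 0 :=
    fun y hy => by rw [h1, if_neg hy, mul_zero]
  set θ' : Fin M → Fin M → Qubits (M + workQubits M) → ℝ :=
    fun k j x => if x (regQ j) = 1 ∧ x (regQ k) = 1 then φ k j else 0 with hθ'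
  have hrf : ∀ i j : Fin M, (regQ i : Fin (M + workQubits M)) ≠ flagQ j := fun i j =>
    ne_of_val_ne (by simp; omega)
  have h2 : ∀ y, (∀ k, y (roundQ k) = 0) → act (filterRounds flagQ θ' roundQ (List.finRange M))
      (act c1 (zeroVec _)) y = if ∀ j, y (flagQ j) = 0 then
        ((List.finRange M).map fun k => ∏ j, (Real.cos (θ' k j y) : ℂ)).prod *
          act c1 (zeroVec _) y else 0 := by
    intro y hy
    refine act_filterRounds flagQ_injective roundQ_injective (fun j k => ne_of_val_ne
      (by simp; omega)) (fun k j u v h => ?_) _ (List.nodup_finRange M) (fun k _ z hz => ?_)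
      (fun z _ hz => ?_) y hy
    · simp only [hθ', h _ (hrf j), h _ (hrf k)]
    · exact hz1 z fun h => hz (h _ (by simp; omega))
    · obtain ⟨j, hj⟩ := hz
      exact hz1 z fun h => hj (h _ (by simp))
  simp only [act]
  rw [rot_rot _ (fun _ => rfl), rot_apply_zero hx3]
  have hfin : ∀ k : Fin M, (roundQ k : Fin (M + workQubits M)) ≠ finalQ :=
    fun k => ne_of_val_ne (by simp; omega)
  rw [h2 x hx2, if_pos hx1, h2 (flipBit finalQ x) fun k => by rw [flipBit_of_ne (hfin k), hx2 k],
    hz1 (flipBit finalQ x), h1 x]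
  · simp only [Pi.add_apply, allHold_regLits]
    have hp : ((List.finRange M).map fun k => ∏ j, (Real.cos (θ' k j x) : ℂ)).prod =
        ∏ k, ∏ j, (Real.cos (θ' k j x) : ℂ) := by
      rw [← List.prod_ofFn, List.ofFn_eq_map]
    rw [hp]
    by_cases h : ∀ r, x (regQ r) = 1
    · simp [h]
    · simp [h, hθ']
  · intro h
    have := h finalQ (by simp; omega)
    simp [hx3] at this

lemma sum_workZero {V : Type*} [AddCommMonoid V] (F : Qubits M → V) :
    ∑ x : Qubits (M + workQubits M), (if WorkZero x then F (fun r => x (regQ r)) else 0) =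
      ∑ y, F y := by
  rw [← (Fin.appendEquiv M (workQubits M)).sum_comp, Fintype.sum_prod_type]
  refine Finset.sum_congr rfl fun y _ => ?_
  rw [Finset.sum_eq_single (fun _ => 0)]
  · rw [if_pos]
    · congr 1; ext1 r
      simp [Fin.appendEquiv, regQ]
    · intro q hq
      obtain ⟨i, rfl⟩ : ∃ i, q = Fin.natAdd M i :=
        ⟨⟨q.val - M, by omega⟩, by ext; simp; omega⟩
      simp [Fin.appendEquiv]
  · intro z _ hz
    rw [if_neg]
    intro h
    refine hz (funext fun i => ?_)
    have := h (Fin.natAdd M i) (by simp)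
    simpa [Fin.appendEquiv] using this
  · simp

/-- In the exponent of the Gaussian the squares are produced by independent rotations of the qubits,
and the cross terms by the pair filters. -/
lemma sq_sum_eq (f : Fin M → ℝ) :
    (∑ r, f r) ^ 2 = ∑ r, f r ^ 2 + ∑ k, ∑ j, if j < k then 2 * (f j * f k) else 0 := by
  have h1 : (∑ r, f r) ^ 2 = ∑ k, ∑ j, f j * f k := by
    rw [sq, Finset.sum_mul_sum, Finset.sum_comm]
  have h2 : ∀ k j : Fin M, f j * f k = (if j = k then f k ^ 2 else 0) +
      ((if j < k then f j * f k else 0) + if k < j then f j * f k else 0) := by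
    intro k j
    rcases lt_trichotomy j k with h | h | h
    · simp [h, h.ne, h.le]
    · subst h; simp [sq]
    · simp [h, h.ne', h.le]
  have h3 : ∑ k : Fin M, ∑ j : Fin M, (if k < j then f j * f k else 0) =
      ∑ k, ∑ j, if j < k then f j * f k else 0 := by
    rw [Finset.sum_comm]
    simp_rw [mul_comm]
  rw [h1, Finset.sum_congr rfl fun k _ => Finset.sum_congr rfl fun j _ => h2 k j]
  simp only [Finset.sum_add_distrib]
  rw [h3, ← Finset.sum_add_distrib]
  congr 1
  · simp
  · refine Finset.sum_congr rfl fun k _ => ?_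
    rw [← Finset.sum_add_distrib]
    refine Finset.sum_congr rfl fun j _ => ?_
    split_ifs <;> ring

end Preparation

/-! ### Gaussian amplitudes of weighted bit sums -/

section Preparation

variable {M : ℕ}

/-- The weighted sum of the bits of `y`. -/
def weight (w : Fin M → ℝ) (y : Qubits M) : ℝ := ∑ r, w r * ((y r : ℕ) : ℝ)

/-- Normalization of the filtered state, which excludes the all-ones string. -/
def partitionSum (α : ℝ) (w : Fin M → ℝ) : ℝ :=
  ∑ y : Qubits M, if ∀ r, y r = 1 then 0 else Real.exp (-(2 * α * weight w y ^ 2))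

/-- The Gaussian state with amplitudes `exp (-α (weight w y) ^ 2)`. -/
def weightState (α : ℝ) (w : Fin M → ℝ) : Vec (M + workQubits M) := fun x =>
  if WorkZero x then
    (if ∀ r, x (regQ r) = 1 then 0
      else ((Real.exp (-(α * weight w (fun r => x (regQ r)) ^ 2)) / √(partitionSum α w) : ℝ) : ℂ))
  else 0

lemma sum_weightState (α : ℝ) (w : Fin M → ℝ) (hZ : 0 < partitionSum α w) :
    ∑ x, weightState α w x * weightState α w x = 1 := by
  set F : Qubits M → ℂ := fun y => if ∀ r, y r = 1 then (0 : ℂ) else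
    ((Real.exp (-(2 * α * weight w y ^ 2)) / partitionSum α w : ℝ) : ℂ) with hF
  have h1 : ∀ x, weightState α w x * weightState α w x =
      if WorkZero x then F (fun r => x (regQ r)) else 0 := by
    intro x
    simp only [weightState, hF]
    split_ifs with h h'
    · simp
    · rw [← Complex.ofReal_mul, div_mul_div_comm, Real.mul_self_sqrt hZ.le, ← Real.exp_add]
      congr 3; ring
    · simp
  rw [Finset.sum_congr rfl fun x _ => h1 x, sum_workZero]
  have h2 : ∀ y : Qubits M, F y = (((if ∀ r, y r = 1 then 0 else Real.exp (-(2 * α * weight w y ^ 2))) /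
        partitionSum α w : ℝ) : ℂ) := by
    intro y; simp only [hF]; split_ifs <;> simp
  simp_rw [h2]
  rw [← Complex.ofReal_sum, ← Finset.sum_div, ← partitionSum, div_self hZ.ne']
  simp

lemma length_successLits : (successLits M).length = 2 * M + 1 := by
  simp [successLits]; ring

/-- Preparation of the Gaussian state of weighted bit sums by exact amplitude amplification. -/
theorem exists_gates_weightState (hM : 0 < M) {α : ℝ} (hα : 0 ≤ α) {w : Fin M → ℝ}
    (hw : ∀ r, 0 ≤ w r)
    (hZ : ∏ r, (1 + Real.exp (-(2 * α * w r ^ 2))) ≤ 4 * partitionSum α w) :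
    ∃ d : List (Gate (M + workQubits M)), d.length ≤ 500 * M ^ 3 ∧
      gatesMatrix d *ᵥ zeroVec _ = weightState α w := by
  set Pr := ∏ r, (1 + Real.exp (-(2 * α * w r ^ 2))) with hPr
  have hPpos : 0 < Pr := Finset.prod_pos fun r _ => by positivity
  have hZpos : 0 < partitionSum α w := by linarith
  -- The tangent is the ratio of the amplitudes of bit 1 and bit 0.
  set θ : Fin M → ℝ := fun r => Real.arctan (Real.exp (-(α * w r ^ 2)))
  -- Each pair is damped once, by a factor that is a cosine because the weights are nonnegative.
  set φ : Fin M → Fin M → ℝ := fun k j =>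
    if j < k then Real.arccos (Real.exp (-(2 * α * w j * w k))) else 0
  -- Before the last filter the amplitudes are exp(-α weight²)/√Pr, whereas half of the normalized
  -- state is wanted. The quotient is this number, which is at most 1 by `hZ`.
  set φ₀ := Real.arccos (√Pr / (2 * √(partitionSum α w)))
  obtain ⟨hr, hr'⟩ := realizes_prepRots hM θ φ φ₀
  have hcos : Real.cos φ₀ = √Pr / (2 * √(partitionSum α w)) := by
    refine Real.cos_arccos ?_ ?_
    · have : 0 ≤ √Pr / (2 * √(partitionSum α w)) := by positivity
      linarith
    · rw [div_le_one (by positivity)]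
      refine Real.sqrt_le_iff.2 ⟨by positivity, ?_⟩
      rw [mul_pow, Real.sq_sqrt hZpos.le]; linarith
  have hone : ∀ r, 1 + Real.exp (-(α * w r ^ 2)) ^ 2 = 1 + Real.exp (-(2 * α * w r ^ 2)) :=
    fun r => by
      rw [← Real.exp_nat_mul]; congr 2; push_cast; ring
  have hG : ∀ x, (if AllHold (successLits M) x then
      act (prepRots θ φ φ₀) (zeroVec _) x else 0) = (1 / 2) * weightState α w x := by
    intro x
    by_cases hx : AllHold (successLits M) x
    · rw [if_pos hx, act_prepRots θ φ φ₀ hx, weightState]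
      by_cases hwz : WorkZero x
      · by_cases h1 : ∀ r, x (regQ r) = 1
        · simp [h1]
        · simp only [if_neg h1, if_pos hwz, mul_one, hcos]
          have e1 : ∀ k j, Real.cos (if x (regQ j) = 1 ∧ x (regQ k) = 1 then φ k j else 0) =
              Real.exp (-(α * if j < k then 2 * ((w j * ((x (regQ j) : ℕ) : ℝ)) *
                (w k * ((x (regQ k) : ℕ) : ℝ))) else 0)) := by
            intro k j
            have hc : Real.cos (φ k j) = Real.exp (-(α * if j < k then 2 * (w j * w k) else 0)) := by
              by_cases hjk : j < k
              · simp only [φ, if_pos hjk]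
                rw [Real.cos_arccos (by linarith [Real.exp_pos (-(2 * α * w j * w k))])]
                · congr 1; ring
                · refine Real.exp_le_one_iff.2 (neg_nonpos.2 ?_)
                  have := hw j; have := hw k; positivity
              · simp [φ, hjk]
            rcases fin_two_eq_zero_or (x (regQ j)) with hj | hj <;>
              rcases fin_two_eq_zero_or (x (regQ k)) with hk | hk <;> simp [hj, hk, hc]
          have e2 : ∀ r, (if x (regQ r) = 0 then Real.cos (θ r) else Real.sin (θ r)) =
              Real.exp (-(α * (w r * ((x (regQ r) : ℕ) : ℝ)) ^ 2)) /
                √(1 + Real.exp (-(2 * α * w r ^ 2))) := by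
            intro r
            rcases fin_two_eq_zero_or (x (regQ r)) with hr | hr
            · simp only [hr, if_true, θ, Real.cos_arctan, hone]; simp
            · simp only [hr, θ, Real.sin_arctan, hone]; simp
          have e3 : (∏ k, ∏ j, (Real.cos (if x (regQ j) = 1 ∧ x (regQ k) = 1 then φ k j else 0) : ℂ))
              * (∏ r, if x (regQ r) = 0 then (Real.cos (θ r) : ℂ) else (Real.sin (θ r) : ℂ)) =
              ((Real.exp (-(α * weight w (fun r => x (regQ r)) ^ 2)) / √Pr : ℝ) : ℂ) := by
            have e4 : ∀ r, (if x (regQ r) = 0 then (Real.cos (θ r) : ℂ) else (Real.sin (θ r) : ℂ)) =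
              ((if x (regQ r) = 0 then Real.cos (θ r) else Real.sin (θ r) : ℝ) : ℂ) := fun r => by
                split_ifs <;> rfl
            simp_rw [e4, e2, e1]
            rw [weight, sq_sum_eq, mul_add, neg_add, Real.exp_add, Finset.mul_sum,
              ← Finset.sum_neg_distrib, Real.exp_sum, Finset.mul_sum, ← Finset.sum_neg_distrib,
              Real.exp_sum]
            simp_rw [Finset.mul_sum, ← Finset.sum_neg_distrib, Real.exp_sum]
            rw [hPr, Real.sqrt_prod _ fun r _ => by positivity]
            simp only [Complex.ofReal_div, Complex.ofReal_mul, Complex.ofReal_prod,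
              Finset.prod_div_distrib]
            ring
          rw [e3, ← Complex.ofReal_mul]
          have hP : √Pr ≠ 0 := (Real.sqrt_pos.2 hPpos).ne'
          have hZ' : √(partitionSum α w) ≠ 0 := (Real.sqrt_pos.2 hZpos).ne'
          have : (1 / 2 : ℂ) = ((1 / 2 : ℝ) : ℂ) := by push_cast; ring
          rw [this, ← Complex.ofReal_mul]
          congr 1
          field_simp
      · simp [hwz]
    · rw [if_neg hx, weightState, if_neg, mul_zero]
      intro h
      refine hx (allHold_successLits.2 ⟨fun j => h _ ?_, fun k => h _ ?_, h _ ?_⟩) <;> simp <;> omega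
  have hsp : (spareQ : Fin (M + workQubits M)) ∉ ladder M := by simp [mem_ladder]
  have hsl : ∀ b ∈ successLits M, b.1 ∉ spareQ :: ladder M := by
    intro b hb
    simp only [successLits, List.mem_append, List.mem_map, List.mem_finRange, true_and,
      List.mem_singleton] at hb
    rcases hb with (⟨j, rfl⟩ | ⟨k, rfl⟩) | rfl
    · simp [mem_ladder, Fin.ext_iff]; omega
    · simp [mem_ladder, Fin.ext_iff]; omega
    · simp [mem_ladder, Fin.ext_iff]
  have hrl : ∀ b ∈ regLits M 0, b.1 ∉ spareQ :: ladder M := by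
    intro b hb
    simp only [regLits, List.mem_map, List.mem_finRange, true_and] at hb
    obtain ⟨r, rfl⟩ := hb
    simp [mem_ladder, Fin.ext_iff]; omega
  have hlen : (regLits M 0).length = M := by simp [regLits]
  have hlad : (ladder M).length = 3 * M + 1 := by simp [ladder]
  have hne : (regQ ⟨0, hM⟩ : Fin (M + workQubits M)) ≠ spareQ := ne_of_val_ne (by simp)
  have hB0 : ∀ x ∈ clean (spareQ :: ladder M),
      AllHold (regLits M 0 ++ successLits M) x ↔ x = fun _ => 0 := by
    intro x hx
    have happ : AllHold (regLits M 0 ++ successLits M) x ↔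
        AllHold (regLits M 0) x ∧ AllHold (successLits M) x := by
      simp only [AllHold, List.mem_append]
      exact ⟨fun h => ⟨fun b hb => h b (Or.inl hb), fun b hb => h b (Or.inr hb)⟩,
        fun h b hb => hb.elim (h.1 b) (h.2 b)⟩
    rw [happ, allHold_regLits, allHold_successLits]
    constructor
    · rintro ⟨h1, h2, h3, h4⟩
      ext1 q
      by_cases c1 : q.val < M
      · have : q = regQ ⟨q.val, c1⟩ := by ext; simp
        rw [this, h1]
      by_cases c2 : q.val < 2 * M
      · have : q = flagQ ⟨q.val - M, by omega⟩ := by ext; simp; omega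
        rw [this, h2]
      by_cases c3 : q.val < 3 * M
      · have : q = roundQ ⟨q.val - 2 * M, by omega⟩ := by ext; simp; omega
        rw [this, h3]
      by_cases c4 : q.val = 3 * M
      · have : q = finalQ := by ext; simpa using c4
        rw [this, h4]
      refine hx q ?_
      by_cases c5 : q.val = 3 * M + 1
      · have : q = spareQ := by ext; simpa using c5
        simp [this]
      · refine List.mem_cons_of_mem _ (mem_ladder.2 ?_)
        omega
    · rintro rfl
      simp
  obtain ⟨d, hd, hdG⟩ := amplitude_amplification (c := prepRots θ φ φ₀) (ls := ladder M)
    (t := spareQ) (u := regQ ⟨0, hM⟩) (Bg := successLits M) (B0 := regLits M 0 ++ successLits M)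
    (N := (M + (M * (M + 2) + 2)) * (8 * M + 4)) (G := weightState α w)
    (fun g hg => (simpleRot_of_mem_prepRots hM hg).indep) hne
    (fun g hg => (simpleRot_of_mem_prepRots hM hg).1)
    (by simp [successLits]) (by rw [length_successLits, hlad]; omega) hsl
    (by simp [successLits]) (by rw [List.length_append, hlen, length_successLits, hlad]; omega)
    (fun b hb => (List.mem_append.1 hb).elim (hrl b) (hsl b))
    (List.nodup_cons.2 ⟨hsp, nodup_ladder⟩) hB0 hr hr' hG (sum_weightState α w hZpos)
  refine ⟨d, hd.trans ?_, hdG⟩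
  rw [List.length_append, hlen, length_successLits]
  obtain ⟨K, rfl⟩ : ∃ K, M = K + 1 := ⟨M - 1, by omega⟩
  ring_nf
  nlinarith [Nat.zero_le (K ^ 3), Nat.zero_le (K ^ 2), Nat.zero_le K]

end Preparation

/-! ### Hadamard, NOT and controlled NOT gates -/

section BasisChanges

variable {a : ℕ}

lemma suppIn_univ (ψ : Vec a) : SuppIn Set.univ ψ := fun x hx => absurd (Set.mem_univ x) hx

lemma realizes_diag_list {ι : Type*} (l : List ι) (c d : ι → Fin a) (g : ι → Fin 2 → Fin 2 → ℂ)
    (hg : ∀ i p q, ‖g i p q‖ = 1) :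
    Realizes Set.univ l.length
      (fun ψ x => (l.map fun i => g i (x (c i)) (x (d i))).prod * ψ x) := by
  induction l with
  | nil => simpa using realizes_id _
  | cons i l ih =>
    refine ((ih.comp (realizes_diag (c i) (d i) (g i) (hg i) Set.univ)
      fun ψ _ => suppIn_univ _)).mono subset_rfl (by simp; omega) fun ψ _ => ?_
    ext x
    simp only [List.map_cons, List.prod_cons]; ring

/-- The NOT gate. -/
lemma realizes_not {t u : Fin a} (h : u ≠ t) :
    Realizes Set.univ 2 (fun ψ x => ψ (flipBit t x)) := by
  refine ((realizes_rot h (fun _ => Real.pi / 2) Set.univ).comp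
    (realizes_diag t t (fun i _ => if i = 1 then -1 else 1) (fun i _ => by split_ifs <;> simp)
      Set.univ) fun ψ _ => suppIn_univ _).mono subset_rfl le_rfl fun ψ _ => ?_
  ext x
  rcases fin_two_eq_zero_or (x t) with hx | hx <;> simp [rot, hx]

/-- The Hadamard gate. -/
lemma realizes_hadamard {t u : Fin a} (h : u ≠ t) :
    Realizes Set.univ 2 (fun ψ x =>
      ((√2)⁻¹ : ℝ) * (ψ (flipBit t x) + (if x t = 1 then -1 else 1) * ψ x)) := by
  refine ((realizes_rot h (fun _ => Real.pi / 4) Set.univ).comp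
    (realizes_diag t t (fun i _ => if i = 1 then -1 else 1) (fun i _ => by split_ifs <;> simp)
      Set.univ) fun ψ _ => suppIn_univ _).mono subset_rfl le_rfl fun ψ _ => ?_
  have h2 : √2 / 2 = (√2)⁻¹ := by
    rw [div_eq_iff two_ne_zero, ← div_eq_inv_mul, eq_div_iff (by positivity)]
    exact Real.mul_self_sqrt (by norm_num)
  ext x
  simp only [rot, Real.cos_pi_div_four, Real.sin_pi_div_four, h2]
  rcases fin_two_eq_zero_or (x t) with hx | hx <;> simp [hx] <;> ring

/-- Controlled NOT gates with control `c` and targets `ts`. -/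
def multiNot (c : Fin a) (ts : List (Fin a)) (x : Qubits a) : Qubits a := fun k =>
  if x c = 1 ∧ k ∈ ts then 1 - x k else x k

lemma realizes_multiNot {c : Fin a} (ts : List (Fin a)) (hnd : ts.Nodup) (hc : c ∉ ts) :
    Realizes Set.univ (2 * ts.length) (fun ψ x => ψ (multiNot c ts x)) := by
  induction ts with
  | nil =>
    refine (realizes_id _).mono subset_rfl (by simp) fun ψ _ => ?_
    have h : ∀ x : Qubits a, multiNot c [] x = x := fun x => by ext k; simp [multiNot]
    simp only [h]
  | cons t ts ih =>
    simp only [List.nodup_cons, List.mem_cons, not_or] at hnd hc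
    have hn : Realizes Set.univ 2
        (fun ψ (x : Qubits a) => ψ (if x c = 1 then flipBit t x else x)) := by
      refine ((realizes_rot hc.1 (fun i => if i = 1 then Real.pi / 2 else 0) Set.univ).comp
        (realizes_diag c t (fun i j => if i = 1 ∧ j = 1 then -1 else 1)
          (fun i _ => by split_ifs <;> simp) Set.univ)
        fun ψ _ => suppIn_univ _).mono subset_rfl le_rfl fun ψ _ => ?_
      ext x
      by_cases h : x c = 1
      · rcases fin_two_eq_zero_or (x t) with hx | hx <;>
          simp [rot, hx, h, flipBit_of_ne hc.1]
      · simp [rot, h]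
    refine ((ih hnd.2 hc.2).comp hn fun ψ _ => suppIn_univ _).mono subset_rfl (by simp; omega)
      fun ψ _ => ?_
    ext x
    beta_reduce
    congr 1
    have hxc : multiNot c ts x c = x c := by simp [multiNot, hc.2]
    rw [hxc]
    ext k
    by_cases h : x c = 1
    · rw [if_pos h]
      by_cases hk : k = t
      · subst hk; simp [multiNot, hnd.1, h]
      · rw [flipBit_of_ne hk]; simp only [multiNot, h, List.mem_cons, hk, false_or]
    · simp [multiNot, h]

end BasisChanges

/-! ### The quantum Fourier transform -/

section Fourier

variable {M : ℕ}

/-- The phases of the quantum Fourier transform. -/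
def qftPhase (r s : ℕ) : ℂ := Complex.exp (2 * Real.pi * Complex.I * (2 ^ r / 2 ^ (s + 1)))

lemma norm_qftPhase (r s : ℕ) : ‖qftPhase r s‖ = 1 := by
  have : (2 * Real.pi * Complex.I * (2 ^ r / 2 ^ (s + 1)) : ℂ) =
      ((2 * Real.pi * (2 ^ r / 2 ^ (s + 1)) : ℝ) : ℂ) * Complex.I := by push_cast; ring
  rw [qftPhase, this, Complex.norm_exp_ofReal_mul_I]

lemma qftPhase_self (r : ℕ) : qftPhase r r = -1 := by
  have : (2 * Real.pi * Complex.I * (2 ^ r / 2 ^ (r + 1)) : ℂ) = Real.pi * Complex.I := by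
    have : (2 : ℂ) ^ r ≠ 0 := by positivity
    rw [pow_succ]; field_simp
  rw [qftPhase, this, Complex.exp_pi_mul_I]

lemma qftPhase_of_lt {r s : ℕ} (h : s < r) : qftPhase r s = 1 := by
  obtain ⟨k, rfl⟩ := Nat.exists_eq_add_of_lt h
  have : (2 * Real.pi * Complex.I * (2 ^ (s + k + 1) / 2 ^ (s + 1)) : ℂ) =
      ((2 ^ k : ℕ) : ℂ) * (2 * Real.pi * Complex.I) := by
    have : (2 : ℂ) ^ s ≠ 0 := by positivity
    push_cast; field_simp; ring
  rw [qftPhase, this, Complex.exp_nat_mul_two_pi_mul_I]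

/-- The phase collected by the qubit `r` in the quantum Fourier transform from `y` to `z`. -/
def qftRow (y z : Qubits (M + workQubits M)) (r : Fin M) : ℂ :=
  ∏ s : Fin M, if z (regQ r) = 1 ∧ y (regQ s) = 1 then qftPhase r s else 1

/-- The quantum Fourier transform of the basis state `y`, after the first `t` qubits have been
processed. -/
def qftState (y : Qubits (M + workQubits M)) (t : ℕ) : Vec (M + workQubits M) := fun z =>
  if ∀ q, t ≤ q.val → z q = y q then
    ((√2)⁻¹ : ℝ) ^ t * ∏ r : Fin M, if r.val < t then qftRow y z r else 1
  else 0

/-- One step of the quantum Fourier transform. -/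
def qftStep (t : Fin M) (ψ : Vec (M + workQubits M)) : Vec (M + workQubits M) := fun z =>
  ((List.finRange M).map fun s => if t < s ∧ z (regQ t) = 1 ∧ z (regQ s) = 1
    then qftPhase t s else 1).prod *
    (((√2)⁻¹ : ℝ) * (ψ (flipBit (regQ t) z) + (if z (regQ t) = 1 then -1 else 1) * ψ z))

lemma regQ_ne_spareQ (r : Fin M) : (spareQ : Fin (M + workQubits M)) ≠ regQ r :=
  ne_of_val_ne (by simp; omega)

lemma realizes_qftStep (t : Fin M) : Realizes Set.univ (2 + M) (qftStep t) := by
  have h1 := realizes_hadamard (regQ_ne_spareQ t)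
  have h2 := realizes_diag_list (List.finRange M) (fun _ => (regQ t : Fin (M + workQubits M)))
    (fun s => regQ s) (fun s i j => if t < s ∧ i = 1 ∧ j = 1 then qftPhase t s else 1)
    fun s i j => by split_ifs <;> simp [norm_qftPhase]
  exact (h2.comp h1 fun ψ _ => suppIn_univ _).mono subset_rfl (by simp) fun ψ _ => rfl

lemma qftRow_congr {y z z' : Qubits (M + workQubits M)} {r : Fin M}
    (h : z (regQ r) = z' (regQ r)) : qftRow y z r = qftRow y z' r := by
  simp only [qftRow, h]

lemma prod_lt_succ (f : Fin M → ℂ) {t : ℕ} (ht : t < M) :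
    (∏ r : Fin M, if r.val < t + 1 then f r else 1) =
      (∏ r : Fin M, if r.val < t then f r else 1) * f ⟨t, ht⟩ := by
  have h : f ⟨t, ht⟩ = ∏ r : Fin M, if r = ⟨t, ht⟩ then f r else 1 := by simp
  rw [h, ← Finset.prod_mul_distrib]
  refine Finset.prod_congr rfl fun r _ => ?_
  rcases lt_trichotomy r.val t with h1 | h1 | h1
  · simp [h1, h1.ne, Nat.lt_succ_of_lt h1, Fin.ext_iff]
  · simp [h1, Fin.ext_iff]
  · simp [not_lt.2 h1.le, h1.ne', not_lt.2 (Nat.succ_le_of_lt h1), Fin.ext_iff]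

/-- In the product over s that defines row t, the factors with s < t are whole turns, the factor s =
t is the sign of the Hadamard gate, and those with s > t are controlled phases, which read `y` off
qubits that are still unprocessed. No swaps are needed: the input has its most significant digit
first, the output its least significant one. -/
lemma qftStep_qftState (y : Qubits (M + workQubits M)) (t : Fin M) :
    qftStep t (qftState y t) = qftState y (t + 1) := by
  ext z
  by_cases hz : ∀ q, t.val + 1 ≤ q.val → z q = y q
  · set P : ℂ := ∏ r : Fin M, if r.val < t.val then qftRow y z r else 1 with hP
    have hrow : qftRow y z t = ((List.finRange M).map fun s =>
        if t < s ∧ z (regQ t) = 1 ∧ z (regQ s) = 1 then qftPhase t s else 1).prod *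
        if z (regQ t) = 1 ∧ y (regQ t) = 1 then -1 else 1 := by
      rw [← List.ofFn_eq_map, List.prod_ofFn]
      have h : (if z (regQ t) = 1 ∧ y (regQ t) = 1 then (-1 : ℂ) else 1) =
          ∏ s : Fin M, if s = t then (if z (regQ t) = 1 ∧ y (regQ t) = 1 then -1 else 1) else 1 := by
        simp
      rw [h, ← Finset.prod_mul_distrib, qftRow]
      refine Finset.prod_congr rfl fun s _ => ?_
      rcases lt_trichotomy s t with h1 | h1 | h1
      · simp [not_lt.2 h1.le, h1.ne, qftPhase_of_lt (Fin.lt_def.1 h1)]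
      · subst h1; simp [qftPhase_self]
      · have : z (regQ s) = y (regQ s) := hz _ (by simpa using h1)
        simp [h1, h1.ne', this]
    have hflip : ∏ r : Fin M, (if r.val < t.val then qftRow y (flipBit (regQ t) z) r else 1) = P := by
      refine Finset.prod_congr rfl fun r _ => ?_
      split_ifs with h
      · exact qftRow_congr (flipBit_of_ne (regQ_injective.ne (by rintro rfl; omega)) z)
      · rfl
    have e1 : qftState y t z = if z (regQ t) = y (regQ t) then ((√2)⁻¹ : ℝ) ^ t.val * P else 0 := by
      rw [qftState]
      congr 1
      rw [eq_iff_iff]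
      refine ⟨fun h => h _ (by simp), fun h q hq => ?_⟩
      rcases hq.eq_or_lt with h' | h'
      · have : q = regQ t := by ext; simp [h']
        rw [this, h]
      · exact hz q h'
    have e2 : qftState y t (flipBit (regQ t) z) =
        if z (regQ t) = y (regQ t) then 0 else ((√2)⁻¹ : ℝ) ^ t.val * P := by
      rw [qftState, hflip, ← ite_not]
      congr 1
      rw [eq_iff_iff]
      have hbit : ∀ b c : Fin 2, 1 - b = c ↔ ¬ b = c := by decide
      rw [not_iff_comm, ← hbit, iff_comm]
      refine ⟨fun h => by simpa using h (regQ t) (by simp), fun h q hq => ?_⟩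
      rcases hq.eq_or_lt with h' | h'
      · have : q = regQ t := by ext; simp [h']
        rw [this]; simpa using h
      · rw [flipBit_of_ne (ne_of_val_ne (by simp; omega))]; exact hz q h'
    have e3 : qftState y (t + 1) z = ((√2)⁻¹ : ℝ) ^ (t.val + 1) * (P * qftRow y z t) := by
      rw [qftState, if_pos hz, prod_lt_succ _ t.isLt]
    rw [e3, hrow, qftStep, e1, e2]
    generalize ((List.finRange M).map fun s =>
        if t < s ∧ z (regQ t) = 1 ∧ z (regQ s) = 1 then qftPhase t s else 1).prod = Q
    rcases fin_two_eq_zero_or (z (regQ t)) with h1 | h1 <;>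
      rcases fin_two_eq_zero_or (y (regQ t)) with h2 | h2 <;> simp [h1, h2, pow_succ] <;> ring
  · have e3 : qftState y (t + 1) z = 0 := by rw [qftState, if_neg hz]
    have e1 : qftState y t z = 0 := by
      rw [qftState, if_neg fun h => hz fun q hq => h q (by omega)]
    have e2 : qftState y t (flipBit (regQ t) z) = 0 := by
      rw [qftState, if_neg fun h => hz fun q hq => ?_]
      rw [← h q (by omega), flipBit_of_ne (ne_of_val_ne (by simp; omega))]
    rw [e3, qftStep, e1, e2]
    simp

/-- The first `t` steps of the quantum Fourier transform. -/
lemma exists_gates_qft (M t : ℕ) (ht : t ≤ M) :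
    ∃ c : List (Gate (M + workQubits M)), c.length ≤ t * (2 + M) ∧
      ∀ y, gatesMatrix c *ᵥ Pi.single y 1 = qftState y t := by
  induction t with
  | zero =>
    refine ⟨[], by simp, fun y => ?_⟩
    ext z
    simp only [gatesMatrix, Matrix.one_mulVec, Pi.single_apply, qftState]
    have : z = y ↔ ∀ q : Fin (M + workQubits M), 0 ≤ q.val → z q = y q :=
      ⟨fun h q _ => by rw [h], fun h => funext fun q => h q (by omega)⟩
    simp only [this]
    simp
  | succ t ih =>
    obtain ⟨c, hc, h⟩ := ih (by omega)
    obtain ⟨d, hd, h'⟩ := realizes_qftStep (⟨t, by omega⟩ : Fin M)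
    refine ⟨c ++ d, ?_, fun y => ?_⟩
    · rw [List.length_append, Nat.succ_mul]; omega
    · rw [gatesMatrix_append, ← Matrix.mulVec_mulVec, h, h' _ (suppIn_univ _)]
      exact qftStep_qftState y ⟨t, by omega⟩

end Fourier

/-! ### The shifted Fourier transform -/

section ShiftedFourier

variable {m : ℕ}

/-- Number with the binary digits `y`, most significant digit first. -/
def bitIndex {M : ℕ} (y : Qubits M) : Fin (2 ^ M) := finFunctionFinEquiv fun i => y (Fin.rev i)

lemma val_bitIndex {M : ℕ} (y : Qubits M) :
    ((bitIndex y : Fin (2 ^ M)) : ℕ) = ∑ r : Fin M, (y r : ℕ) * 2 ^ (M - 1 - r.val) := by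
  rw [bitIndex, finFunctionFinEquiv_apply, ← Equiv.sum_comp Fin.revPerm]
  refine Finset.sum_congr rfl fun r _ => ?_
  simp [Fin.val_rev, Nat.sub_sub, add_comm]

lemma neg_one_pow_bits {M : ℕ} (b : Fin M → Fin 2) (e : Fin M → ℕ) (r₀ : Fin M) (h0 : e r₀ = 0)
    (he : ∀ r, r ≠ r₀ → e r ≠ 0) :
    (-1 : ℂ) ^ (∑ r, (b r : ℕ) * 2 ^ e r) = if b r₀ = 1 then -1 else 1 := by
  rw [← Finset.prod_pow_eq_pow_sum, Finset.prod_eq_single r₀]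
  · rw [h0]
    rcases fin_two_eq_zero_or (b r₀) with h | h <;> simp [h]
  · intro r _ hr
    refine Even.neg_one_pow ?_
    obtain ⟨k, hk⟩ := Nat.exists_eq_succ_of_ne_zero (he r hr)
    rw [hk, pow_succ]
    exact ⟨(b r : ℕ) * 2 ^ k, by ring⟩
  · simp

lemma exp_neg_pi_mul_nat (k : ℕ) : Complex.exp (-(Real.pi * Complex.I * k)) = (-1) ^ k := by
  have : -(Real.pi * Complex.I * k) = (k : ℂ) * (-(Real.pi * Complex.I)) := by ring
  rw [this, Complex.exp_nat_mul, Complex.exp_neg, Complex.exp_pi_mul_I]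
  norm_num

/-- Expanding (ℓ - N/2)(j - N/2)/N leaves the ordinary kernel, the signs (-1)^ℓ and (-1)^j, and the
phase exp(2πi N/4), which is 1 because N/4 = 4^(m-1) is an integer. The two signs depend on the
lowest binary digits only: the first qubit for j, the last one for ℓ. -/
lemma shiftedQFT_bits (hm : 0 < m) (b d : Qubits (2 * m)) :
    shiftedQFT m (finFunctionFinEquiv d) (bitIndex b) =
      (if d ⟨0, by omega⟩ = 1 then -1 else 1) * ((if b ⟨2 * m - 1, by omega⟩ = 1 then -1 else 1) *
      (((√2)⁻¹ : ℝ) ^ (2 * m) * ∏ r : Fin (2 * m), ∏ s : Fin (2 * m),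
        if d r = 1 ∧ b s = 1 then qftPhase r s else 1)) := by
  set j : ℕ := ((finFunctionFinEquiv d : Fin (2 ^ (2 * m))) : ℕ) with hj
  set l : ℕ := ((bitIndex b : Fin (2 ^ (2 * m))) : ℕ) with hl
  have hj' : j = ∑ r, (d r : ℕ) * 2 ^ r.val := by rw [hj, finFunctionFinEquiv_apply]
  have hl' : l = ∑ s, (b s : ℕ) * 2 ^ (2 * m - 1 - s.val) := by rw [hl, val_bitIndex]
  have hN : (2 : ℂ) ^ (2 * m) ≠ 0 := by positivity
  have hexp : 2 * Real.pi * Complex.I * ((l : ℂ) - 2 ^ (2 * m) / 2) *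
      ((j : ℂ) - 2 ^ (2 * m) / 2) / 2 ^ (2 * m) =
      -(Real.pi * Complex.I * j) + (-(Real.pi * Complex.I * l) +
        (2 * Real.pi * Complex.I * (l * j / 2 ^ (2 * m)) +
          ((4 ^ (m - 1) : ℕ) : ℂ) * (2 * Real.pi * Complex.I))) := by
    have h4 : (2 : ℂ) ^ (2 * m) = 4 * ((4 ^ (m - 1) : ℕ) : ℂ) := by
      obtain ⟨k, rfl⟩ := Nat.exists_eq_succ_of_ne_zero hm.ne'
      rw [pow_mul]; push_cast; simp only [Nat.succ_eq_add_one]; ring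
    have h5 : (((4 ^ (m - 1) : ℕ) : ℂ)) ≠ 0 := by positivity
    rw [h4]
    field_simp
    ring
  have hlj : 2 * Real.pi * Complex.I * ((l : ℂ) * j / 2 ^ (2 * m)) =
      ∑ r : Fin (2 * m), ∑ s : Fin (2 * m), 2 * Real.pi * Complex.I *
        (2 ^ r.val / 2 ^ (s.val + 1)) * ((d r : ℕ) : ℂ) * ((b s : ℕ) : ℂ) := by
    rw [hj', hl']
    push_cast
    rw [mul_comm (∑ s : Fin (2 * m), ((b s : ℕ) : ℂ) * 2 ^ (2 * m - 1 - s.val)), Finset.sum_mul_sum, Finset.sum_div, Finset.mul_sum]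
    refine Finset.sum_congr rfl fun r _ => ?_
    rw [Finset.sum_div, Finset.mul_sum]
    refine Finset.sum_congr rfl fun s _ => ?_
    have : (2 : ℂ) ^ (2 * m) = 2 ^ (2 * m - 1 - s.val) * 2 ^ (s.val + 1) := by
      rw [← pow_add]; congr 1; omega
    rw [this]
    have : (2 : ℂ) ^ (2 * m - 1 - s.val) ≠ 0 := by positivity
    field_simp
  have hsq : (√(2 ^ (2 * m)))⁻¹ = (√2)⁻¹ ^ (2 * m) := by
    rw [inv_pow, pow_mul, pow_mul, Real.sq_sqrt (by norm_num)]
    congr 1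
    rw [← pow_mul, mul_comm, pow_mul, Real.sqrt_sq (by positivity)]
  rw [shiftedQFT]
  change _ * Complex.exp (2 * Real.pi * Complex.I * ((l : ℂ) - 2 ^ (2 * m) / 2) *
      ((j : ℂ) - 2 ^ (2 * m) / 2) / 2 ^ (2 * m)) = _
  rw [hexp, Complex.exp_add, Complex.exp_add, Complex.exp_add, Complex.exp_nat_mul_two_pi_mul_I,
    exp_neg_pi_mul_nat, exp_neg_pi_mul_nat, hlj, hsq]
  rw [hj', neg_one_pow_bits d (fun r => r.val) ⟨0, by omega⟩ rfl
    (fun r hr h => hr (Fin.ext h)), hl', neg_one_pow_bits b (fun r => 2 * m - 1 - r.val)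
    ⟨2 * m - 1, by omega⟩ (by simp) (fun r hr h => hr (Fin.ext (by dsimp only at h ⊢; omega)))]
  have hprod : Complex.exp (∑ r : Fin (2 * m), ∑ s : Fin (2 * m), 2 * Real.pi * Complex.I *
        (2 ^ r.val / 2 ^ (s.val + 1)) * ((d r : ℕ) : ℂ) * ((b s : ℕ) : ℂ)) =
      ∏ r : Fin (2 * m), ∏ s : Fin (2 * m), if d r = 1 ∧ b s = 1 then qftPhase r s else 1 := by
    rw [Complex.exp_sum]
    refine Finset.prod_congr rfl fun r _ => ?_
    rw [Complex.exp_sum]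
    refine Finset.prod_congr rfl fun s _ => ?_
    rcases fin_two_eq_zero_or (d r) with h1 | h1 <;>
      rcases fin_two_eq_zero_or (b s) with h2 | h2 <;> simp [h1, h2, qftPhase]
  rw [hprod]
  push_cast
  ring

/-- The register part of a basis state. -/
def regPart {M : ℕ} (x : Qubits (M + workQubits M)) : Qubits M := fun r => x (regQ r)

/-- Inversion of the leading bit followed by the shifted Fourier transform. -/
lemma exists_gates_shiftedQFT (hm : 0 < m) :
    ∃ c : List (Gate (2 * m + workQubits (2 * m))), c.length ≤ 2 * m * (2 + 2 * m) + 4 ∧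
      ∀ y z, gatesMatrix c z y =
        if ∀ q, 2 * m ≤ q.val → z q = y q then
          shiftedQFT m (finFunctionFinEquiv (regPart z))
            (bitIndex (flipBit ⟨0, by omega⟩ (regPart y))) else 0 := by
  set r₀ : Fin (2 * m) := ⟨0, by omega⟩ with hr₀
  set r₁ : Fin (2 * m) := ⟨2 * m - 1, by omega⟩ with hr₁
  obtain ⟨c1, hc1, h1⟩ := realizes_not (regQ_ne_spareQ r₀)
  obtain ⟨c2, hc2, h2⟩ := realizes_diag (regQ r₁ : Fin (2 * m + workQubits (2 * m))) (regQ r₁)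
    (fun i _ => if i = 1 then -1 else 1) (fun i _ => by split_ifs <;> simp) Set.univ
  obtain ⟨c3, hc3, h3⟩ := exists_gates_qft (2 * m) (2 * m) le_rfl
  obtain ⟨c4, hc4, h4⟩ := realizes_diag (regQ r₀ : Fin (2 * m + workQubits (2 * m))) (regQ r₀)
    (fun i _ => if i = 1 then -1 else 1) (fun i _ => by split_ifs <;> simp) Set.univ
  refine ⟨c1 ++ c2 ++ c3 ++ c4, by simp only [List.length_append]; omega, fun y z => ?_⟩
  have e0 : gatesMatrix (c1 ++ c2 ++ c3 ++ c4) z y =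
      (gatesMatrix (c1 ++ c2 ++ c3 ++ c4) *ᵥ Pi.single y 1) z := by simp
  set y' := flipBit (regQ r₀) y with hy'
  have e1 : gatesMatrix c1 *ᵥ Pi.single y 1 = Pi.single y' 1 := by
    rw [h1 _ (suppIn_univ _)]
    ext x
    simp only [Pi.single_apply]
    congr 1
    rw [eq_iff_iff]
    exact ⟨fun h => by rw [hy', ← h, flipBit_flipBit], fun h => by rw [h, hy', flipBit_flipBit]⟩
  have e2 : gatesMatrix c2 *ᵥ Pi.single y' 1 =
      (if y' (regQ r₁) = 1 then (-1 : ℂ) else 1) • Pi.single y' 1 := by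
    rw [h2 _ (suppIn_univ _)]
    ext x
    simp only [Pi.single_apply, Pi.smul_apply, smul_eq_mul]
    by_cases h : x = y' <;> simp [h]
  rw [e0]
  simp only [gatesMatrix_append, ← Matrix.mulVec_mulVec]
  rw [e1, e2, Matrix.mulVec_smul, h3, Matrix.mulVec_smul, h4 _ (suppIn_univ _), Pi.smul_apply,
    smul_eq_mul]
  simp only [qftState]
  have hcond : (∀ q, 2 * m ≤ q.val → z q = y' q) ↔ ∀ q, 2 * m ≤ q.val → z q = y q :=
    forall₂_congr fun q hq => by
      rw [hy', flipBit_of_ne (ne_of_val_ne (by change q.val ≠ 0; omega))]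
  have hreg : flipBit r₀ (regPart y) = regPart y' := by
    ext1 r
    by_cases h : r = r₀
    · subst h; simp [regPart, hy']
    · rw [flipBit_of_ne h]
      simp only [regPart, hy']
      rw [flipBit_of_ne (regQ_injective.ne h)]
  simp only [hcond]
  by_cases hz : ∀ q, 2 * m ≤ q.val → z q = y q
  · rw [if_pos hz, if_pos hz, hreg, shiftedQFT_bits hm, ← hr₀, ← hr₁]
    simp only [Fin.is_lt, if_true, qftRow]
    exact mul_left_comm _ _ _
  · rw [if_neg hz, if_neg hz]
    simp

end ShiftedFourier

/-! ### Circuits consisting of gates, controlled evolutions, gates -/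

section Evolution

variable {S : Type*} [Fintype S] [DecidableEq S]

lemma evolution_add (O : Matrix S S ℂ) (τ τ' : ℝ) :
    evolution O (τ + τ') = evolution O τ * evolution O τ' := by
  rw [evolution, evolution, evolution, ← Matrix.exp_add_of_commute, ← add_smul]
  · congr 2; push_cast; ring
  · exact (Commute.refl O).smul_left _ |>.smul_right _

@[simp] lemma evolution_zero (O : Matrix S S ℂ) : evolution O 0 = 1 := by
  simp [evolution, NormedSpace.exp_zero]

variable {a : ℕ}

lemma circuitMatrix_append (O : Matrix S S ℂ) (c d : List (Op a)) :
    circuitMatrix O (c ++ d) = circuitMatrix O d * circuitMatrix O c := by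
  induction c with
  | nil => simp [circuitMatrix]
  | cons g c ih => simp [circuitMatrix, ih, Matrix.mul_assoc]

set_option linter.unusedSectionVars false in
lemma kronecker_one_apply (U : Matrix (Qubits a) (Qubits a) ℂ) (s s' : S) (x y : Qubits a) :
    Matrix.kronecker (1 : Matrix S S ℂ) U (s, x) (s', y) = if s = s' then U x y else 0 := by
  rw [Matrix.kronecker, Matrix.kroneckerMap_apply, Matrix.one_apply]
  split_ifs <;> simp

lemma circuitMatrix_gates (O : Matrix S S ℂ) (c : List (Gate a)) :
    circuitMatrix O (c.map Op.gate) = Matrix.kronecker (1 : Matrix S S ℂ) (gatesMatrix c) := by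
  induction c with
  | nil => simp [circuitMatrix, gatesMatrix]
  | cons g c ih =>
    simp only [List.map_cons, circuitMatrix, ih, Op.toMatrix, gatesMatrix]
    exact (Matrix.mul_kronecker_mul 1 1 (gatesMatrix c) g.1).symm.trans (by rw [Matrix.one_mul]; rfl)

lemma ctrlEvolution_apply (O : Matrix S S ℂ) (i : Fin a) (τ : ℝ) (s s' : S) (x y : Qubits a) :
    (Op.ctrlEvolution i τ).toMatrix O (s, x) (s', y) =
      if x = y then (if x i = 1 then evolution O τ s s' else (1 : Matrix S S ℂ) s s') else 0 := rfl

lemma circuitMatrix_evolutions (O : Matrix S S ℂ) {ι : Type*} (l : List ι) (q : ι → Fin a)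
    (β : ι → ℝ) (s s' : S) (x y : Qubits a) :
    circuitMatrix O (l.map fun i => Op.ctrlEvolution (q i) (β i)) (s, x) (s', y) =
      if x = y then evolution O (l.map fun i => if x (q i) = 1 then β i else 0).sum s s' else 0 := by
  induction l generalizing s s' x y with
  | nil =>
    simp only [List.map_nil, circuitMatrix, List.sum_nil, evolution_zero, Matrix.one_apply,
      Prod.mk.injEq]
    by_cases h : x = y <;> simp [h]
  | cons i l ih =>
    simp only [List.map_cons, circuitMatrix, List.sum_cons]
    rw [Matrix.mul_apply, Fintype.sum_prod_type]
    simp only [ih, ctrlEvolution_apply]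
    by_cases h : x = y
    · subst h
      simp only [if_true, ite_mul, zero_mul, Finset.sum_ite_eq, Finset.mem_univ]
      rw [add_comm, evolution_add]
      by_cases h' : x (q i) = 1
      · simp only [h', if_true]; rw [Matrix.mul_apply]
      · simp only [h', if_false]; rw [evolution_zero, Matrix.mul_apply]
    · simp [h]

/-- The controlled evolutions are diagonal in the ancilla basis. A path through the circuit is
therefore fixed by one intermediate basis state `x`, along which the system evolves for the total
time of the qubits that are 1. -/
lemma circuitKraus_eq (O : Matrix S S ℂ) (c d : List (Gate a)) {ι : Type*} (l : List ι)
    (q : ι → Fin a) (β : ι → ℝ) (z : Qubits a) :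
    circuitKraus O (c.map Op.gate ++ (l.map fun i => Op.ctrlEvolution (q i) (β i)) ++
      d.map Op.gate) z =
      ∑ x, (gatesMatrix d z x * (gatesMatrix c *ᵥ zeroVec a) x) •
        evolution O (l.map fun i => if x (q i) = 1 then β i else 0).sum := by
  have h0 : ∀ x, (gatesMatrix c *ᵥ zeroVec a) x = gatesMatrix c x fun _ => 0 := by
    simp [zeroVec]
  ext s s'
  rw [circuitKraus, circuitMatrix_append, circuitMatrix_append, circuitMatrix_gates,
    circuitMatrix_gates, Matrix.mul_apply, Fintype.sum_prod_type, Finset.sum_comm,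
    Matrix.sum_apply]
  refine Finset.sum_congr rfl fun x _ => ?_
  rw [Matrix.smul_apply, smul_eq_mul, h0]
  simp only [kronecker_one_apply, ite_mul, zero_mul, Finset.sum_ite_eq, Finset.mem_univ, if_true]
  rw [Matrix.mul_apply, Fintype.sum_prod_type, Finset.sum_comm]
  simp only [kronecker_one_apply, circuitMatrix_evolutions, ite_mul, zero_mul, mul_ite, mul_zero,
    Finset.sum_ite_eq, Finset.mem_univ, if_true, Finset.sum_ite_eq']
  ring

end Evolution

/-! ### Binary encodings of the grid index -/

section Assembly

variable {m : ℕ}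

/-- The weight of the qubit `r` in the absolute value of the grid index, when the first qubit
encodes the sign. -/
def signedWeight (m : ℕ) (r : Fin (2 * m)) : ℝ := if r.val = 0 then 1 else 2 ^ (2 * m - 1 - r.val)

/-- The weight of the qubit `r` in the grid index, in two's complement. -/
def indexWeight (m : ℕ) (r : Fin (2 * m)) : ℝ :=
  if r.val = 0 then -2 ^ (2 * m - 1) else 2 ^ (2 * m - 1 - r.val)

/-- The grid index `ℓ - N / 2`. -/
def gridIndex (m : ℕ) (l : Fin (2 ^ (2 * m))) : ℝ := (l : ℝ) - 2 ^ (2 * m) / 2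

/-- The squared normalization of the discrete Gaussian amplitudes. -/
def gaussSum (α : ℝ) (m : ℕ) : ℝ :=
  ∑ l : Fin (2 ^ (2 * m)), if (l : ℕ) = 0 then 0 else Real.exp (-(2 * α * gridIndex m l ^ 2))

/-- The grid point of a string of bits in two's complement. -/
def toGrid (hm : 0 < m) (y : Qubits (2 * m)) : Fin (2 ^ (2 * m)) :=
  bitIndex (flipBit ⟨0, by omega⟩ y)

lemma bitIndex_bijective {M : ℕ} : Function.Bijective (bitIndex (M := M)) := by
  have : (bitIndex : Qubits M → Fin (2 ^ M)) =
      finFunctionFinEquiv ∘ (Equiv.arrowCongr Fin.revPerm (Equiv.refl (Fin 2))) := by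
    ext1 y
    simp only [bitIndex, Function.comp]
    congr 1
  rw [this]
  exact finFunctionFinEquiv.bijective.comp (Equiv.bijective _)

lemma toGrid_bijective (hm : 0 < m) : Function.Bijective (toGrid hm) :=
  bitIndex_bijective.comp (flipEquiv _).bijective

lemma gridIndex_toGrid (hm : 0 < m) (y : Qubits (2 * m)) :
    gridIndex m (toGrid hm y) = ∑ r, indexWeight m r * ((y r : ℕ) : ℝ) := by
  have h : ∀ r : Fin (2 * m), (((flipBit ⟨0, by omega⟩ y r : ℕ) : ℝ)) * 2 ^ (2 * m - 1 - r.val) =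
      indexWeight m r * ((y r : ℕ) : ℝ) + if r = ⟨0, by omega⟩ then 2 ^ (2 * m - 1) else 0 := by
    intro r
    by_cases hr : r = ⟨0, by omega⟩
    · subst hr
      rcases fin_two_eq_zero_or (y ⟨0, by omega⟩) with h | h <;> simp [indexWeight, h]
    · have hr' : r.val ≠ 0 := fun h => hr (Fin.ext h)
      rw [flipBit_of_ne hr]
      simp only [indexWeight, if_neg hr', if_neg hr, add_zero]
      ring
  rw [gridIndex, toGrid, val_bitIndex]
  push_cast
  rw [Finset.sum_congr rfl fun r _ => h r, Finset.sum_add_distrib]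
  have : (2 : ℝ) ^ (2 * m) = 2 * 2 ^ (2 * m - 1) := by
    rw [← pow_succ']; congr 1; omega
  rw [this]
  simp

lemma toGrid_eq_zero_iff (hm : 0 < m) (y : Qubits (2 * m)) :
    (toGrid hm y : ℕ) = 0 ↔ ∀ r : Fin (2 * m), flipBit ⟨0, by omega⟩ y r = 0 := by
  rw [toGrid, val_bitIndex, Finset.sum_eq_zero_iff]
  refine ⟨fun h r => Fin.ext ?_, fun h r _ => by rw [h r]; simp⟩
  have := h r (Finset.mem_univ r)
  rcases Nat.mul_eq_zero.1 this with h' | h'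
  · exact h'
  · exact absurd h' (by positivity)

/-- Conversion between the sign-magnitude and the two's complement encoding. -/
def encode (hm : 0 < m) (y : Qubits (2 * m)) : Qubits (2 * m) := fun r =>
  if y ⟨0, by omega⟩ = 1 ∧ r.val ≠ 0 then 1 - y r else y r

/-- The all-ones string of the sign-magnitude encoding is the index -N/2, the point ℓ = 0 that the
resource state omits. -/
lemma encode_eq_one_iff (hm : 0 < m) (y : Qubits (2 * m)) :
    (∀ r, encode hm y r = 1) ↔ (toGrid hm y : ℕ) = 0 := by
  rw [toGrid_eq_zero_iff]
  have hb : ∀ b : Fin 2, 1 - b = 1 ↔ b = 0 := by decide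
  have hb' : ∀ b : Fin 2, 1 - b = 0 ↔ b = 1 := by decide
  constructor
  · intro h r
    have h0 : y ⟨0, by omega⟩ = 1 := by simpa [encode] using h ⟨0, by omega⟩
    by_cases hr : r = ⟨0, by omega⟩
    · subst hr; rw [flipBit_same, h0]; rfl
    · have hr' : r.val ≠ 0 := fun h => hr (Fin.ext h)
      have := h r
      rw [encode, if_pos ⟨h0, hr'⟩, hb] at this
      rw [flipBit_of_ne hr, this]
  · intro h r
    have h0 : y ⟨0, by omega⟩ = 1 := by
      have := h ⟨0, by omega⟩
      rwa [flipBit_same, hb'] at this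
    by_cases hr : r = ⟨0, by omega⟩
    · subst hr; simp [encode, h0]
    · have hr' : r.val ≠ 0 := fun h => hr (Fin.ext h)
      rw [encode, if_pos ⟨h0, hr'⟩, hb]
      have := h r
      rwa [flipBit_of_ne hr] at this

lemma sum_pow_weights (hm : 0 < m) :
    ∑ r : Fin (2 * m), (2 : ℝ) ^ (2 * m - 1 - r.val) = 2 * 2 ^ (2 * m - 1) - 1 := by
  rw [Fin.sum_univ_eq_sum_range (fun r => (2 : ℝ) ^ (2 * m - 1 - r)) (2 * m),
    Finset.sum_range_reflect (fun r => (2 : ℝ) ^ r) (2 * m), geom_sum_eq (by norm_num)]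
  have : (2 : ℝ) ^ (2 * m) = 2 * 2 ^ (2 * m - 1) := by
    rw [← pow_succ']; congr 1; omega
  rw [this]; norm_num

/-- With leading bit 1, the two's complement index is minus one plus minus the complement of the
remaining bits. So complementing those bits and giving the leading qubit the weight 1 yields the
absolute value, with nonnegative weights as the filters require. -/
lemma weight_encode_sq (hm : 0 < m) (y : Qubits (2 * m)) :
    weight (signedWeight m) (encode hm y) ^ 2 = gridIndex m (toGrid hm y) ^ 2 := by
  rw [gridIndex_toGrid]
  rcases fin_two_eq_zero_or (y ⟨0, by omega⟩) with h | h
  · congr 1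
    refine Finset.sum_congr rfl fun r _ => ?_
    by_cases hr : r.val = 0
    · have : y r = 0 := by rw [← h]; congr 1; exact Fin.ext hr
      simp [encode, h, this]
    · simp [encode, h, signedWeight, indexWeight, hr]
  · have key : ∀ r : Fin (2 * m), signedWeight m r * ((encode hm y r : ℕ) : ℝ) =
        -(indexWeight m r * ((y r : ℕ) : ℝ)) + (2 ^ (2 * m - 1 - r.val) -
          if r = ⟨0, by omega⟩ then 2 * 2 ^ (2 * m - 1) - 1 else 0) := by
      intro r
      by_cases hr : r = ⟨0, by omega⟩
      · subst hr
        simp [encode, h, signedWeight, indexWeight]; ring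
      · have hr' : r.val ≠ 0 := fun h => hr (Fin.ext h)
        rcases fin_two_eq_zero_or (y r) with h' | h' <;>
          simp [encode, h, signedWeight, indexWeight, hr, hr', h']
    rw [weight, Finset.sum_congr rfl fun r _ => key r, Finset.sum_add_distrib,
      Finset.sum_sub_distrib, sum_pow_weights hm]
    simp

lemma encode_encode (hm : 0 < m) (y : Qubits (2 * m)) : encode hm (encode hm y) = y := by
  ext1 r
  have h0 : encode hm y ⟨0, by omega⟩ = y ⟨0, by omega⟩ := by simp [encode]
  by_cases h : y ⟨0, by omega⟩ = 1 ∧ r.val ≠ 0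
  · rw [encode, h0, if_pos h, encode, if_pos h, fin_two_one_sub_one_sub]
  · rw [encode, h0, if_neg h, encode, if_neg h]

lemma partitionSum_signedWeight (hm : 0 < m) (α : ℝ) :
    partitionSum α (signedWeight m) = gaussSum α m := by
  rw [gaussSum, ← Function.Bijective.sum_comp (toGrid_bijective hm) (fun l => if (l : ℕ) = 0 then 0
      else Real.exp (-(2 * α * gridIndex m l ^ 2))), partitionSum,
    ← Function.Bijective.sum_comp (Function.Involutive.bijective (encode_encode hm))
      (fun y => if ∀ r, y r = 1 then 0 else Real.exp (-(2 * α * weight (signedWeight m) y ^ 2)))]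
  refine Finset.sum_congr rfl fun y _ => ?_
  simp only [encode_eq_one_iff, weight_encode_sq]

/-- Amplitudes of the resource state in terms of the grid index. -/
lemma resource_eq {γ : ℝ} (hγ : 0 < γ) (m : ℕ) (l : Fin (2 ^ (2 * m))) :
    resource γ m l = if (l : ℕ) = 0 then 0 else
      ((Real.exp (-((4 * Real.pi ^ 2 * γ ^ 2 * step m ^ 2) * gridIndex m l ^ 2)) /
        √(gaussSum (4 * Real.pi ^ 2 * γ ^ 2 * step m ^ 2) m) : ℝ) : ℂ) := by
  have hs : 0 < step m := by rw [step]; positivity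
  set A := 2 * √(2 * Real.pi) * γ with hA
  have hApos : 0 < A := by positivity
  have hn : normConst γ m = √(step m) * √A *
      √(gaussSum (4 * Real.pi ^ 2 * γ ^ 2 * step m ^ 2) m) := by
    rw [normConst, ← Real.sqrt_mul hs.le, ← Real.sqrt_mul (by positivity), mul_assoc]
    congr 2
    rw [gaussSum, Finset.mul_sum]
    refine Finset.sum_congr rfl fun l _ => ?_
    split_ifs
    · simp
    · rw [gaussHat, mul_pow, Real.sq_sqrt hApos.le, ← Real.exp_nat_mul]
      congr 2
      simp only [gridPoint, gridIndex]; push_cast; ring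
  rw [resource]
  split_ifs with h
  · rfl
  · congr 1
    rw [hn, gaussHat, ← hA]
    have h1 : √(step m) ≠ 0 := (Real.sqrt_pos.2 hs).ne'
    have h2 : √A ≠ 0 := (Real.sqrt_pos.2 hApos).ne'
    have h3 : Real.exp (-(4 * Real.pi ^ 2 * γ ^ 2 * gridPoint m l ^ 2)) =
        Real.exp (-((4 * Real.pi ^ 2 * γ ^ 2 * step m ^ 2) * gridIndex m l ^ 2)) := by
      congr 1
      simp only [gridPoint, gridIndex]; ring
    rw [h3, ← mul_assoc, mul_div_mul_left _ _ (mul_ne_zero h1 h2)]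

end Assembly

/-! ### The complete circuit -/

section Assembly

variable {m : ℕ}

/-- The evolution times of the readout qubits. -/
def evolutionAngle (κ : ℝ) (m : ℕ) (r : Fin (2 * m)) : ℝ :=
  2 * Real.pi * (indexWeight m r * step m) / κ

lemma sum_evolutionAngle (hm : 0 < m) (κ : ℝ) (y : Qubits (2 * m)) :
    ((List.finRange (2 * m)).map fun r => if y r = 1 then evolutionAngle κ m r else 0).sum =
      2 * Real.pi * gridPoint m (toGrid hm y) / κ := by
  rw [← List.ofFn_eq_map, List.sum_ofFn]
  have h : gridPoint m (toGrid hm y) = gridIndex m (toGrid hm y) * step m := rfl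
  rw [h, gridIndex_toGrid, Finset.sum_mul, Finset.mul_sum, Finset.sum_div]
  refine Finset.sum_congr rfl fun r _ => ?_
  rcases fin_two_eq_zero_or (y r) with h | h <;> simp [h, evolutionAngle]

/-- The list of the controlled evolutions. -/
def evolutionOps (κ : ℝ) (m : ℕ) : List (Op (2 * m + workQubits (2 * m))) :=
  (List.finRange (2 * m)).map fun r => Op.ctrlEvolution (regQ r) (evolutionAngle κ m r)

lemma step_pos (m : ℕ) : 0 < step m := by rw [step]; positivity

lemma evolutionTime_gates {a : ℕ} (c : List (Gate a)) : evolutionTime (c.map Op.gate) = 0 := by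
  rw [evolutionTime, List.map_map]
  refine List.sum_eq_zero fun x hx => ?_
  simp only [List.mem_map, Function.comp] at hx
  obtain ⟨g, _, rfl⟩ := hx
  rfl

lemma evolutionTime_append {a : ℕ} (c d : List (Op a)) :
    evolutionTime (c ++ d) = evolutionTime c + evolutionTime d := by
  simp [evolutionTime]

/-- The absolute weights 1, 2, 4, ... add up to N - 1, and N h = 2^m. -/
lemma evolutionTime_evolutionOps (hm : 0 < m) {κ : ℝ} (hκ : 0 < κ) :
    evolutionTime (evolutionOps κ m) ≤ 2 * Real.pi * 2 ^ m / κ := by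
  have h1 : ∀ r : Fin (2 * m), |evolutionAngle κ m r| =
      2 ^ (2 * m - 1 - r.val) * (2 * Real.pi * step m / κ) := by
    intro r
    have hs := step_pos m
    have h : evolutionAngle κ m r = indexWeight m r * (2 * Real.pi * step m / κ) := by
      rw [evolutionAngle]; ring
    have hp : 0 ≤ 2 * Real.pi * step m / κ := by positivity
    rw [h, abs_mul, abs_of_nonneg hp, indexWeight]
    congr 1
    split_ifs with hr
    · rw [abs_neg, abs_of_nonneg (by positivity), hr]; rfl
    · rw [abs_of_nonneg (by positivity)]
  have h2 : evolutionTime (evolutionOps κ m) = ∑ r, |evolutionAngle κ m r| := by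
    rw [evolutionTime, evolutionOps, List.map_map, ← List.ofFn_eq_map, List.sum_ofFn]
    rfl
  rw [h2, Finset.sum_congr rfl fun r _ => h1 r, ← Finset.sum_mul, sum_pow_weights hm]
  have h3 : (2 : ℝ) * 2 ^ (2 * m - 1) = 2 ^ m * 2 ^ m := by
    rw [← pow_succ', ← pow_add]; congr 1; omega
  rw [h3, step]
  have h4 : (0 : ℝ) < 2 ^ m := by positivity
  calc ((2 : ℝ) ^ m * 2 ^ m - 1) * (2 * Real.pi * (2 ^ m)⁻¹ / κ)
      ≤ (2 ^ m * 2 ^ m) * (2 * Real.pi * (2 ^ m)⁻¹ / κ) := by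
        have := Real.pi_pos
        exact mul_le_mul_of_nonneg_right (by linarith) (by positivity)
    _ = 2 * Real.pi * 2 ^ m / κ := by field_simp

lemma regPart_multiNot (hm : 0 < m) (x : Qubits (2 * m + workQubits (2 * m))) :
    regPart (multiNot (regQ ⟨0, by omega⟩)
      (((List.finRange (2 * m)).filter fun r => r.val ≠ 0).map regQ) x) =
    encode hm (regPart x) := by
  ext1 r
  simp only [regPart, multiNot, encode, List.mem_map, List.mem_filter, List.mem_finRange, true_and,
    regQ_injective.eq_iff, exists_eq_right, decide_eq_true_eq]
  congr

lemma workZero_multiNot {M : ℕ} {c : Fin (M + workQubits M)} {l : List (Fin M)}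
    (x : Qubits (M + workQubits M)) :
    WorkZero (multiNot c (l.map regQ) x) ↔ WorkZero x := by
  refine forall₂_congr fun q hq => ?_
  rw [multiNot, if_neg]
  rintro ⟨_, h⟩
  simp only [List.mem_map] at h
  obtain ⟨r, _, rfl⟩ := h
  simp at hq; omega

/-- Every filtered phase estimation instrument with enough success probability of the filters is
implemented exactly by a circuit of polynomial size. -/
theorem exists_circuit (hm : 0 < m) {γ : ℝ} (hγ : 0 < γ)
    (hZ : ∏ r, (1 + Real.exp (-(2 * (4 * Real.pi ^ 2 * γ ^ 2 * step m ^ 2) *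
      signedWeight m r ^ 2))) ≤ 4 * gaussSum (4 * Real.pi ^ 2 * γ ^ 2 * step m ^ 2) m)
    {κ : ℝ} (hκ : 0 < κ) :
    ∃ c : List (Op (2 * m + workQubits (2 * m))),
      evolutionTime c ≤ 2 * Real.pi * 2 ^ m / κ ∧ c.length ≤ 510 * (2 * m) ^ 3 ∧
      ∀ {S : Type} [Fintype S] [DecidableEq S] (O : Matrix S S ℂ),
        Implements O c (krausOp κ γ m O) := by
  set α := 4 * Real.pi ^ 2 * γ ^ 2 * step m ^ 2 with hα
  rw [← partitionSum_signedWeight hm] at hZ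
  obtain ⟨c1, hc1, h1⟩ := exists_gates_weightState (M := 2 * m) (by omega) (by positivity)
    (fun r => by rw [signedWeight]; split_ifs <;> positivity) hZ
  set ts : List (Fin (2 * m + workQubits (2 * m))) :=
    ((List.finRange (2 * m)).filter fun r => r.val ≠ 0).map regQ with hts
  obtain ⟨c2, hc2, h2⟩ := realizes_multiNot (c := regQ ⟨0, by omega⟩) ts
    (((List.nodup_finRange _).filter _).map regQ_injective) (by simp [hts, regQ_injective.eq_iff])
  obtain ⟨c3, hc3, h3⟩ := exists_gates_shiftedQFT hm
  have hlts : ts.length ≤ 2 * m := by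
    rw [hts, List.length_map]
    exact (List.length_filter_le _ _).trans (by simp)
  have hprep : ∀ x, (gatesMatrix (c1 ++ c2) *ᵥ zeroVec _) x =
      if WorkZero x then resource γ m (toGrid hm (regPart x)) else 0 := by
    intro x
    rw [gatesMatrix_append, ← Matrix.mulVec_mulVec, h1, h2 _ (suppIn_univ _)]
    have e := regPart_multiNot hm x
    rw [← hts] at e
    have e' : ∀ r, multiNot (regQ ⟨0, by omega⟩) ts x (regQ r) = encode hm (regPart x) r :=
      fun r => congrFun e r
    simp only [weightState, hts, workZero_multiNot]
    simp only [← hts, e', encode_eq_one_iff, weight_encode_sq, resource_eq hγ,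
      partitionSum_signedWeight hm, ← hα]
  refine ⟨(c1 ++ c2).map Op.gate ++ evolutionOps κ m ++ c3.map Op.gate, ?_, ?_, ?_⟩
  · rw [evolutionTime_append, evolutionTime_append, evolutionTime_gates, evolutionTime_gates]
    simpa using evolutionTime_evolutionOps hm hκ
  · simp only [List.length_append, List.length_map, evolutionOps, List.length_finRange]
    have h4 : (2 * m) ^ 3 = 2 * m * (2 * m) ^ 2 := by ring
    nlinarith [Nat.zero_le m, Nat.pow_le_pow_left hm 2, Nat.pow_le_pow_left hm 3]
  · intro S _ _ O j ρ
    -- The preparation returns all work qubits to 0 and nothing touches them later. Discarding them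
    -- thus leaves a single nonzero term, which makes the implementation exact.
    have hK : ∀ z, circuitKraus O ((c1 ++ c2).map Op.gate ++ evolutionOps κ m ++ c3.map Op.gate) z =
        if WorkZero z then krausOp κ γ m O (readout (2 * m) _ z) else 0 := by
      intro z
      rw [evolutionOps, circuitKraus_eq]
      by_cases hz : WorkZero z
      · rw [if_pos hz, krausOp, ← Function.Bijective.sum_comp (toGrid_bijective hm)
          (fun l => (shiftedQFT m (readout (2 * m) _ z) l * resource γ m l) •
            evolution O (2 * Real.pi * gridPoint m l / κ))]
        refine (Finset.sum_congr rfl fun x _ => ?_).trans (sum_workZero (M := 2 * m) fun y =>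
          (shiftedQFT m (readout (2 * m) _ z) (toGrid hm y) * resource γ m (toGrid hm y)) •
            evolution O (2 * Real.pi * gridPoint m (toGrid hm y) / κ))
        have hcond : (∀ q : Fin (2 * m + workQubits (2 * m)), 2 * m ≤ q.val → z q = x q) ↔
            WorkZero x :=
          forall₂_congr fun q hq => by rw [hz q hq]; exact eq_comm
        rw [hprep, h3]
        simp only [hcond]
        by_cases hx : WorkZero x
        · simp only [if_pos hx]
          exact congrArg₂ (fun (c : ℂ) (U : Matrix S S ℂ) => c • U) rfl
            (congrArg (evolution O) (sum_evolutionAngle hm κ (regPart x)))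
        · simp [hx]
      · rw [if_neg hz]
        refine Finset.sum_eq_zero fun x _ => ?_
        rw [hprep, h3]
        by_cases hx : WorkZero x
        · rw [if_neg, zero_mul, zero_smul]
          intro h
          exact hz fun q hq => (h q hq).trans (hx q hq)
        · simp [hx]
    set z₀ : Qubits (2 * m + workQubits (2 * m)) :=
      Fin.append (finFunctionFinEquiv.symm j) (fun _ => 0) with hz₀
    have hr0 : readout (2 * m) _ z₀ = j := by
      have : (fun i => z₀ (Fin.castAdd (workQubits (2 * m)) i)) = finFunctionFinEquiv.symm j := by
        ext1 i; simp [hz₀]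
      rw [readout, this, Equiv.apply_symm_apply]
    have hw0 : WorkZero z₀ := by
      intro q hq
      obtain ⟨i, rfl⟩ : ∃ i, q = Fin.natAdd (2 * m) i :=
        ⟨⟨q.val - 2 * m, by omega⟩, by ext; simp; omega⟩
      simp [hz₀]
    rw [Finset.sum_eq_single z₀]
    · rw [hK, if_pos hw0, hr0]
    · intro z hz hzz
      rw [hK, if_neg]
      · simp
      · intro hw
        refine hzz (funext fun q => ?_)
        rw [Finset.mem_filter] at hz
        by_cases hq : 2 * m ≤ q.val
        · rw [hw q hq, hw0 q hq]
        · have he := hz.2.trans hr0.symm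
          rw [readout, readout, EmbeddingLike.apply_eq_iff_eq] at he
          have := congrFun he ⟨q.val, by omega⟩
          simpa using this
    · intro h
      exact absurd (by simp [hr0]) h

end Assembly

/-! ### Lattice sums of Gaussians and theta duality -/

section GaussianSums

open Real

lemma summable_half_pow_natAbs : Summable fun n : ℤ => (1 / 2 : ℝ) ^ n.natAbs := by
  refine Summable.of_nat_of_neg ?_ ?_ <;> simpa using summable_geometric_two

lemma tsum_half_pow_natAbs : ∑' n : ℤ, (1 / 2 : ℝ) ^ n.natAbs = 3 := by
  have h : Summable fun n : ℕ => (1 / 2 : ℝ) ^ n := summable_geometric_two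
  rw [tsum_of_nat_of_neg_add_one (by simpa using h)]
  · have h2 : ∀ n : ℕ, (1 / 2 : ℝ) ^ (-((n : ℤ) + 1)).natAbs = 1 / 2 * (1 / 2) ^ n := by
      intro n
      rw [show (-((n : ℤ) + 1)).natAbs = n + 1 by omega, pow_succ']
    simp only [h2, Int.natAbs_natCast]
    rw [tsum_mul_left, tsum_geometric_two]; norm_num
  · refine ((summable_nat_add_iff 1).2 h).congr fun n => ?_
    congr 1

/-- With |n| = k + 1 and b ≥ 1 one has b n² ≥ b + 2k. One factor exp(-k) pays for |n| and the other
one gives a geometric series. -/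
lemma natAbs_mul_exp_le {b : ℝ} (hb : 1 ≤ b) {n : ℤ} (hn : n ≠ 0) :
    |(n : ℝ)| * exp (-(b * n ^ 2)) ≤ exp (-b) * (2 * (1 / 2) ^ n.natAbs) := by
  obtain ⟨k, hk⟩ : ∃ k : ℕ, n.natAbs = k + 1 := ⟨n.natAbs - 1, by have := Int.natAbs_pos.2 hn; omega⟩
  have h1 : |(n : ℝ)| = (k : ℝ) + 1 := by
    have : ((n.natAbs : ℕ) : ℝ) = |(n : ℝ)| := by
      rw [Nat.cast_natAbs]; simp
    rw [← this, hk]; push_cast; ring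
  rw [← sq_abs (n : ℝ), h1, hk]
  have h2 : (k : ℝ) + 1 ≤ exp k := add_one_le_exp _
  have h3 : (2 : ℝ) ^ k ≤ exp k := by
    rw [← exp_one_pow]
    exact pow_le_pow_left₀ (by norm_num) (by linarith [add_one_le_exp (1 : ℝ)]) k
  have h4 : exp (-(b * ((k : ℝ) + 1) ^ 2)) ≤ exp (-b) * (exp (-k) * exp (-k)) := by
    rw [← exp_add, ← exp_add, exp_le_exp]
    have hk0 : (0 : ℝ) ≤ k := Nat.cast_nonneg k
    have : (0 : ℝ) ≤ (b - 1) * (2 * k + k ^ 2) := mul_nonneg (by linarith) (by positivity)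
    nlinarith
  have h5 : (2 : ℝ) * (1 / 2) ^ (k + 1) = ((2 : ℝ) ^ k)⁻¹ := by
    rw [pow_succ, one_div, inv_pow]; ring
  rw [h5]
  calc ((k : ℝ) + 1) * exp (-(b * ((k : ℝ) + 1) ^ 2))
      ≤ exp k * (exp (-b) * (exp (-k) * exp (-k))) :=
        mul_le_mul h2 h4 (exp_pos _).le (exp_pos _).le
    _ = exp (-b) * exp (-k) := by
        rw [exp_neg (k : ℝ)]; field_simp
    _ ≤ exp (-b) * ((2 : ℝ) ^ k)⁻¹ := by
        rw [exp_neg (k : ℝ)]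
        gcongr

lemma summable_exp_neg_mul_int_sq_mul_abs {b : ℝ} (hb : 1 ≤ b) :
    Summable fun n : ℤ => |(n : ℝ)| * exp (-(b * n ^ 2)) := by
  refine Summable.of_nonneg_of_le (fun n => by positivity) (fun n => ?_)
    ((summable_half_pow_natAbs.mul_left 2).mul_left (exp (-b)))
  by_cases hn : n = 0
  · simp only [hn, Int.cast_zero, abs_zero, zero_mul]; positivity
  · exact natAbs_mul_exp_le hb hn

lemma tsum_abs_mul_exp_le {b : ℝ} (hb : 1 ≤ b) :
    ∑' n : ℤ, |(n : ℝ)| * exp (-(b * n ^ 2)) ≤ 6 * exp (-b) := by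
  refine (Summable.tsum_le_tsum (fun n => ?_) (summable_exp_neg_mul_int_sq_mul_abs hb)
    ((summable_half_pow_natAbs.mul_left 2).mul_left (exp (-b)))).trans ?_
  · by_cases hn : n = 0
    · simp only [hn, Int.cast_zero, abs_zero, zero_mul]; positivity
    · exact natAbs_mul_exp_le hb hn
  · rw [tsum_mul_left, tsum_mul_left, tsum_half_pow_natAbs]; linarith

lemma exp_neg_mul_int_sq_le {b : ℝ} (n : ℤ) :
    exp (-(b * n ^ 2)) ≤ (if n = 0 then 1 else 0) + |(n : ℝ)| * exp (-(b * n ^ 2)) := by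
  split_ifs with hn
  · simp [hn]
  · have : (1 : ℝ) ≤ |(n : ℝ)| := by
      rw [← Int.cast_abs]; exact_mod_cast Int.one_le_abs hn
    nlinarith [exp_pos (-(b * (n : ℝ) ^ 2))]

lemma summable_exp_neg_mul_int_sq {b : ℝ} (hb : 1 ≤ b) :
    Summable fun n : ℤ => exp (-(b * n ^ 2)) := by
  refine Summable.of_nonneg_of_le (fun n => (exp_pos _).le) exp_neg_mul_int_sq_le
    (Summable.add ?_ (summable_exp_neg_mul_int_sq_mul_abs hb))
  exact summable_of_ne_finset_zero (s := {0}) fun n hn => by simp at hn; simp [hn]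

lemma tsum_exp_neg_mul_int_sq_le {b : ℝ} (hb : 1 ≤ b) :
    ∑' n : ℤ, exp (-(b * n ^ 2)) ≤ 1 + 6 * exp (-b) := by
  have h0 : Summable fun n : ℤ => if n = 0 then (1 : ℝ) else 0 :=
    summable_of_ne_finset_zero (s := {0}) fun n hn => by simp at hn; simp [hn]
  refine (Summable.tsum_le_tsum exp_neg_mul_int_sq_le (summable_exp_neg_mul_int_sq hb)
    (h0.add (summable_exp_neg_mul_int_sq_mul_abs hb))).trans ?_
  rw [Summable.tsum_add h0 (summable_exp_neg_mul_int_sq_mul_abs hb), tsum_ite_eq]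
  linarith [tsum_abs_mul_exp_le hb]

/-- The value at a real point of the theta series of a Gaussian centred at `u`. -/
lemma theta_term_eq {c : ℝ} (u : ℝ) (n : ℤ) :
    ((exp (-(c * (n - u) ^ 2)) : ℝ) : ℂ) = Complex.exp (-(c * u ^ 2)) *
      jacobiTheta₂_term n (-(Complex.I * (c / π * u : ℝ))) (Complex.I * (c / π : ℝ)) := by
  have hpi : (π : ℂ) ≠ 0 := by exact_mod_cast pi_ne_zero
  rw [jacobiTheta₂_term, Complex.ofReal_exp, ← Complex.exp_add]
  congr 1
  push_cast
  field_simp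
  ring_nf
  simp only [Complex.I_sq]
  ring

lemma theta_im_pos {c : ℝ} (hc : 0 < c) : 0 < (Complex.I * ((c / π : ℝ) : ℂ)).im := by
  have : 0 < c / π := div_pos hc pi_pos
  simpa using this

lemma summable_gauss {c : ℝ} (hc : 0 < c) (u : ℝ) :
    Summable fun n : ℤ => exp (-(c * (n - u) ^ 2)) := by
  have h := ((hasSum_jacobiTheta₂_term (-(Complex.I * (c / π * u : ℝ))) (theta_im_pos hc)).mul_left
    (Complex.exp (-(c * u ^ 2)))).summable
  simp only [← theta_term_eq] at h
  exact_mod_cast h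

/-- The ingredients of the inversion τ ↦ -1/τ: the dual arguments, the cancellation of exp(-cu²)
against the Gaussian factor of the functional equation, and its square root. -/
lemma theta_dual {c : ℝ} (hc : 0 < c) (u : ℝ) :
    -(Complex.I * ((c / π * u : ℝ) : ℂ)) / (Complex.I * ((c / π : ℝ) : ℂ)) = -(u : ℂ) ∧
      -1 / (Complex.I * ((c / π : ℝ) : ℂ)) = Complex.I * ((π / c : ℝ) : ℂ) ∧
      Complex.exp (-(c * u ^ 2)) * Complex.exp (-π * Complex.I *
        (-(Complex.I * ((c / π * u : ℝ) : ℂ))) ^ 2 / (Complex.I * ((c / π : ℝ) : ℂ))) = 1 ∧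
      1 / (-Complex.I * (Complex.I * ((c / π : ℝ) : ℂ))) ^ (1 / 2 : ℂ) = ((√(π / c) : ℝ) : ℂ) := by
  have hpi : (π : ℂ) ≠ 0 := by exact_mod_cast pi_ne_zero
  have hc' : (c : ℂ) ≠ 0 := by exact_mod_cast hc.ne'
  have hI := Complex.I_ne_zero
  refine ⟨?_, ?_, ?_, ?_⟩
  · push_cast; field_simp
  · push_cast; field_simp; simp
  · rw [← Complex.exp_add, Complex.exp_eq_one_iff]
    refine ⟨0, ?_⟩
    push_cast; field_simp; ring_nf; simp
  · have h1 : -Complex.I * (Complex.I * ((c / π : ℝ) : ℂ)) = ((c / π : ℝ) : ℂ) := by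
      rw [← mul_assoc, neg_mul, Complex.I_mul_I]; simp
    rw [h1, show (1 / 2 : ℂ) = ((1 / 2 : ℝ) : ℂ) by norm_num,
      ← Complex.ofReal_cpow (div_pos hc pi_pos).le, ← sqrt_eq_rpow, ← Complex.ofReal_one,
      ← Complex.ofReal_div, one_div, ← sqrt_inv, inv_div]

lemma norm_theta_term (n : ℤ) (u t : ℝ) :
    ‖jacobiTheta₂_term n (-(u : ℂ)) (Complex.I * (t : ℂ))‖ = exp (-(π * t * n ^ 2)) := by
  rw [norm_jacobiTheta₂_term]
  congr 1
  simp; ring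

lemma tsum_gauss_eq {c : ℝ} (hc : 0 < c) (u : ℝ) :
    ((∑' n : ℤ, exp (-(c * (n - u) ^ 2)) : ℝ) : ℂ) =
      (√(π / c) : ℝ) * jacobiTheta₂ (-(u : ℂ)) (Complex.I * ((π / c : ℝ) : ℂ)) := by
  obtain ⟨h1, h2, h3, h4⟩ := theta_dual hc u
  have h := jacobiTheta₂_functional_equation (-(Complex.I * (c / π * u : ℝ)))
    (Complex.I * ((c / π : ℝ) : ℂ))
  rw [Complex.ofReal_tsum]
  simp only [theta_term_eq]
  rw [tsum_mul_left, ← jacobiTheta₂, h, h1, h2, h4]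
  linear_combination (((√(π / c) : ℝ) : ℂ) * jacobiTheta₂ (-(u : ℂ)) (Complex.I * ((π / c : ℝ) : ℂ))) * h3

/-- After inversion u enters through phases only, and the dual series has decay rate π²/c ≥ 9. So it
is bounded by 1 + 6 exp(-π²/c) ≤ 3 uniformly in u. -/
lemma tsum_gauss_le {c : ℝ} (hc : 0 < c) (hc1 : c ≤ 1) (u : ℝ) :
    ∑' n : ℤ, exp (-(c * (n - u) ^ 2)) ≤ 3 * √(π / c) := by
  have hb : 9 ≤ π * (π / c) := by
    rw [← mul_div_assoc, le_div_iff₀ hc]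
    nlinarith [pi_gt_three]
  have h : ‖jacobiTheta₂ (-(u : ℂ)) (Complex.I * ((π / c : ℝ) : ℂ))‖ ≤ 3 := by
    rw [jacobiTheta₂]
    have hs : Summable fun n : ℤ =>
        ‖jacobiTheta₂_term n (-(u : ℂ)) (Complex.I * ((π / c : ℝ) : ℂ))‖ := by
      simp only [norm_theta_term]
      exact summable_exp_neg_mul_int_sq (by linarith)
    refine (norm_tsum_le_tsum_norm hs).trans ?_
    simp only [norm_theta_term]
    refine (tsum_exp_neg_mul_int_sq_le (by linarith)).trans ?_
    have : exp (-(π * (π / c))) ≤ 1 / 3 := by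
      rw [exp_neg, ← one_div]
      exact one_div_le_one_div_of_le (by norm_num) (by linarith [add_one_le_exp (π * (π / c))])
    linarith
  have h0 : 0 ≤ ∑' n : ℤ, exp (-(c * (n - u) ^ 2)) := tsum_nonneg fun n => (exp_pos _).le
  rw [← abs_of_nonneg h0, ← norm_eq_abs, ← Complex.norm_real, tsum_gauss_eq hc, norm_mul, Complex.norm_real,
    norm_eq_abs, abs_of_nonneg (sqrt_nonneg _), mul_comm]
  gcongr

lemma summable_first_moment {c : ℝ} (hc : 0 < c) (u : ℝ) :
    Summable fun n : ℤ => (n - u) * exp (-(c * (n - u) ^ 2)) := by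
  refine Summable.of_norm_bounded ((summable_gauss (half_pos hc) u).mul_left (1 / c + 1))
    fun n => ?_
  rw [norm_mul, norm_of_nonneg (exp_pos _).le, norm_eq_abs]
  set y := (n : ℝ) - u
  have h1 : exp (-(c * y ^ 2)) = exp (-(c / 2 * y ^ 2)) * exp (-(c / 2 * y ^ 2)) := by
    rw [← exp_add]; congr 1; ring
  have h2 : |y| * exp (-(c / 2 * y ^ 2)) ≤ 1 / c + 1 := by
    rw [exp_neg, ← div_eq_mul_inv, div_le_iff₀ (exp_pos _)]
    have h3 := add_one_le_exp (c / 2 * y ^ 2)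
    have h4 : |y| ≤ (1 / c + 1) * (c / 2 * y ^ 2 + 1) := by
      have : (1 / c + 1) * (c / 2 * y ^ 2 + 1) = y ^ 2 / 2 + 1 / c + c / 2 * y ^ 2 + 1 := by
        field_simp; ring
      rw [this]
      have h5 : 0 < 1 / c := by positivity
      have h6 : 0 ≤ c / 2 * y ^ 2 := by positivity
      nlinarith [sq_abs y, sq_nonneg (|y| - 1)]
    exact h4.trans (by gcongr)
  calc |y| * exp (-(c * y ^ 2)) = (|y| * exp (-(c / 2 * y ^ 2))) * exp (-(c / 2 * y ^ 2)) := by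
        rw [h1]; ring
    _ ≤ _ := by gcongr

/-- In the functional equation of the derivative, the multiple of the theta function itself cancels
against the centring by u. What remains is the dual derivative series, whose terms carry the factor
n: there is no zero mode, and everything is of order exp(-π²/c). -/
lemma abs_first_moment_le {c : ℝ} (hc : 0 < c) (hc1 : c ≤ 1) (u : ℝ) :
    |∑' n : ℤ, (n - u) * exp (-(c * (n - u) ^ 2))| ≤
      6 * (π / c) ^ 2 * exp (-(π * (π / c))) := by
  obtain ⟨h1, h2, h3, h4⟩ := theta_dual hc u
  have hpi : (π : ℂ) ≠ 0 := by exact_mod_cast pi_ne_zero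
  have hc' : (c : ℂ) ≠ 0 := by exact_mod_cast hc.ne'
  have hI := Complex.I_ne_zero
  set z : ℂ := -(Complex.I * (c / π * u : ℝ)) with hz
  set τ : ℂ := Complex.I * ((c / π : ℝ) : ℂ) with hτ
  have hF := jacobiTheta₂_functional_equation z τ
  have hF' := jacobiTheta₂'_functional_equation z τ
  rw [h1, h2, h4] at hF hF'
  set T := jacobiTheta₂ (-(u : ℂ)) (Complex.I * ((π / c : ℝ) : ℂ))
  set T' := jacobiTheta₂' (-(u : ℂ)) (Complex.I * ((π / c : ℝ) : ℂ)) with hT'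
  have hs : HasSum (fun n : ℤ => (((n - u) * exp (-(c * (n - u) ^ 2)) : ℝ) : ℂ))
      (Complex.exp (-(c * u ^ 2)) * (jacobiTheta₂' z τ / (2 * π * Complex.I) -
        u * jacobiTheta₂ z τ)) := by
    have ha := (hasSum_jacobiTheta₂'_term z (theta_im_pos hc)).div_const (2 * π * Complex.I)
    have hb := (hasSum_jacobiTheta₂_term z (theta_im_pos hc)).mul_left (u : ℂ)
    have hab := (ha.sub hb).mul_left (Complex.exp (-(c * u ^ 2)))
    have hfun : (fun n : ℤ => (((n - u) * exp (-(c * (n - u) ^ 2)) : ℝ) : ℂ)) = fun n : ℤ =>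
        Complex.exp (-(c * u ^ 2)) * (jacobiTheta₂'_term n z τ / (2 * π * Complex.I) -
          u * jacobiTheta₂_term n z τ) := funext fun n => ?_
    · rw [hfun]; exact hab
    have h := theta_term_eq (c := c) u n
    rw [← hz, ← hτ] at h
    rw [Complex.ofReal_mul, h, jacobiTheta₂'_term]
    push_cast
    field_simp
  have hv : Complex.exp (-(c * u ^ 2)) * (jacobiTheta₂' z τ / (2 * π * Complex.I) -
      u * jacobiTheta₂ z τ) = ((√(π / c) : ℝ) : ℂ) * (T' / (2 * π * Complex.I * τ)) := by
    have hτ0 : τ ≠ 0 := by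
      intro h
      have := theta_im_pos hc
      rw [← hτ, h] at this
      simp at this
    have hzτ : z = -u * τ := by rw [← h1]; field_simp
    rw [hF, hF']
    have : ∀ E F : ℂ, E * F = 1 → E * (((√(π / c) : ℝ) : ℂ) * F / τ * (T' - 2 * π * Complex.I * z * T) /
        (2 * π * Complex.I) - u * (((√(π / c) : ℝ) : ℂ) * F * T)) =
        ((√(π / c) : ℝ) : ℂ) * (T' / (2 * π * Complex.I * τ)) := by
      intro E F hEF
      rw [hzτ]
      field_simp
      linear_combination T' * hEF
    exact this _ _ h3
  have ht : 1 ≤ π / c := by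
    rw [le_div_iff₀ hc]; linarith [pi_gt_three]
  have hn : ‖T'‖ ≤ 2 * π * (6 * exp (-(π * (π / c)))) := by
    have hterm : ∀ n : ℤ, ‖jacobiTheta₂'_term n (-(u : ℂ)) (Complex.I * ((π / c : ℝ) : ℂ))‖ =
        2 * π * (|(n : ℝ)| * exp (-(π * (π / c) * n ^ 2))) := by
      intro n
      rw [jacobiTheta₂'_term, norm_mul, norm_theta_term]
      simp [abs_of_pos pi_pos]
      ring
    have hb : 1 ≤ π * (π / c) := by nlinarith [pi_gt_three]
    have hsum : Summable fun n : ℤ =>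
        ‖jacobiTheta₂'_term n (-(u : ℂ)) (Complex.I * ((π / c : ℝ) : ℂ))‖ := by
      simp only [hterm]
      exact (summable_exp_neg_mul_int_sq_mul_abs hb).mul_left _
    rw [hT', jacobiTheta₂']
    refine (norm_tsum_le_tsum_norm hsum).trans ?_
    simp only [hterm]
    rw [tsum_mul_left]
    have := pi_pos
    gcongr
    exact tsum_abs_mul_exp_le hb
  rw [← norm_eq_abs, ← Complex.norm_real, Complex.ofReal_tsum, hs.tsum_eq, hv, norm_mul,
    Complex.norm_real, norm_of_nonneg (sqrt_nonneg _), norm_div]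
  have hd : ‖2 * π * Complex.I * τ‖ = 2 * c := by
    rw [hτ]
    simp only [norm_mul, Complex.norm_I, Complex.norm_real, Complex.norm_ofNat, norm_eq_abs]
    rw [abs_of_pos pi_pos, abs_of_pos (div_pos hc pi_pos)]
    field_simp
  rw [hd]
  have hsq : √(π / c) ≤ π / c := by
    rw [sqrt_le_iff]
    exact ⟨by linarith, by nlinarith⟩
  calc √(π / c) * (‖T'‖ / (2 * c))
      ≤ π / c * (2 * π * (6 * exp (-(π * (π / c)))) / (2 * c)) := by gcongr
    _ = 6 * (π / c) ^ 2 * exp (-(π * (π / c))) := by field_simp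

end GaussianSums

/-! ### The truncated theta series -/

section GridSums

open Real

/-- The grid index as an integer. -/
def gridInt (m : ℕ) (l : Fin (2 ^ (2 * m))) : ℤ := (l : ℤ) - 2 ^ (2 * m - 1)

lemma two_pow_half {m : ℕ} (hm : 0 < m) : (2 : ℤ) ^ (2 * m) = 2 * 2 ^ (2 * m - 1) := by
  rw [← pow_succ']; congr 1; omega

lemma gridIndex_eq {m : ℕ} (hm : 0 < m) (l : Fin (2 ^ (2 * m))) :
    gridIndex m l = (gridInt m l : ℝ) := by
  have h : (2 : ℝ) ^ (2 * m) = 2 * 2 ^ (2 * m - 1) := by exact_mod_cast two_pow_half hm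
  rw [gridIndex, gridInt, h]
  push_cast; ring

lemma sum_gridInt {E : Type*} [AddCommGroup E] [TopologicalSpace E] {m : ℕ} (hm : 0 < m)
    (f : ℤ → E) :
    ∑ l, f (gridInt m l) =
      ∑' k : ℤ, if -2 ^ (2 * m - 1) ≤ k ∧ k < 2 ^ (2 * m - 1) then f k else 0 := by
  rw [tsum_eq_sum (s := Finset.Ico (-2 ^ (2 * m - 1)) (2 ^ (2 * m - 1)))]
  · have h2 := two_pow_half hm
    refine Finset.sum_bij (fun l _ => gridInt m l) (fun l _ => ?_) (fun a _ b _ h => ?_)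
      (fun k hk => ?_) (fun l _ => ?_)
    · have hl : ((l : ℕ) : ℤ) < 2 ^ (2 * m) := by exact_mod_cast l.2
      simp only [gridInt, Finset.mem_Ico]; omega
    · simp only [gridInt] at h
      exact Fin.ext (by omega)
    · rw [Finset.mem_Ico] at hk
      refine ⟨⟨(k + 2 ^ (2 * m - 1)).toNat, ?_⟩, Finset.mem_univ _, ?_⟩
      · zify; rw [Int.toNat_of_nonneg (by omega)]; omega
      · simp only [gridInt]; rw [Int.toNat_of_nonneg (by omega)]; omega
    · have hl : ((l : ℕ) : ℤ) < 2 ^ (2 * m) := by exact_mod_cast l.2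
      rw [if_pos]
      simp only [gridInt]; omega
  · intro k hk
    rw [Finset.mem_Ico] at hk
    rw [if_neg hk]

lemma gridInt_eq_iff {m : ℕ} (l : Fin (2 ^ (2 * m))) :
    gridInt m l = -2 ^ (2 * m - 1) ↔ (l : ℕ) = 0 := by
  simp only [gridInt]; omega

/-- Omitting ℓ = 0 makes the range of the index symmetric. -/
lemma sum_gridInt_symm {E : Type*} [AddCommGroup E] [TopologicalSpace E] {m : ℕ} (hm : 0 < m)
    (f : ℤ → E) :
    ∑ l : Fin (2 ^ (2 * m)), (if (l : ℕ) = 0 then 0 else f (gridInt m l)) =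
      ∑' k : ℤ, if |k| < 2 ^ (2 * m - 1) then f k else 0 := by
  have h := sum_gridInt hm fun k => if k = -2 ^ (2 * m - 1) then 0 else f k
  simp only [gridInt_eq_iff] at h
  rw [h]
  refine tsum_congr fun k => ?_
  simp only [abs_lt]
  split_ifs <;> first | rfl | omega

lemma sum_gridInt_le {m : ℕ} (hm : 0 < m) {f : ℤ → ℝ} (hf : Summable f) (h0 : ∀ k, 0 ≤ f k) :
    ∑ l, f (gridInt m l) ≤ ∑' k, f k := by
  rw [sum_gridInt hm]
  have hle : ∀ k : ℤ, (if -2 ^ (2 * m - 1) ≤ k ∧ k < 2 ^ (2 * m - 1) then f k else 0) ≤ f k := by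
    intro k; split_ifs; exacts [le_rfl, h0 k]
  refine Summable.tsum_le_tsum hle (Summable.of_nonneg_of_le (fun k => ?_) hle hf) hf
  split_ifs; exacts [h0 k, le_rfl]

/-- The truncated theta series. -/
def truncTheta (α : ℝ) (m : ℕ) (u : ℝ) : ℂ :=
  ∑ l : Fin (2 ^ (2 * m)), if (l : ℕ) = 0 then 0 else
    Complex.exp (-(α * gridInt m l ^ 2) + 2 * π * Complex.I * u * gridInt m l)

lemma summable_gauss_zero {α : ℝ} (hα : 0 < α) :
    Summable fun k : ℤ => exp (-(α * (k : ℝ) ^ 2)) := by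
  have := summable_gauss hα 0
  simpa using this

lemma norm_theta_summand (α u : ℝ) (k : ℤ) :
    ‖Complex.exp (-(α * k ^ 2) + 2 * π * Complex.I * u * k)‖ = exp (-(α * (k : ℝ) ^ 2)) := by
  rw [Complex.norm_exp]
  congr 1
  simp [← Complex.ofReal_intCast, ← Complex.ofReal_pow, Complex.mul_re]

lemma norm_truncTheta_sub_le {α : ℝ} (hα : 0 < α) (hα1 : α ≤ 1) {m : ℕ} (hm : 0 < m) (u : ℝ) :
    ‖truncTheta α m u -
        ∑' k : ℤ, Complex.exp (-(α * k ^ 2) + 2 * π * Complex.I * u * k)‖ ≤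
      √(π / α) * (5 * exp (-(α * (2 ^ (2 * m - 1)) ^ 2 / 2))) := by
  set H : ℤ := 2 ^ (2 * m - 1) with hH
  set f : ℤ → ℂ := fun k => Complex.exp (-(α * k ^ 2) + 2 * π * Complex.I * u * k) with hf
  have hnf : ∀ k, ‖f k‖ = exp (-(α * (k : ℝ) ^ 2)) := norm_theta_summand α u
  have hs : Summable f := Summable.of_norm (by simp only [hnf]; exact summable_gauss_zero hα)
  have hs' : Summable fun k : ℤ => if |k| < H then f k else 0 := by
    refine Summable.of_norm_bounded (summable_gauss_zero hα) fun k => ?_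
    split_ifs
    · exact (hnf k).le
    · rw [norm_zero]; exact (exp_pos _).le
  have h1 : truncTheta α m u = ∑' k : ℤ, if |k| < H then f k else 0 := sum_gridInt_symm hm f
  rw [h1, ← Summable.tsum_sub hs' hs]
  -- Half of the exponent supplies the small factor on |k| ≥ N/2, the other half is summed. The
  -- constant 5 bounds 3√2.
  have hb : ∀ k : ℤ, ‖(if |k| < H then f k else 0) - f k‖ ≤
      exp (-(α * (2 ^ (2 * m - 1)) ^ 2 / 2)) * exp (-(α / 2 * ((k : ℝ) - 0) ^ 2)) := by
    intro k
    split_ifs with hk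
    · rw [sub_self, norm_zero]; positivity
    · rw [zero_sub, norm_neg, hnf, ← exp_add, exp_le_exp]
      have h2 : (2 : ℝ) ^ (2 * m - 1) ≤ |(k : ℝ)| := by
        rw [not_lt, hH] at hk
        exact_mod_cast hk
      have h3 : ((2 : ℝ) ^ (2 * m - 1)) ^ 2 ≤ (k : ℝ) ^ 2 := by
        rw [← sq_abs (k : ℝ)]; gcongr
      nlinarith
  have hsb := (summable_gauss (half_pos hα) 0).mul_left (exp (-(α * (2 ^ (2 * m - 1)) ^ 2 / 2)))
  refine (tsum_of_norm_bounded hsb.hasSum hb).trans ?_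
  rw [tsum_mul_left]
  have h4 := tsum_gauss_le (half_pos hα) (by linarith) 0
  have h5 : √(π / (α / 2)) = √2 * √(π / α) := by
    rw [← sqrt_mul (by norm_num)]; congr 1; field_simp
  have h6 : √2 ≤ 5 / 3 := by
    rw [sqrt_le_left (by norm_num)]; norm_num
  rw [h5] at h4
  have h7 := sqrt_nonneg (π / α)
  have h8 : ∑' n : ℤ, exp (-(α / 2 * ((n : ℝ) - 0) ^ 2)) ≤ 5 * √(π / α) := by nlinarith
  have h9 := exp_pos (-(α * (2 ^ (2 * m - 1)) ^ 2 / 2))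
  nlinarith

/-- By Poisson summation the series is a sum of Gaussians centred at the integers. For |u| ≤ 3/4 and
n ≠ 0 one has |n - u| ≥ |n|/4, so only the Gaussian at 0 matters. -/
lemma tsum_theta_sub_le {α : ℝ} (hα : 0 < α) (hα1 : α ≤ 1 / 4) {u : ℝ} (hu : |u| ≤ 3 / 4) :
    ‖∑' k : ℤ, Complex.exp (-(α * k ^ 2) + 2 * π * Complex.I * u * k) -
        (√(π / α) * exp (-(π ^ 2 / α * u ^ 2)) : ℝ)‖ ≤
      √(π / α) * (6 * exp (-(π ^ 2 / (16 * α)))) := by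
  have hpi : (π : ℂ) ≠ 0 := by exact_mod_cast pi_ne_zero
  have hα' : (α : ℂ) ≠ 0 := by exact_mod_cast hα.ne'
  have hP := Complex.tsum_exp_neg_quadratic (a := ((α / π : ℝ) : ℂ))
    (by rw [Complex.ofReal_re]; exact div_pos hα pi_pos) (Complex.I * u)
  have hp2 : 0 < π ^ 2 / α := by positivity
  have h1 : ∀ k : ℤ, Complex.exp (-π * ((α / π : ℝ) : ℂ) * k ^ 2 + 2 * π * (Complex.I * u) * k) =
      Complex.exp (-(α * k ^ 2) + 2 * π * Complex.I * u * k) := by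
    intro k; congr 1; push_cast; field_simp
  have h2 : ∀ k : ℤ, Complex.exp (-π / ((α / π : ℝ) : ℂ) * (k + Complex.I * (Complex.I * u)) ^ 2) =
      ((exp (-(π ^ 2 / α * ((k : ℝ) - u) ^ 2)) : ℝ) : ℂ) := by
    intro k
    rw [← mul_assoc Complex.I, Complex.I_mul_I]
    push_cast; congr 1; field_simp; ring
  have h3 : 1 / ((α / π : ℝ) : ℂ) ^ (1 / 2 : ℂ) = ((√(π / α) : ℝ) : ℂ) := by
    rw [show (1 / 2 : ℂ) = ((1 / 2 : ℝ) : ℂ) by norm_num,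
      ← Complex.ofReal_cpow (div_pos hα pi_pos).le, ← sqrt_eq_rpow, ← Complex.ofReal_one,
      ← Complex.ofReal_div, one_div, ← sqrt_inv, inv_div]
  simp only [h1, h2, h3] at hP
  rw [hP, ← Complex.ofReal_tsum, ← Complex.ofReal_mul, ← Complex.ofReal_sub, Complex.norm_real,
    ← mul_sub, norm_mul, norm_of_nonneg (sqrt_nonneg _)]
  refine mul_le_mul_of_nonneg_left ?_ (sqrt_nonneg _)
  rw [(summable_gauss hp2 u).tsum_eq_add_tsum_ite 0]
  have h4 : exp (-(π ^ 2 / α * (((0 : ℤ) : ℝ) - u) ^ 2)) = exp (-(π ^ 2 / α * u ^ 2)) := by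
    congr 2; push_cast; ring
  have hb : 1 ≤ π ^ 2 / (16 * α) := by
    rw [le_div_iff₀ (by positivity)]; nlinarith [pi_gt_three]
  rw [h4, add_sub_cancel_left]
  refine (tsum_of_norm_bounded (summable_exp_neg_mul_int_sq_mul_abs hb).hasSum fun n => ?_).trans
    (tsum_abs_mul_exp_le hb)
  split_ifs with hn
  · rw [norm_zero]; positivity
  · have hn1 : (1 : ℝ) ≤ |(n : ℝ)| := by
      rw [← Int.cast_abs]; exact_mod_cast Int.one_le_abs hn
    rw [norm_of_nonneg (exp_pos _).le]
    have h5 : |(n : ℝ)| / 4 ≤ |(n : ℝ) - u| := by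
      have := abs_sub_abs_le_abs_sub (n : ℝ) u
      linarith
    have h6 : (n : ℝ) ^ 2 / 16 ≤ ((n : ℝ) - u) ^ 2 := by
      rw [← sq_abs ((n : ℝ) - u), ← sq_abs (n : ℝ)]
      have := pow_le_pow_left₀ (by positivity) h5 2
      linarith
    calc exp (-(π ^ 2 / α * ((n : ℝ) - u) ^ 2))
        ≤ exp (-(π ^ 2 / (16 * α) * n ^ 2)) := by
          rw [exp_le_exp, neg_le_neg_iff]
          calc π ^ 2 / (16 * α) * n ^ 2 = π ^ 2 / α * (n ^ 2 / 16) := by field_simp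
            _ ≤ _ := by gcongr
      _ ≤ |(n : ℝ)| * exp (-(π ^ 2 / (16 * α) * n ^ 2)) := by
          nlinarith [exp_pos (-(π ^ 2 / (16 * α) * (n : ℝ) ^ 2))]

/-- Pointwise approximation of the truncated theta series by a Gaussian. -/
lemma norm_truncTheta_sub_gauss_le {α : ℝ} (hα : 0 < α) (hα1 : α ≤ 1 / 4) {m : ℕ} (hm : 0 < m)
    {u : ℝ} (hu : |u| ≤ 3 / 4) :
    ‖truncTheta α m u - (√(π / α) * exp (-(π ^ 2 / α * u ^ 2)) : ℝ)‖ ≤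
      √(π / α) * (5 * exp (-(α * (2 ^ (2 * m - 1)) ^ 2 / 2)) + 6 * exp (-(π ^ 2 / (16 * α)))) := by
  have h := norm_sub_le_norm_sub_add_norm_sub (truncTheta α m u)
    (∑' k : ℤ, Complex.exp (-(α * k ^ 2) + 2 * π * Complex.I * u * k))
    ((√(π / α) * exp (-(π ^ 2 / α * u ^ 2)) : ℝ) : ℂ)
  have h1 := norm_truncTheta_sub_le hα (by linarith) hm u
  have h2 := tsum_theta_sub_le hα hα1 hu
  linarith

end GridSums

/-! ### The two scales and the success probability of the filters -/

section Parameters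

open Real

/-- The Gaussian width `γ` that belongs to the scale `s`. -/
def widthOf (s : ℕ) : ℝ := (2 ^ s)⁻¹ / (2 * π)

lemma widthOf_pos (s : ℕ) : 0 < widthOf s := by rw [widthOf]; positivity

/-- The resource state thus has width about 2^(2s+r) in the grid index, which falls short of the
cutoff N/2 = 2^(2s+2r-1) by the factor 2^(r-1). -/
lemma exponent_eq (s r : ℕ) :
    4 * π ^ 2 * widthOf s ^ 2 * step (s + r) ^ 2 = ((4 : ℝ) ^ (2 * s + r))⁻¹ := by
  have h : (4 : ℝ) = 2 ^ 2 := by norm_num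
  have hpi := pi_ne_zero
  rw [widthOf, step, h, ← pow_mul]
  field_simp
  ring

/-- Telescoping as for the product of 1 + z^(2^j); the sparser exponents only help, as z^(4^(n+1)) ≤
(z^(4^n))². -/
lemma prod_one_add_pow_le {z : ℝ} (hz : 0 ≤ z) (hz1 : z ≤ 1) (n : ℕ) :
    (1 - z) * ∏ j ∈ Finset.range n, (1 + z ^ 4 ^ j) ≤ 1 - z ^ 4 ^ n := by
  induction n with
  | zero => simp
  | succ n ih =>
    rw [Finset.prod_range_succ, ← mul_assoc]
    have h0 : 0 ≤ z ^ 4 ^ n := by positivity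
    have h1 : z ^ 4 ^ (n + 1) ≤ z ^ 4 ^ n * z ^ 4 ^ n := by
      rw [← pow_add]
      exact pow_le_pow_of_le_one hz hz1 (by rw [pow_succ]; have := Nat.one_le_pow n 4 (by norm_num); omega)
    nlinarith

lemma gaussSum_eq {m : ℕ} (hm : 0 < m) (α : ℝ) :
    gaussSum α m = ∑' k : ℤ, if |k| < 2 ^ (2 * m - 1) then exp (-(2 * α * k ^ 2)) else 0 := by
  rw [← sum_gridInt_symm hm (fun k : ℤ => exp (-(2 * α * (k : ℝ) ^ 2))), gaussSum]
  simp only [gridIndex_eq hm]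

lemma exp_neg_half_ge : (0.6 : ℝ) ≤ exp (-(1 / 2)) := by
  have h1 : exp (1 / 2) ≤ 1.66 := by
    have h : exp (1 / 2) ^ 2 = exp 1 := by rw [← exp_nat_mul]; norm_num
    have := exp_one_lt_d9
    nlinarith [exp_pos (1 / 2)]
  rw [exp_neg, ← one_div, le_div_iff₀ (exp_pos _)]
  linarith

/-- On the 2^(2s+r) indices of [-A, A) the exponent 2αk² is at most 2αA² = 1/2. -/
lemma le_gaussSum {s r : ℕ} (hr : 0 < r) :
    0.6 * 2 ^ (2 * s + r) ≤ gaussSum ((4 : ℝ) ^ (2 * s + r))⁻¹ (s + r) := by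
  set α := ((4 : ℝ) ^ (2 * s + r))⁻¹ with hα
  have hα0 : 0 < α := by positivity
  rw [gaussSum_eq (by omega)]
  set A : ℤ := 2 ^ (2 * s + r - 1) with hA
  have hA2 : (2 : ℤ) ^ (2 * s + r) = 2 * A := by
    rw [hA, ← pow_succ']; congr 1; omega
  have hA2' : (2 : ℝ) ^ (2 * s + r) = 2 * (A : ℝ) := by exact_mod_cast hA2
  have hAlt : A < 2 ^ (2 * (s + r) - 1) := by
    rw [hA]; exact pow_lt_pow_right₀ (by norm_num) (by omega)
  have hA0 : 0 < A := by positivity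
  have hs : Summable fun k : ℤ =>
      if |k| < 2 ^ (2 * (s + r) - 1) then exp (-(2 * α * (k : ℝ) ^ 2)) else 0 := by
    refine Summable.of_norm_bounded (summable_gauss_zero (α := 2 * α) (by positivity)) fun k => ?_
    split_ifs
    · rw [norm_of_nonneg (exp_pos _).le]
    · rw [norm_zero]; positivity
  refine le_trans ?_ (hs.sum_le_tsum (Finset.Ico (-A) A) fun k _ => by split_ifs <;> positivity)
  have hle : ∀ k ∈ Finset.Ico (-A) A, (0.6 : ℝ) ≤
      if |k| < 2 ^ (2 * (s + r) - 1) then exp (-(2 * α * (k : ℝ) ^ 2)) else 0 := by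
    intro k hk
    rw [Finset.mem_Ico] at hk
    have hk' : |k| ≤ A := abs_le.2 ⟨by omega, by omega⟩
    rw [if_pos (by omega)]
    refine exp_neg_half_ge.trans (exp_le_exp.2 (neg_le_neg ?_))
    have h1 : (k : ℝ) ^ 2 ≤ (A : ℝ) ^ 2 := by
      rw [← sq_abs (k : ℝ), ← Int.cast_abs]
      gcongr
    have h2 : 2 * α * (A : ℝ) ^ 2 = 1 / 2 := by
      have h3 : (4 : ℝ) ^ (2 * s + r) = 4 * (A : ℝ) ^ 2 := by
        rw [show (4 : ℝ) = 2 ^ 2 by norm_num, ← pow_mul, mul_comm 2 (2 * s + r), pow_mul, hA2']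
        ring
      have : (A : ℝ) ≠ 0 := by exact_mod_cast hA0.ne'
      rw [hα, h3]; field_simp
      norm_num
    calc 2 * α * (k : ℝ) ^ 2 ≤ 2 * α * (A : ℝ) ^ 2 := by gcongr
      _ = 1 / 2 := h2
  have h := Finset.card_nsmul_le_sum _ _ _ hle
  rw [Int.card_Ico, nsmul_eq_mul] at h
  have hc : (((A - -A).toNat : ℕ) : ℝ) = 2 * A := by
    have : (((A - -A).toNat : ℕ) : ℤ) = 2 * A := by rw [Int.toNat_of_nonneg (by omega)]; ring
    exact_mod_cast this
  rw [hc] at h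
  rw [hA2']; linarith

/-- The acceptance probability of the product-state preparation. -/
lemma prod_signedWeight_le {s r : ℕ} (hr : 0 < r) :
    ∏ i, (1 + exp (-(2 * ((4 : ℝ) ^ (2 * s + r))⁻¹ * signedWeight (s + r) i ^ 2))) ≤
      4 * gaussSum ((4 : ℝ) ^ (2 * s + r))⁻¹ (s + r) := by
  set K := 2 * s + r with hK
  set α := ((4 : ℝ) ^ K)⁻¹ with hα
  have hα0 : 0 < α := by positivity
  obtain ⟨M, hM⟩ : ∃ M, 2 * (s + r) = M + 1 := ⟨2 * (s + r) - 1, by omega⟩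
  set F : ℕ → ℝ := fun i => 1 + exp (-(2 * α * ((2 : ℝ) ^ i) ^ 2)) with hF
  have hF2 : ∀ i, F i ≤ 2 := by
    intro i
    have : exp (-(2 * α * ((2 : ℝ) ^ i) ^ 2)) ≤ 1 := exp_le_one_iff.2 (by
      rw [neg_nonpos]; positivity)
    simp only [hF]; linarith
  have hF0 : ∀ i, 0 ≤ F i := fun i => by simp only [hF]; positivity
  have h1 : ∏ i, (1 + exp (-(2 * α * signedWeight (s + r) i ^ 2))) =
      (1 + exp (-(2 * α))) * ∏ i ∈ Finset.range M, F i := by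
    have h2 : ∏ i, (1 + exp (-(2 * α * signedWeight (s + r) i ^ 2))) =
        ∏ i ∈ Finset.range (2 * (s + r)), (if i = 0 then 1 + exp (-(2 * α)) else
          F (2 * (s + r) - 1 - i)) := by
      rw [← Fin.prod_univ_eq_prod_range (fun i => if i = 0 then 1 + exp (-(2 * α)) else
          F (2 * (s + r) - 1 - i))]
      refine Finset.prod_congr rfl fun i _ => ?_
      simp only [signedWeight]
      split_ifs
      · simp
      · rfl
    rw [h2, hM, Finset.prod_range_succ', mul_comm]
    simp only [if_true, Nat.succ_ne_zero, if_false]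
    congr 1
    rw [← Finset.prod_range_reflect]
    refine Finset.prod_congr rfl fun i hi => ?_
    rw [Finset.mem_range] at hi
    congr 1; omega
  -- The K bits below the width contribute at most 2 each. For the bits above it the exponents are
  -- 2·4^j, and their product is at most 1/(1 - exp(-2)) ≤ 7/6. With a further 2 for the sign qubit
  -- the total is 2.4·2^K, which is exactly 4 times the lower bound 0.6·2^K of the Gaussian sum.
  have h3 : ∏ i ∈ Finset.range M, F i ≤ 2 ^ K * 1.2 := by
    rw [show M = K + (M - K) by omega, Finset.prod_range_add]
    have h4 : ∏ i ∈ Finset.range K, F i ≤ 2 ^ K := by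
      refine (Finset.prod_le_prod (fun i _ => hF0 i) fun i _ => hF2 i).trans ?_
      simp
    have h5 : ∏ j ∈ Finset.range (M - K), F (K + j) ≤ 1.2 := by
      have h6 : ∀ j, F (K + j) = 1 + exp (-2) ^ 4 ^ j := by
        intro j
        simp only [hF]
        rw [← exp_nat_mul, hα]
        congr 2
        have h7 : ((2 : ℝ) ^ (K + j)) ^ 2 = 4 ^ K * 4 ^ j := by
          rw [← pow_add, show (4 : ℝ) = 2 ^ 2 by norm_num, ← pow_mul, ← pow_mul, mul_comm]
        rw [h7]
        push_cast
        field_simp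
      simp only [h6]
      have hz : exp (-2) ≤ 1 / 7 := by
        have h7 : exp 2 = exp 1 * exp 1 := by rw [← exp_add]; norm_num
        rw [exp_neg, ← one_div]
        refine one_div_le_one_div_of_le (by norm_num) ?_
        rw [h7]; nlinarith [exp_one_gt_d9]
      have h8 := prod_one_add_pow_le (exp_pos (-2)).le (by linarith) (M - K)
      have h9 : 0 ≤ exp (-2) ^ 4 ^ (M - K) := by positivity
      have h10 : 0 ≤ ∏ j ∈ Finset.range (M - K), (1 + exp (-2) ^ 4 ^ j) :=
        Finset.prod_nonneg fun j _ => by positivity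
      nlinarith
    exact mul_le_mul h4 h5 (Finset.prod_nonneg fun j _ => hF0 _) (by positivity)
  have h11 : exp (-(2 * α)) ≤ 1 := exp_le_one_iff.2 (by linarith)
  have h12 : 0 ≤ ∏ i ∈ Finset.range M, F i := Finset.prod_nonneg fun i _ => hF0 i
  have h13 := le_gaussSum (s := s) hr
  rw [← hK, ← hα] at h13
  rw [h1]
  nlinarith [exp_pos (-(2 * α))]

end Parameters

/-! ### The readout distribution is nearly Gaussian -/

section Readout

open Real

/-- The amplitude of the readout `j` on an eigenvector with eigenvalue `κ x`. -/
def readoutAmp (γ : ℝ) (m : ℕ) (j : Fin (2 ^ (2 * m))) (x : ℝ) : ℂ :=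
  ∑ l, shiftedQFT m j l * resource γ m l *
    Complex.exp (-(Complex.I * ((2 * π * gridPoint m l * x : ℝ) : ℂ)))

/-- The probability of the readout `j` on an eigenvector with eigenvalue `κ x`. -/
def readoutProb (γ : ℝ) (m : ℕ) (j : Fin (2 ^ (2 * m))) (x : ℝ) : ℝ := ‖readoutAmp γ m j x‖ ^ 2

lemma gridPoint_eq {m : ℕ} (hm : 0 < m) (j : Fin (2 ^ (2 * m))) :
    gridPoint m j = gridInt m j * step m := by
  rw [← gridIndex_eq hm]; rfl

lemma step_sq (m : ℕ) : step m ^ 2 = (2 ^ (2 * m))⁻¹ := by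
  rw [step, inv_pow, ← pow_mul, mul_comm]

/-- Since N h² = 1, the phases of the transform and of the evolution combine into the single
frequency h(ω_j - x). -/
lemma readoutAmp_eq {γ α : ℝ} (hγ : 0 < γ) {m : ℕ} (hm : 0 < m)
    (hα : 4 * π ^ 2 * γ ^ 2 * step m ^ 2 = α) (j : Fin (2 ^ (2 * m))) (x : ℝ) :
    readoutAmp γ m j x = ((step m / √(gaussSum α m) : ℝ) : ℂ) *
      truncTheta α m (step m * (gridPoint m j - x)) := by
  rw [readoutAmp, truncTheta, Finset.mul_sum]
  refine Finset.sum_congr rfl fun l _ => ?_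
  rw [resource_eq hγ, hα]
  split_ifs with hl
  · simp
  · have h1 : ((√((2 : ℝ) ^ (2 * m)))⁻¹ : ℝ) = step m := by
      rw [step, mul_comm, pow_mul, sqrt_sq (by positivity)]
    have h2 : ((l : ℂ) - 2 ^ (2 * m) / 2) = ((gridInt m l : ℝ) : ℂ) := by
      rw [← gridIndex_eq hm, gridIndex]; push_cast; ring
    have h3 : ((j : ℂ) - 2 ^ (2 * m) / 2) / 2 ^ (2 * m) = ((step m * gridPoint m j : ℝ) : ℂ) := by
      have h := step_sq m
      have : step m * gridPoint m j = gridIndex m j * step m ^ 2 := by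
        simp only [gridPoint, gridIndex]; ring
      rw [this, h, gridIndex]; push_cast; ring
    rw [shiftedQFT, h1, mul_div_assoc, h2, h3, gridPoint_eq hm l]
    rw [show ((exp (-(α * gridIndex m l ^ 2)) / √(gaussSum α m) : ℝ) : ℂ) =
      Complex.exp (-(α * gridInt m l ^ 2)) * ((1 / √(gaussSum α m) : ℝ) : ℂ) by
        rw [gridIndex_eq hm]; push_cast; ring]
    have h4 : ∀ a b E1 E2 E3 : ℂ, a * E1 * (E2 * b) * E3 = a * b * (E2 * E1 * E3) := by
      intros; ring
    rw [h4, ← Complex.exp_add, ← Complex.exp_add, ← Complex.ofReal_mul, mul_one_div]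
    congr 2
    push_cast
    ring

/-- The distance from the readout value with index `k` to `x`. -/
def offset (m : ℕ) (x : ℝ) (k : ℤ) : ℝ := k * step m - x

/-- The prefactor of the Gaussian approximation of the readout distribution. -/
def readoutScale (s r : ℕ) : ℝ :=
  step (s + r) ^ 2 / gaussSum ((4 : ℝ) ^ (2 * s + r))⁻¹ (s + r) * (π * 4 ^ (2 * s + r))

lemma gaussSum_pos {s r : ℕ} (hr : 0 < r) : 0 < gaussSum ((4 : ℝ) ^ (2 * s + r))⁻¹ (s + r) :=
  lt_of_lt_of_le (by positivity) (le_gaussSum hr)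

lemma readoutScale_nonneg {s r : ℕ} (hr : 0 < r) : 0 ≤ readoutScale s r := by
  have := gaussSum_pos (s := s) hr
  rw [readoutScale]; positivity

/-- The factor 2^r is compensated here because it is the order of the grid sums of the readout
Gaussian, see `tsum_offset_le_two_pow`. -/
lemma readoutScale_mul_le {s r : ℕ} (hr : 0 < r) : readoutScale s r * 2 ^ r ≤ 7 := by
  have hZ := le_gaussSum (s := s) hr
  have hZ0 := gaussSum_pos (s := s) hr
  rw [readoutScale, step_sq, div_mul_eq_mul_div, div_mul_eq_mul_div, div_le_iff₀ hZ0]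
  have h1 : (4 : ℝ) ^ (2 * s + r) * 2 ^ r = 2 ^ (2 * (s + r)) * 2 ^ (2 * s + r) := by
    rw [show (4 : ℝ) = 2 ^ 2 by norm_num, ← pow_mul, ← pow_add, ← pow_add]
    congr 1; ring
  have h2 : ((2 : ℝ) ^ (2 * (s + r)))⁻¹ * (π * 4 ^ (2 * s + r)) * 2 ^ r = π * 2 ^ (2 * s + r) := by
    rw [mul_assoc, mul_assoc, h1]; field_simp
  rw [h2]
  have h3 : (0 : ℝ) < 2 ^ (2 * s + r) := by positivity
  nlinarith [pi_lt_d2]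

/-- The error of the Gaussian approximation. -/
def approxError (r : ℕ) : ℝ := 11 * exp (-(4 ^ r / 8))

lemma approxError_le_one {r : ℕ} (hr : 3 ≤ r) : approxError r ≤ 1 := by
  have h1 : (4 : ℝ) ^ 3 ≤ 4 ^ r := pow_le_pow_right₀ (by norm_num) hr
  have h2 : (11 : ℝ) ≤ exp (4 ^ r / 8) := by
    have h3 : (2 : ℝ) ^ 8 ≤ exp 8 := by
      have : exp 8 = exp 1 ^ 8 := by rw [← exp_nat_mul]; norm_num
      rw [this]
      exact pow_le_pow_left₀ (by norm_num) (by linarith [add_one_le_exp (1 : ℝ)]) 8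
    have h4 : exp 8 ≤ exp (4 ^ r / 8) := exp_le_exp.2 (by linarith)
    linarith
  rw [approxError, exp_neg, ← div_eq_mul_inv, div_le_one (exp_pos _)]
  exact h2

lemma approxError_pos (r : ℕ) : 0 < approxError r := by rw [approxError]; positivity

lemma gridInt_bounds {m : ℕ} (hm : 0 < m) (j : Fin (2 ^ (2 * m))) :
    -2 ^ (2 * m - 1) ≤ gridInt m j ∧ gridInt m j < 2 ^ (2 * m - 1) := by
  have hl : ((j : ℕ) : ℤ) < 2 ^ (2 * m) := by exact_mod_cast j.2
  have h2 := two_pow_half hm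
  simp only [gridInt]; omega

lemma step_le_quarter {m : ℕ} (hm : 2 ≤ m) : step m ≤ 1 / 4 := by
  rw [step, ← one_div]
  refine one_div_le_one_div_of_le (by norm_num) ?_
  calc (4 : ℝ) = 2 ^ 2 := by norm_num
    _ ≤ 2 ^ m := pow_le_pow_right₀ (by norm_num) hm

/-- The amplitude is, up to normalization, within Bδ of a Gaussian BG ≤ B; squaring multiplies the
error by at most 3B, as δ ≤ 1. -/
lemma abs_readoutProb_sub_le {s r : ℕ} (hs : 1 ≤ s) (hr : 3 ≤ r) (j : Fin (2 ^ (2 * (s + r))))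
    {x : ℝ} (hx : |x| ≤ 1) :
    |readoutProb (widthOf s) (s + r) j x -
        readoutScale s r * exp (-(2 * (π ^ 2 * 4 ^ s) * offset (s + r) x (gridInt (s + r) j) ^ 2))| ≤
      readoutScale s r * (3 * approxError r) := by
  have hr0 : 0 < r := by omega
  have hm : 0 < s + r := by omega
  have hZ0 := gaussSum_pos (s := s) hr0
  have hK4 : (1 : ℝ) ≤ 4 ^ (2 * s) / 16 := by
    rw [le_div_iff₀ (by norm_num)]
    calc (1 : ℝ) * 16 = 4 ^ 2 := by norm_num
      _ ≤ 4 ^ (2 * s) := pow_le_pow_right₀ (by norm_num) (by omega)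
  rw [readoutProb, readoutAmp_eq (widthOf_pos s) hm (exponent_eq s r), readoutScale]
  set Z := gaussSum ((4 : ℝ) ^ (2 * s + r))⁻¹ (s + r)
  set α := ((4 : ℝ) ^ (2 * s + r))⁻¹ with hα
  have hα0 : 0 < α := by positivity
  have hα1 : α ≤ 1 / 4 := by
    rw [hα, ← one_div]
    refine one_div_le_one_div_of_le (by norm_num) ?_
    calc (4 : ℝ) = 4 ^ 1 := by norm_num
      _ ≤ 4 ^ (2 * s + r) := pow_le_pow_right₀ (by norm_num) (by omega)
  have hpa : π / α = π * 4 ^ (2 * s + r) := by rw [hα, div_inv_eq_mul]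
  have hst := step_pos (s + r)
  have hst4 := step_le_quarter (m := s + r) (by omega)
  set y := offset (s + r) x (gridInt (s + r) j) with hy
  have hgy : gridPoint (s + r) j - x = y := by rw [gridPoint_eq hm, hy, offset]
  rw [hgy]
  -- The readout contributes at most (N/2) h² = 1/2 and the eigenvalue at most h ≤ 1/4. This keeps
  -- the frequency away from the periodic images of the Gaussian.
  have hu : |step (s + r) * y| ≤ 3 / 4 := by
    have h1 : step (s + r) * y = gridInt (s + r) j * step (s + r) ^ 2 - step (s + r) * x := by
      rw [hy, offset]; ring
    have h2 : |(gridInt (s + r) j : ℝ) * step (s + r) ^ 2| ≤ 1 / 2 := by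
      rw [abs_mul, abs_of_pos (pow_pos hst 2), step_sq]
      have hb := gridInt_bounds hm j
      have h3 : |(gridInt (s + r) j : ℝ)| ≤ 2 ^ (2 * (s + r) - 1) := by
        rw [← Int.cast_abs]
        have : |gridInt (s + r) j| ≤ 2 ^ (2 * (s + r) - 1) := abs_le.2 ⟨hb.1, hb.2.le⟩
        exact_mod_cast this
      have h4 : (2 : ℝ) ^ (2 * (s + r)) = 2 * 2 ^ (2 * (s + r) - 1) := by
        exact_mod_cast two_pow_half hm
      rw [← div_eq_mul_inv, div_le_iff₀ (by positivity), h4]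
      linarith
    have h5 : |step (s + r) * x| ≤ 1 / 4 := by
      rw [abs_mul, abs_of_pos hst]
      nlinarith [abs_nonneg x]
    rw [h1]
    exact (abs_sub _ _).trans (by linarith)
  have happ := norm_truncTheta_sub_gauss_le hα0 hα1 hm hu
  have hgauss : π ^ 2 / α * (step (s + r) * y) ^ 2 = π ^ 2 * 4 ^ s * y ^ 2 := by
    rw [mul_pow, step_sq, hα, pow_mul, div_inv_eq_mul]
    have : ((2 : ℝ) ^ 2) ^ (s + r) = 4 ^ (s + r) := by norm_num
    rw [this, show 2 * s + r = s + (s + r) by ring, pow_add 4 s (s + r)]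
    field_simp
  have hR1 : α * ((2 : ℝ) ^ (2 * (s + r) - 1)) ^ 2 / 2 = 4 ^ r / 8 := by
    have h4 : (2 : ℝ) ^ (2 * (s + r)) = 2 * 2 ^ (2 * (s + r) - 1) := by
      exact_mod_cast two_pow_half hm
    have h5 : ((2 : ℝ) ^ (2 * (s + r) - 1)) ^ 2 = 4 ^ (2 * s + r) * 4 ^ r / 4 := by
      have h6 : (4 : ℝ) ^ (2 * s + r) * 4 ^ r = (2 ^ (2 * (s + r))) ^ 2 := by
        rw [← pow_add, show (4 : ℝ) = 2 ^ 2 by norm_num, ← pow_mul, ← pow_mul]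
        congr 1; ring
      rw [h6, h4]; ring
    rw [h5, hα]; field_simp; norm_num
  have hR2 : (4 : ℝ) ^ r / 8 ≤ π ^ 2 / (16 * α) := by
    have h6 : π ^ 2 / (16 * α) = π ^ 2 * (4 ^ (2 * s) / 16) * 4 ^ r := by
      rw [hα, pow_add]; field_simp
    rw [h6]
    have h7 : (9 : ℝ) ≤ π ^ 2 := by nlinarith [pi_gt_three]
    have h8 : (0 : ℝ) < 4 ^ r := by positivity
    have h9 : (1 : ℝ) ≤ π ^ 2 * (4 ^ (2 * s) / 16) := by nlinarith
    nlinarith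
  rw [hgauss, hR1] at happ
  set G := exp (-(π ^ 2 * 4 ^ s * y ^ 2)) with hG
  have hG0 : 0 < G := exp_pos _
  have hG1 : G ≤ 1 := exp_le_one_iff.2 (by rw [neg_nonpos]; positivity)
  have hG2 : exp (-(2 * (π ^ 2 * 4 ^ s) * y ^ 2)) = G ^ 2 := by
    rw [hG, ← exp_nat_mul]; congr 1; push_cast; ring
  set B := √(π / α) with hB
  have hB0 : 0 ≤ B := sqrt_nonneg _
  have hB2 : B ^ 2 = π * 4 ^ (2 * s + r) := by rw [hB, sq_sqrt (by positivity), hpa]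
  set T := truncTheta α (s + r) (step (s + r) * y)
  set δ := approxError r with hδ
  have hδ0 : 0 < δ := approxError_pos r
  have hδ1 : δ ≤ 1 := approxError_le_one hr
  have hT : |‖T‖ - B * G| ≤ B * δ := by
    have h1 : |‖T‖ - ‖((B * G : ℝ) : ℂ)‖| ≤ ‖T - ((B * G : ℝ) : ℂ)‖ := abs_norm_sub_norm_le _ _
    rw [Complex.norm_real, norm_of_nonneg (by positivity)] at h1
    refine h1.trans (happ.trans (mul_le_mul_of_nonneg_left ?_ hB0))
    have h2 : exp (-(π ^ 2 / (16 * α))) ≤ exp (-(4 ^ r / 8)) := exp_le_exp.2 (by linarith)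
    rw [hδ, approxError]; linarith
  have hT2 : |‖T‖ ^ 2 - B ^ 2 * G ^ 2| ≤ B ^ 2 * (3 * δ) := by
    have h1 : ‖T‖ ^ 2 - B ^ 2 * G ^ 2 = (‖T‖ - B * G) * ((‖T‖ - B * G) + 2 * (B * G)) := by ring
    rw [h1, abs_mul]
    have h2 : |(‖T‖ - B * G) + 2 * (B * G)| ≤ 3 * B := by
      refine (abs_add_le _ _).trans ?_
      rw [abs_of_nonneg (by positivity : 0 ≤ 2 * (B * G))]
      nlinarith
    calc |‖T‖ - B * G| * |(‖T‖ - B * G) + 2 * (B * G)| ≤ (B * δ) * (3 * B) :=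
          mul_le_mul hT h2 (abs_nonneg _) (by positivity)
      _ = B ^ 2 * (3 * δ) := by ring
  rw [norm_mul, Complex.norm_real, norm_of_nonneg (by positivity), mul_pow, div_pow,
    sq_sqrt hZ0.le, hG2, ← hB2, mul_assoc, mul_assoc, ← mul_sub, abs_mul,
    abs_of_nonneg (by positivity)]
  exact mul_le_mul_of_nonneg_left hT2 (by positivity)

end Readout

/-! ### Bias and second moment of the recorded value -/

section Moments

open Real

/-- The recorded readout value, in units of `κ`. -/
def recorded (m : ℕ) (j : Fin (2 ^ (2 * m))) : ℝ :=
  if |gridPoint m j| ≤ 2 then gridPoint m j else 0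

lemma outcome_eq (κ : ℝ) (m : ℕ) (j : Fin (2 ^ (2 * m))) :
    outcome κ m j = κ * recorded m j := by
  rw [outcome, recorded]; split_ifs <;> simp

lemma offset_eq (m : ℕ) (x : ℝ) (k : ℤ) : offset m x k = step m * (k - x / step m) := by
  have := (step_pos m).ne'
  rw [offset]; field_simp

lemma summable_offset (m : ℕ) (x : ℝ) {b : ℝ} (hb : 0 < b) :
    Summable fun k : ℤ => exp (-(b * offset m x k ^ 2)) := by
  have h := summable_gauss (c := b * step m ^ 2) (by have := step_pos m; positivity) (x / step m)
  refine h.congr fun k => ?_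
  rw [offset_eq]; congr 1; ring

lemma tsum_offset_le (m : ℕ) (x : ℝ) {b : ℝ} (hb : 0 < b) (hb1 : b * step m ^ 2 ≤ 1) :
    ∑' k : ℤ, exp (-(b * offset m x k ^ 2)) ≤ 3 * √(π / (b * step m ^ 2)) := by
  have h := tsum_gauss_le (c := b * step m ^ 2) (by have := step_pos m; positivity) hb1 (x / step m)
  refine le_trans (le_of_eq (tsum_congr fun k => ?_)) h
  rw [offset_eq]; congr 1; ring

lemma sharpness_mul_step_sq (s r : ℕ) :
    (π ^ 2 * 4 ^ s) * step (s + r) ^ 2 = π ^ 2 / 4 ^ r := by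
  rw [step_sq, pow_mul]
  have : ((2 : ℝ) ^ 2) ^ (s + r) = 4 ^ s * 4 ^ r := by rw [← pow_add]; norm_num
  rw [this]; field_simp

lemma one_le_sharpness (s : ℕ) : 9 * 4 ^ s ≤ π ^ 2 * 4 ^ s := by
  have h7 : (9 : ℝ) ≤ π ^ 2 := by nlinarith [pi_gt_three]
  gcongr

lemma sixtyFour_le {r : ℕ} (hr : 3 ≤ r) : (64 : ℝ) ≤ 4 ^ r := by
  calc (64 : ℝ) = 4 ^ 3 := by norm_num
    _ ≤ 4 ^ r := pow_le_pow_right₀ (by norm_num) hr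

lemma sqrt_four_pow (r : ℕ) : √((4 : ℝ) ^ r) = 2 ^ r := by
  rw [show (4 : ℝ) = 2 ^ 2 by norm_num, ← pow_mul, mul_comm, pow_mul, sqrt_sq (by positivity)]

/-- The total mass of a Gaussian of comparable sharpness. -/
lemma tsum_offset_le_two_pow {s r : ℕ} (hr : 3 ≤ r) (x : ℝ) {t : ℝ} (ht : 1 / 2 ≤ t)
    (ht1 : t ≤ 1) :
    ∑' k : ℤ, exp (-(t * (π ^ 2 * 4 ^ s) * offset (s + r) x k ^ 2)) ≤ 3 * 2 ^ r := by
  have hR := sixtyFour_le hr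
  have h1 : t * (π ^ 2 * 4 ^ s) * step (s + r) ^ 2 = t * π ^ 2 / 4 ^ r := by
    rw [mul_assoc, sharpness_mul_step_sq]; ring
  have hpi4 := pi_lt_d2
  have hpi3 := pi_gt_three
  have h2 : t * π ^ 2 ≤ 10 := by nlinarith
  refine (tsum_offset_le (s + r) x (b := t * (π ^ 2 * 4 ^ s)) (by positivity) ?_).trans ?_
  · rw [h1, div_le_one (by positivity)]; linarith
  · rw [h1, ← sqrt_four_pow r]
    refine mul_le_mul_of_nonneg_left (sqrt_le_sqrt ?_) (by norm_num)
    rw [div_div_eq_mul_div, div_le_iff₀ (by positivity)]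
    have h3 : π ≤ t * π ^ 2 := by nlinarith
    nlinarith

lemma abs_recorded_sub_le (m : ℕ) (j : Fin (2 ^ (2 * m))) {x : ℝ} (hx : |x| ≤ 1) :
    |recorded m j - x| ≤ 3 := by
  rw [recorded]
  split_ifs with h
  · exact (abs_sub _ _).trans (by linarith)
  · rw [zero_sub, abs_neg]; linarith

/-- A rejected readout satisfies |ω| > 2 and so misses x by more than 1, whereas the recorded 0
misses it by at most 1: the cutoff never increases the error. -/
lemma abs_recorded_sub_le_offset {m : ℕ} (hm : 0 < m) (j : Fin (2 ^ (2 * m))) {x : ℝ}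
    (hx : |x| ≤ 1) : |recorded m j - x| ≤ |offset m x (gridInt m j)| := by
  rw [recorded, offset, ← gridPoint_eq hm]
  split_ifs with h
  · exact le_rfl
  · have := abs_sub_abs_le_abs_sub (gridPoint m j) x
    rw [zero_sub, abs_neg]; linarith

/-- The pointwise error, at most 7·3δ, is added over all N = 4^(s+r) readouts; the exponential
smallness of δ in 4^r has to absorb this factor. -/
lemma sum_readoutProb_error {s r : ℕ} (hs : 1 ≤ s) (hr : 3 ≤ r) {x : ℝ} (hx : |x| ≤ 1)
    (d : Fin (2 ^ (2 * (s + r))) → ℝ) {D : ℝ} (hd : ∀ j, |d j| ≤ D) :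
    |∑ j, d j * readoutProb (widthOf s) (s + r) j x - readoutScale s r *
        ∑ j, d j * exp (-(2 * (π ^ 2 * 4 ^ s) * offset (s + r) x (gridInt (s + r) j) ^ 2))| ≤
      21 * D * 4 ^ (s + r) * approxError r := by
  have hr0 : 0 < r := by omega
  have hA0 := readoutScale_nonneg (s := s) hr0
  have hδ := approxError_pos r
  have hD : 0 ≤ D := (abs_nonneg _).trans (hd ⟨0, by positivity⟩)
  rw [Finset.mul_sum, ← Finset.sum_sub_distrib]
  refine (Finset.abs_sum_le_sum_abs _ _).trans ?_
  have hA7 : readoutScale s r ≤ 7 := by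
    have h1 : (1 : ℝ) ≤ 2 ^ r := one_le_pow₀ (by norm_num)
    nlinarith [readoutScale_mul_le (s := s) hr0]
  have h : ∀ j ∈ Finset.univ, |d j * readoutProb (widthOf s) (s + r) j x - readoutScale s r *
      (d j * exp (-(2 * (π ^ 2 * 4 ^ s) * offset (s + r) x (gridInt (s + r) j) ^ 2)))| ≤
      D * (7 * (3 * approxError r)) := by
    intro j _
    rw [mul_left_comm, ← mul_sub, abs_mul]
    exact mul_le_mul (hd j) ((abs_readoutProb_sub_le hs hr j hx).trans (by gcongr)) (abs_nonneg _) hD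
  refine (Finset.sum_le_card_nsmul _ _ _ h).trans (le_of_eq ?_)
  rw [Finset.card_univ, Fintype.card_fin, nsmul_eq_mul, pow_mul]
  push_cast
  ring

/-- The second moment of the readout. -/
lemma second_moment_le {s r : ℕ} (hs : 1 ≤ s) (hr : 3 ≤ r) {x : ℝ} (hx : |x| ≤ 1) :
    ∑ j, (recorded (s + r) j - x) ^ 2 * readoutProb (widthOf s) (s + r) j x ≤
      21 / (π ^ 2 * 4 ^ s) + 189 * 4 ^ (s + r) * approxError r := by
  have hr0 : 0 < r := by omega
  have hm : 0 < s + r := by omega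
  have hA0 := readoutScale_nonneg (s := s) hr0
  set σ := π ^ 2 * 4 ^ s with hσ
  have hσ0 : 0 < σ := by positivity
  have h1 := sum_readoutProb_error hs hr hx (fun j => (recorded (s + r) j - x) ^ 2) (D := 9)
    (fun j => by
      have := abs_recorded_sub_le (s + r) j hx
      rw [abs_of_nonneg (sq_nonneg _), ← sq_abs]
      nlinarith [abs_nonneg (recorded (s + r) j - x)])
  have h2 : ∑ j, (recorded (s + r) j - x) ^ 2 *
      exp (-(2 * σ * offset (s + r) x (gridInt (s + r) j) ^ 2)) ≤ 1 / σ * (3 * 2 ^ r) := by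
    calc ∑ j, (recorded (s + r) j - x) ^ 2 *
          exp (-(2 * σ * offset (s + r) x (gridInt (s + r) j) ^ 2))
        ≤ ∑ j, 1 / σ * exp (-(1 * σ * offset (s + r) x (gridInt (s + r) j) ^ 2)) := by
          refine Finset.sum_le_sum fun j _ => ?_
          set y := offset (s + r) x (gridInt (s + r) j) with hy
          have h3 : (recorded (s + r) j - x) ^ 2 ≤ y ^ 2 :=
            sq_le_sq.2 (abs_recorded_sub_le_offset hm j hx)
          -- One half of the exponent pays for y² at the price 1/σ, the other half keeps a summable
          -- mass.
          have h4 : exp (-(2 * σ * y ^ 2)) = exp (-(σ * y ^ 2)) * exp (-(1 * σ * y ^ 2)) := by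
            rw [← exp_add]; congr 1; ring
          have h5 : y ^ 2 * exp (-(σ * y ^ 2)) ≤ 1 / σ := by
            rw [exp_neg, ← div_eq_mul_inv, div_le_div_iff₀ (exp_pos _) hσ0]
            linarith [add_one_le_exp (σ * y ^ 2)]
          rw [h4, ← mul_assoc]
          refine mul_le_mul_of_nonneg_right ((mul_le_mul_of_nonneg_right h3 (exp_pos _).le).trans h5)
            (exp_pos _).le
      _ = 1 / σ * ∑ j, exp (-(1 * σ * offset (s + r) x (gridInt (s + r) j) ^ 2)) := by
          rw [Finset.mul_sum]
      _ ≤ 1 / σ * (3 * 2 ^ r) := by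
          refine mul_le_mul_of_nonneg_left ?_ (by positivity)
          refine (sum_gridInt_le hm (summable_offset _ x (b := 1 * σ) (by positivity))
            fun k => (exp_pos _).le).trans ?_
          exact tsum_offset_le_two_pow hr x (by norm_num) le_rfl
  have h6 := readoutScale_mul_le (s := s) hr0
  have h7 : readoutScale s r * (1 / σ * (3 * 2 ^ r)) ≤ 21 / σ := by
    have : readoutScale s r * (1 / σ * (3 * 2 ^ r)) = (readoutScale s r * 2 ^ r) * 3 / σ := by ring
    rw [this]
    gcongr; linarith
  have h8 := (abs_le.1 h1).2
  have h9 := mul_le_mul_of_nonneg_left h2 hA0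
  linarith

lemma summable_first_moment_offset (m : ℕ) (x : ℝ) {b : ℝ} (hb : 0 < b) :
    Summable fun k : ℤ => offset m x k * exp (-(b * offset m x k ^ 2)) := by
  have h := (summable_first_moment (c := b * step m ^ 2) (by have := step_pos m; positivity)
    (x / step m)).mul_left (step m)
  refine h.congr fun k => ?_
  rw [offset_eq, ← mul_assoc]; congr 2; ring

/-- In units of the step the readout Gaussian has c = 2π²/4^r, so the dual exponent π²/c is 4^r/2.
-/
lemma first_moment_offset_le {s r : ℕ} (hr : 3 ≤ r) (x : ℝ) :
    |∑' k : ℤ, offset (s + r) x k * exp (-(2 * (π ^ 2 * 4 ^ s) * offset (s + r) x k ^ 2))| ≤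
      (4 ^ r) ^ 2 * exp (-(4 ^ r / 2)) := by
  have hst := step_pos (s + r)
  have hst1 : step (s + r) ≤ 1 := (step_le_quarter (by omega)).trans (by norm_num)
  have hR := sixtyFour_le hr
  have hc : 2 * (π ^ 2 * 4 ^ s) * step (s + r) ^ 2 = 2 * π ^ 2 / 4 ^ r := by
    rw [mul_assoc, sharpness_mul_step_sq]; ring
  have hc1 : 2 * π ^ 2 / 4 ^ r ≤ 1 := by
    rw [div_le_one (by positivity)]; nlinarith [pi_lt_d2, pi_gt_three]
  have h := abs_first_moment_le (c := 2 * π ^ 2 / 4 ^ r) (by positivity) hc1 (x / step (s + r))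
  have he : ∀ k : ℤ, offset (s + r) x k * exp (-(2 * (π ^ 2 * 4 ^ s) * offset (s + r) x k ^ 2)) =
      step (s + r) * ((k - x / step (s + r)) *
        exp (-(2 * π ^ 2 / 4 ^ r * (k - x / step (s + r)) ^ 2))) := by
    intro k
    rw [offset_eq, ← hc, ← mul_assoc (step (s + r))]; congr 2; ring
  simp only [he]
  rw [tsum_mul_left, abs_mul, abs_of_pos hst]
  have hpi : π * (π / (2 * π ^ 2 / 4 ^ r)) = 4 ^ r / 2 := by
    have := pi_ne_zero
    field_simp
  have hpi2 : 6 * (π / (2 * π ^ 2 / 4 ^ r)) ^ 2 ≤ (4 ^ r) ^ 2 := by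
    have h3 : π / (2 * π ^ 2 / 4 ^ r) = 4 ^ r / (2 * π) := by
      have := pi_ne_zero
      field_simp
    rw [h3, div_pow, ← mul_div_assoc, div_le_iff₀ (by positivity)]
    have h4 : (6 : ℝ) ≤ (2 * π) ^ 2 := by nlinarith [pi_gt_three]
    have h5 : (0 : ℝ) < (4 ^ r) ^ 2 := by positivity
    nlinarith
  rw [hpi] at h
  calc step (s + r) * |∑' k : ℤ, ((k : ℝ) - x / step (s + r)) *
        exp (-(2 * π ^ 2 / 4 ^ r * (k - x / step (s + r)) ^ 2))|
      ≤ 1 * ((4 ^ r) ^ 2 * exp (-(4 ^ r / 2))) := by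
        refine mul_le_mul hst1 (h.trans ?_) (abs_nonneg _) (by norm_num)
        exact mul_le_mul_of_nonneg_right hpi2 (exp_pos _).le
    _ = _ := one_mul _

/-- A quarter of the exponent 2σy² pays for |y|, one half yields exp(-σ) because y² ≥ 1, and a
quarter is left for summation. -/
lemma abs_mul_exp_tail {σ y : ℝ} (hσ : 1 ≤ σ) (hy : 1 ≤ |y|) :
    |y| * exp (-(2 * σ * y ^ 2)) ≤ exp (-σ) * exp (-(1 / 2 * σ * y ^ 2)) := by
  have h1 : |y| ≤ exp (1 / 2 * σ * y ^ 2) := by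
    have := add_one_le_exp (1 / 2 * σ * y ^ 2)
    rw [← sq_abs y] at this ⊢
    nlinarith [sq_nonneg (|y| - 1)]
  have hy2 : 1 ≤ y ^ 2 := by rw [← sq_abs]; nlinarith
  calc |y| * exp (-(2 * σ * y ^ 2)) ≤ exp (1 / 2 * σ * y ^ 2) * exp (-(2 * σ * y ^ 2)) := by gcongr
    _ = exp (-(σ * y ^ 2)) * exp (-(1 / 2 * σ * y ^ 2)) := by
        rw [← exp_add, ← exp_add]; congr 1; ring
    _ ≤ exp (-σ) * exp (-(1 / 2 * σ * y ^ 2)) := by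
        gcongr; nlinarith

/-- The bias of the readout. -/
lemma abs_bias_le {s r : ℕ} (hs : 1 ≤ s) (hr : 3 ≤ r) {x : ℝ} (hx : |x| ≤ 1) :
    |∑ j, (recorded (s + r) j - x) * readoutProb (widthOf s) (s + r) j x| ≤
      63 * 4 ^ (s + r) * approxError r + 42 * exp (-(9 * 4 ^ s)) +
        7 * ((4 ^ r) ^ 2 * exp (-(4 ^ r / 2))) := by
  have hr0 : 0 < r := by omega
  have hm : 0 < s + r := by omega
  have hst := step_pos (s + r)
  have hA0 := readoutScale_nonneg (s := s) hr0
  have hA := readoutScale_mul_le (s := s) hr0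
  have hσ9 := one_le_sharpness s
  have h4s : (1 : ℝ) ≤ 4 ^ s := one_le_pow₀ (by norm_num)
  set σ := π ^ 2 * 4 ^ s with hσ
  have hσ0 : 0 < σ := by positivity
  have h1 := sum_readoutProb_error hs hr hx (fun j => recorded (s + r) j - x)
    (fun j => abs_recorded_sub_le (s + r) j hx)
  set g : ℤ → ℝ := fun k => exp (-(2 * σ * offset (s + r) x k ^ 2)) with hg
  set d : ℤ → ℝ := fun k => (if |(k : ℝ) * step (s + r)| ≤ 2 then k * step (s + r) else 0) - x
    with hd
  have hsum : ∑ j, (recorded (s + r) j - x) * g (gridInt (s + r) j) =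
      ∑' k : ℤ, if -2 ^ (2 * (s + r) - 1) ≤ k ∧ k < 2 ^ (2 * (s + r) - 1) then d k * g k else 0 := by
    rw [← sum_gridInt hm fun k => d k * g k]
    refine Finset.sum_congr rfl fun j _ => ?_
    simp only [hd, recorded, gridPoint_eq hm]
  set w : ℤ → ℝ := fun k =>
    if -2 ^ (2 * (s + r) - 1) ≤ k ∧ k < 2 ^ (2 * (s + r) - 1) then d k * g k else 0 with hw
  have hfull := summable_first_moment_offset (s + r) x (b := 2 * σ) (by positivity)
  have htail := summable_offset (s + r) x (b := 1 / 2 * σ) (by positivity)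
  -- The actual sum and the full lattice sum of offsets differ only where |kh| ≥ 2, by the cutoff or
  -- by the end of the grid. There |y| ≥ 1 and the value used in place of y is no larger than |y|,
  -- so the tail estimate applies.
  have hbound : ∀ k : ℤ, ‖w k - offset (s + r) x k * g k‖ ≤
      2 * exp (-σ) * exp (-(1 / 2 * σ * offset (s + r) x k ^ 2)) := by
    intro k
    set y := offset (s + r) x k with hy
    have key : ∀ D : ℝ, 1 ≤ |y| → |D| ≤ |y| → ‖D * g k - y * g k‖ ≤
        2 * exp (-σ) * exp (-(1 / 2 * σ * y ^ 2)) := by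
      intro D hy1 hD
      have h2 : |D - y| ≤ 2 * |y| := (abs_sub _ _).trans (by linarith)
      have h3 := abs_mul_exp_tail (σ := σ) (by linarith) hy1
      have hgk : g k = exp (-(2 * σ * y ^ 2)) := rfl
      rw [← sub_mul, norm_mul, hgk, norm_of_nonneg (exp_pos _).le, norm_eq_abs]
      calc |D - y| * exp (-(2 * σ * y ^ 2)) ≤ 2 * |y| * exp (-(2 * σ * y ^ 2)) := by gcongr
        _ ≤ 2 * (exp (-σ) * exp (-(1 / 2 * σ * y ^ 2))) := by linarith
        _ = _ := by ring
    have hyx : y = k * step (s + r) - x := rfl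
    have hfar : 2 < |(k : ℝ) * step (s + r)| ∨ 2 ≤ |(k : ℝ) * step (s + r)| → 1 ≤ |y| := by
      intro h
      have h2 : 2 ≤ |(k : ℝ) * step (s + r)| := by rcases h with h | h <;> linarith
      have h3 := abs_sub_abs_le_abs_sub ((k : ℝ) * step (s + r)) x
      rw [hyx]; linarith
    simp only [hw]
    split_ifs with hk
    · by_cases h2 : |(k : ℝ) * step (s + r)| ≤ 2
      · have : d k = y := by simp only [hd, if_pos h2, hyx]
        rw [this, sub_self, norm_zero]; positivity
      · have h3 := hfar (Or.inl (not_le.1 h2))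
        refine key _ h3 ?_
        simp only [hd, if_neg h2, zero_sub, abs_neg]
        linarith
    · have h2 : (2 : ℝ) ^ (2 * (s + r) - 1) ≤ |(k : ℝ)| := by
        have : (2 : ℤ) ^ (2 * (s + r) - 1) ≤ |k| := by
          by_contra hlt
          rw [not_le, abs_lt] at hlt
          exact hk ⟨hlt.1.le, hlt.2⟩
        rw [← Int.cast_abs]; exact_mod_cast this
      have h3 : 1 ≤ |y| := by
        refine hfar (Or.inr ?_)
        rw [abs_mul, abs_of_pos hst]
        have h4 : (2 : ℝ) ^ (2 * (s + r) - 1) * step (s + r) = 2 ^ (s + r - 1) := by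
          rw [step, show 2 * (s + r) - 1 = (s + r - 1) + (s + r) by omega, pow_add]; field_simp
        have h5 : (2 : ℝ) ^ 1 ≤ 2 ^ (s + r - 1) := pow_le_pow_right₀ (by norm_num) (by omega)
        nlinarith
      have := key 0 h3 (by rw [abs_zero]; exact abs_nonneg _)
      rwa [zero_mul] at this
  have hsumm := htail.mul_left (2 * exp (-σ))
  have hdiff : Summable fun k => w k - offset (s + r) x k * g k :=
    Summable.of_norm_bounded hsumm hbound
  have hwsum : Summable w := by
    have := hdiff.add hfull
    simpa [hg] using this
  have h5 : |∑' k, w k - ∑' k, offset (s + r) x k * g k| ≤ 6 * exp (-σ) * 2 ^ r := by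
    rw [← Summable.tsum_sub hwsum hfull]
    refine (tsum_of_norm_bounded hsumm.hasSum hbound).trans ?_
    rw [tsum_mul_left]
    have := tsum_offset_le_two_pow (s := s) hr x (t := 1 / 2) le_rfl (by norm_num)
    have h6 := exp_pos (-σ)
    rw [← hσ] at this
    nlinarith
  have h7 := first_moment_offset_le (s := s) hr x
  rw [← hσ] at h7
  change |∑' k : ℤ, offset (s + r) x k * g k| ≤ _ at h7
  have h8 : |∑' k, w k| ≤ 6 * exp (-(9 * 4 ^ s)) * 2 ^ r + (4 ^ r) ^ 2 * exp (-(4 ^ r / 2)) := by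
    have h9 := abs_add_le (∑' k, w k - ∑' k, offset (s + r) x k * g k)
      (∑' k, offset (s + r) x k * g k)
    rw [sub_add_cancel] at h9
    have h10 : exp (-σ) ≤ exp (-(9 * 4 ^ s)) := exp_le_exp.2 (by linarith)
    have h11 : 6 * exp (-σ) * 2 ^ r ≤ 6 * exp (-(9 * 4 ^ s)) * 2 ^ r := by gcongr
    linarith
  have h12 : ∑ j, (recorded (s + r) j - x) *
      exp (-(2 * σ * offset (s + r) x (gridInt (s + r) j) ^ 2)) = ∑' k, w k := hsum
  rw [h12] at h1
  have h13 : |readoutScale s r * ∑' k, w k| ≤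
      42 * exp (-(9 * 4 ^ s)) + 7 * ((4 ^ r) ^ 2 * exp (-(4 ^ r / 2))) := by
    rw [abs_mul, abs_of_nonneg hA0]
    refine (mul_le_mul_of_nonneg_left h8 hA0).trans ?_
    have h14 : (1 : ℝ) ≤ 2 ^ r := one_le_pow₀ (by norm_num)
    have h15 : readoutScale s r ≤ 7 := by nlinarith
    have h16 := exp_pos (-(9 * (4 : ℝ) ^ s))
    have h17 : 0 ≤ ((4 : ℝ) ^ r) ^ 2 * exp (-(4 ^ r / 2)) := by positivity
    have h18 : readoutScale s r * (6 * exp (-(9 * 4 ^ s)) * 2 ^ r) ≤ 42 * exp (-(9 * 4 ^ s)) := by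
      calc readoutScale s r * (6 * exp (-(9 * 4 ^ s)) * 2 ^ r)
          = readoutScale s r * 2 ^ r * (6 * exp (-(9 * 4 ^ s))) := by ring
        _ ≤ 7 * (6 * exp (-(9 * 4 ^ s))) := by gcongr
        _ = _ := by ring
    have h19 := mul_le_mul_of_nonneg_right h15 h17
    linarith
  have h20 := abs_add_le (∑ j, (recorded (s + r) j - x) * readoutProb (widthOf s) (s + r) j x -
    readoutScale s r * ∑' k, w k) (readoutScale s r * ∑' k, w k)
  rw [sub_add_cancel] at h20
  linarith

end Moments

/-! ### Functions of the observable -/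

section Spectral

variable {S : Type*} [Fintype S] [DecidableEq S]

/-- The matrix with eigenvectors `V` and eigenvalues `f`. -/
def diagConj (V : Matrix S S ℂ) (f : S → ℂ) : Matrix S S ℂ := V * Matrix.diagonal f * Vᴴ

variable {V : Matrix S S ℂ}

lemma conjTranspose_mul_of_unitary (hV : V ∈ Matrix.unitaryGroup S ℂ) : Vᴴ * V = 1 :=
  Matrix.mem_unitaryGroup_iff'.1 hV

lemma mul_conjTranspose_of_unitary (hV : V ∈ Matrix.unitaryGroup S ℂ) : V * Vᴴ = 1 :=
  Matrix.mem_unitaryGroup_iff.1 hV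

lemma diagConj_mul (hV : V ∈ Matrix.unitaryGroup S ℂ) (f g : S → ℂ) :
    diagConj V f * diagConj V g = diagConj V (fun i => f i * g i) := by
  have h : diagConj V f * diagConj V g =
      V * Matrix.diagonal f * (Vᴴ * V) * Matrix.diagonal g * Vᴴ := by
    simp only [diagConj, Matrix.mul_assoc]
  rw [h, conjTranspose_mul_of_unitary hV, Matrix.mul_one, Matrix.mul_assoc V,
    Matrix.diagonal_mul_diagonal, diagConj]

lemma diagConj_conjTranspose (f : S → ℂ) :
    (diagConj V f)ᴴ = diagConj V (fun i => star (f i)) := by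
  rw [diagConj, Matrix.conjTranspose_mul, Matrix.conjTranspose_mul,
    Matrix.conjTranspose_conjTranspose, Matrix.diagonal_conjTranspose, ← Matrix.mul_assoc, diagConj]
  rfl

lemma diagConj_sum {ι : Type*} (s : Finset ι) (f : ι → S → ℂ) :
    ∑ a ∈ s, diagConj V (f a) = diagConj V (fun i => ∑ a ∈ s, f a i) := by
  have h : (Matrix.diagonal fun i => ∑ a ∈ s, f a i) = ∑ a ∈ s, Matrix.diagonal (f a) := by
    ext i j
    rw [Matrix.sum_apply]
    by_cases hij : i = j
    · subst hij; simp
    · simp [Matrix.diagonal_apply_ne _ hij]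
  rw [diagConj, h, Finset.mul_sum, Finset.sum_mul]
  rfl

lemma diagConj_smul (c : ℂ) (f : S → ℂ) :
    c • diagConj V f = diagConj V (fun i => c * f i) := by
  have h : (Matrix.diagonal fun i => c * f i) = c • Matrix.diagonal f := by
    rw [← Matrix.diagonal_smul]; rfl
  rw [diagConj, diagConj, h, Matrix.mul_smul, Matrix.smul_mul]

lemma diagConj_one (hV : V ∈ Matrix.unitaryGroup S ℂ) : diagConj V (fun _ => 1) = 1 := by
  have h : (Matrix.diagonal fun _ : S => (1 : ℂ)) = 1 := Matrix.diagonal_one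
  rw [diagConj, h, Matrix.mul_one, mul_conjTranspose_of_unitary hV]

lemma exp_diagConj (hV : V ∈ Matrix.unitaryGroup S ℂ) (f : S → ℂ) :
    NormedSpace.exp (diagConj V f) = diagConj V (fun i => Complex.exp (f i)) := by
  have hinv : V⁻¹ = Vᴴ := Matrix.inv_eq_right_inv (mul_conjTranspose_of_unitary hV)
  have hu : IsUnit V := ⟨⟨V, Vᴴ, mul_conjTranspose_of_unitary hV,
    conjTranspose_mul_of_unitary hV⟩, rfl⟩
  rw [diagConj, ← hinv, Matrix.exp_conj _ _ hu, Matrix.exp_diagonal, diagConj, hinv]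
  congr 3
  ext i
  rw [Complex.exp_eq_exp_ℂ, Pi.exp_def]

lemma exists_diagConj {O : Matrix S S ℂ} (hO : O.IsHermitian) :
    ∃ V ∈ Matrix.unitaryGroup S ℂ, ∃ ev : S → ℝ,
      (∀ i, |ev i| ≤ ‖O‖) ∧ O = diagConj V (fun i => (ev i : ℂ)) := by
  have h : O = diagConj (hO.eigenvectorUnitary : Matrix S S ℂ)
      (fun i => (hO.eigenvalues i : ℂ)) := by
    conv_lhs => rw [hO.spectral_theorem, Unitary.conjStarAlgAut_apply]
    rfl
  refine ⟨hO.eigenvectorUnitary, hO.eigenvectorUnitary.2, hO.eigenvalues, fun i => ?_, h⟩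
  have h1 : ‖O‖ = ‖Matrix.diagonal fun i => (hO.eigenvalues i : ℂ)‖ := by
    conv_lhs => rw [h]
    rw [diagConj]
    exact (CStarRing.norm_mul_coe_unitary _ (star hO.eigenvectorUnitary)).trans
      (CStarRing.norm_coe_unitary_mul hO.eigenvectorUnitary _)
  rw [h1, Matrix.l2_opNorm_diagonal]
  have := norm_le_pi_norm (fun i => (hO.eigenvalues i : ℂ)) i
  simpa using this

/-- The distribution of the eigenvectors `V` in the state `ρ`. -/
def eigenProb (V ρ : Matrix S S ℂ) (i : S) : ℝ := ((Vᴴ * ρ * V) i i).re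

set_option linter.unusedSectionVars false in
lemma eigenProb_nonneg {ρ : Matrix S S ℂ} (hρ : ρ.PosSemidef) (i : S) : 0 ≤ eigenProb V ρ i := by
  have h := (hρ.conjTranspose_mul_mul_same V).diag_nonneg (i := i)
  exact (Complex.le_def.1 h).1

set_option linter.unusedSectionVars false in
lemma coe_eigenProb {ρ : Matrix S S ℂ} (hρ : ρ.PosSemidef) (i : S) :
    ((eigenProb V ρ i : ℝ) : ℂ) = (Vᴴ * ρ * V) i i := by
  have h := (hρ.conjTranspose_mul_mul_same V).diag_nonneg (i := i)
  refine Complex.ext rfl ?_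
  rw [Complex.ofReal_im]
  exact (Complex.le_def.1 h).2

lemma trace_diagConj_mul {ρ : Matrix S S ℂ} (hρ : ρ.PosSemidef) (f : S → ℂ) :
    (diagConj V f * ρ).trace = ∑ i, f i * eigenProb V ρ i := by
  rw [diagConj, Matrix.mul_assoc, Matrix.mul_assoc, Matrix.trace_mul_comm, Matrix.mul_assoc,
    Matrix.trace]
  refine Finset.sum_congr rfl fun i _ => ?_
  rw [Matrix.diag_apply, Matrix.diagonal_mul, coe_eigenProb hρ]

lemma sum_eigenProb (hV : V ∈ Matrix.unitaryGroup S ℂ) {ρ : Matrix S S ℂ} (hρ : IsState ρ) :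
    ∑ i, eigenProb V ρ i = 1 := by
  have h := trace_diagConj_mul (V := V) hρ.1 fun _ => 1
  rw [diagConj_one hV, Matrix.one_mul, hρ.2] at h
  simp only [one_mul] at h
  exact_mod_cast h.symm

lemma trace_sandwich (hV : V ∈ Matrix.unitaryGroup S ℂ) {ρ : Matrix S S ℂ} (hρ : ρ.PosSemidef)
    (f : S → ℂ) :
    (diagConj V f * ρ * (diagConj V f)ᴴ).trace.re = ∑ i, ‖f i‖ ^ 2 * eigenProb V ρ i := by
  rw [Matrix.trace_mul_comm, ← Matrix.mul_assoc, diagConj_conjTranspose, diagConj_mul hV,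
    trace_diagConj_mul hρ, Complex.re_sum]
  refine Finset.sum_congr rfl fun i _ => ?_
  have : star (f i) * f i = ((‖f i‖ ^ 2 : ℝ) : ℂ) := by
    rw [Complex.star_def, Complex.conj_mul']; push_cast; rfl
  rw [this, ← Complex.ofReal_mul, Complex.ofReal_re]

end Spectral

/-! ### Moments of noisy observations -/

section FiniteProbability

variable {ι J : Type*} [Fintype ι] [Fintype J]

/-- Mean, variance and covariance of a random variable that is noisy with small bias. -/
lemma noisy_moments {p f : ι → ℝ} {P : J → ι → ℝ} {v : J → ℝ} {β M B : ℝ} (hp : ∀ i, 0 ≤ p i)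
    (hp1 : ∑ i, p i = 1) (hP : ∀ j i, 0 ≤ P j i) (hP1 : ∀ i, ∑ j, P j i = 1)
    (hf : ∀ i, |f i| ≤ B) (hβ : ∀ i, |∑ j, (v j - f i) * P j i| ≤ β)
    (hM : ∀ i, ∑ j, (v j - f i) ^ 2 * P j i ≤ M) {E : ℝ}
    (hE : E = ∑ j, v j * ∑ i, P j i * p i) :
    |E - ∑ i, f i * p i| ≤ β ∧
      |∑ j, (v j - E) ^ 2 * ∑ i, P j i * p i - (∑ i, f i * f i * p i - (∑ i, f i * p i) ^ 2)| ≤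
        M + 2 * β * (2 * B + β) + β ^ 2 ∧
      |∑ j, ∑ k, (v j - E) * (v k - E) * ∑ i, P j i * P k i * p i| ≤
        ∑ j, (v j - E) ^ 2 * ∑ i, P j i * p i := by
  have swap : ∀ g : J → ℝ, ∑ j, g j * ∑ i, P j i * p i = ∑ i, (∑ j, g j * P j i) * p i := by
    intro g
    simp only [Finset.mul_sum, Finset.sum_mul]
    rw [Finset.sum_comm]
    simp only [mul_assoc]
  have avg : ∀ {g : ι → ℝ} {c : ℝ}, (∀ i, |g i| ≤ c) → |∑ i, g i * p i| ≤ c := by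
    intro g c hg
    refine (Finset.abs_sum_le_sum_abs _ _).trans ?_
    calc ∑ i, |g i * p i| ≤ ∑ i, c * p i := by
          refine Finset.sum_le_sum fun i _ => ?_
          rw [abs_mul, abs_of_nonneg (hp i)]
          exact mul_le_mul_of_nonneg_right (hg i) (hp i)
      _ = c := by rw [← Finset.mul_sum, hp1, mul_one]
  set μ := ∑ i, f i * p i with hμ
  have hmean : ∀ i, ∑ j, (v j - f i) * P j i = ∑ j, v j * P j i - f i := by
    intro i
    simp only [sub_mul, Finset.sum_sub_distrib]
    rw [← Finset.mul_sum, hP1, mul_one]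
  have h1 : |E - μ| ≤ β := by
    have : E - μ = ∑ i, (∑ j, (v j - f i) * P j i) * p i := by
      rw [hE, swap, hμ, ← Finset.sum_sub_distrib]
      refine Finset.sum_congr rfl fun i _ => ?_
      rw [hmean]; ring
    rw [this]
    exact avg hβ
  have hμB : |μ| ≤ B := avg hf
  have hne : Nonempty ι := by
    by_contra h
    rw [not_nonempty_iff] at h
    simp at hp1
  have hβ0 : 0 ≤ β := (abs_nonneg _).trans (hβ hne.some)
  refine ⟨h1, ?_, ?_⟩
  · rw [swap]
    -- Expansion about the true value f i: the noise, a cross term containing the bias, and the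
    -- spread of f, whose mean is the wanted variance up to (E - μ)².
    have h2 : ∀ i, ∑ j, (v j - E) ^ 2 * P j i = ∑ j, (v j - f i) ^ 2 * P j i +
        2 * (f i - E) * ∑ j, (v j - f i) * P j i + (f i - E) ^ 2 := by
      intro i
      have : ∀ j, (v j - E) ^ 2 * P j i = (v j - f i) ^ 2 * P j i +
          2 * (f i - E) * ((v j - f i) * P j i) + (f i - E) ^ 2 * P j i := fun j => by ring
      simp only [this, Finset.sum_add_distrib]
      rw [← Finset.mul_sum, ← Finset.mul_sum, hP1, mul_one]
    have h3 : ∑ i, (f i - E) ^ 2 * p i = (∑ i, f i * f i * p i - μ ^ 2) + (E - μ) ^ 2 := by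
      have : ∀ i, (f i - E) ^ 2 * p i = f i * f i * p i - 2 * E * (f i * p i) + E ^ 2 * p i :=
        fun i => by ring
      simp only [this, Finset.sum_add_distrib, Finset.sum_sub_distrib]
      rw [← Finset.mul_sum, ← Finset.mul_sum, hp1, ← hμ]; ring
    have h4 : ∑ i, (∑ j, (v j - E) ^ 2 * P j i) * p i = ∑ i, (∑ j, (v j - f i) ^ 2 * P j i +
        2 * (f i - E) * ∑ j, (v j - f i) * P j i) * p i + ∑ i, (f i - E) ^ 2 * p i := by
      rw [← Finset.sum_add_distrib]
      refine Finset.sum_congr rfl fun i _ => ?_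
      rw [h2]; ring
    rw [h4, h3]
    have h5 : |∑ i, (∑ j, (v j - f i) ^ 2 * P j i +
        2 * (f i - E) * ∑ j, (v j - f i) * P j i) * p i| ≤ M + 2 * β * (2 * B + β) := by
      refine avg fun i => ?_
      refine (abs_add_le _ _).trans (add_le_add ?_ ?_)
      · rw [abs_of_nonneg (Finset.sum_nonneg fun j _ => mul_nonneg (sq_nonneg _) (hP j i))]
        exact hM i
      · rw [abs_mul, abs_mul, abs_two]
        have h6 : |f i - E| ≤ 2 * B + β := by
          have e : f i - E = f i - μ - (E - μ) := by ring
          rw [e]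
          refine (abs_sub _ _).trans (add_le_add ((abs_sub _ _).trans ?_) h1)
          linarith [hf i]
        have h7 := hβ i
        have h8 : 0 ≤ 2 * B + β := (abs_nonneg _).trans h6
        calc 2 * |f i - E| * |∑ j, (v j - f i) * P j i| ≤ 2 * (2 * B + β) * β := by gcongr
          _ = _ := by ring
    have h9 : (E - μ) ^ 2 ≤ β ^ 2 := by
      rw [← sq_abs]; exact pow_le_pow_left₀ (abs_nonneg _) h1 2
    have h10 := abs_add_le (∑ i, (∑ j, (v j - f i) ^ 2 * P j i +
        2 * (f i - E) * ∑ j, (v j - f i) * P j i) * p i) ((E - μ) ^ 2)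
    rw [abs_of_nonneg (sq_nonneg (E - μ))] at h10
    refine le_trans (le_of_eq ?_) (h10.trans (by linarith))
    congr 1; ring
  -- Given i the two outcomes are independent with the same law, so the covariance is the mean
  -- square of a conditional mean. It is at most the variance since a conditional variance is
  -- nonnegative.
  · have h2 : ∑ j, ∑ k, (v j - E) * (v k - E) * ∑ i, P j i * P k i * p i =
        ∑ i, (∑ j, (v j - E) * P j i) ^ 2 * p i := by
      have : ∀ i, (∑ j, (v j - E) * P j i) ^ 2 * p i =
          ∑ j, ∑ k, (v j - E) * (v k - E) * (P j i * P k i * p i) := by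
        intro i
        rw [sq, Finset.sum_mul_sum, Finset.sum_mul]
        refine Finset.sum_congr rfl fun j _ => ?_
        rw [Finset.sum_mul]
        refine Finset.sum_congr rfl fun k _ => ?_
        ring
      simp only [this, Finset.mul_sum]
      symm
      rw [Finset.sum_comm]
      exact Finset.sum_congr rfl fun j _ => Finset.sum_comm
    rw [h2, swap, abs_of_nonneg (Finset.sum_nonneg fun i _ => mul_nonneg (sq_nonneg _) (hp i))]
    refine Finset.sum_le_sum fun i _ => mul_le_mul_of_nonneg_right ?_ (hp i)
    set e := ∑ j, (v j - E) * P j i with he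
    have h3 : 0 ≤ ∑ j, (v j - E - e) ^ 2 * P j i :=
      Finset.sum_nonneg fun j _ => mul_nonneg (sq_nonneg _) (hP j i)
    have h4 : ∑ j, (v j - E - e) ^ 2 * P j i = ∑ j, (v j - E) ^ 2 * P j i - e ^ 2 := by
      have : ∀ j, (v j - E - e) ^ 2 * P j i =
          (v j - E) ^ 2 * P j i - 2 * e * ((v j - E) * P j i) + e ^ 2 * P j i := fun j => by ring
      simp only [this, Finset.sum_add_distrib, Finset.sum_sub_distrib]
      rw [← Finset.mul_sum, ← Finset.mul_sum, hP1, ← he]; ring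
    linarith

end FiniteProbability

/-! ### Unitarity of the transform and normalization -/

section Isometry

/-- The shift of j only contributes the common phase c; what remains is a geometric sum of powers of
an N-th root of unity. -/
lemma shiftedQFT_orthogonal (m : ℕ) (l l' : Fin (2 ^ (2 * m))) :
    ∑ j, star (shiftedQFT m j l) * shiftedQFT m j l' = if l = l' then 1 else 0 := by
  have hN : (2 : ℂ) ^ (2 * m) ≠ 0 := by positivity
  have hnorm : (((√(2 ^ (2 * m)))⁻¹ : ℝ) : ℂ) * (((√(2 ^ (2 * m)))⁻¹ : ℝ) : ℂ) =
      (2 ^ (2 * m))⁻¹ := by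
    rw [← Complex.ofReal_mul, ← mul_inv, Real.mul_self_sqrt (by positivity)]
    push_cast; rfl
  set ζ := Complex.exp (2 * Real.pi * Complex.I * (((l' : ℕ) : ℂ) - ((l : ℕ) : ℂ)) / 2 ^ (2 * m))
    with hζ
  set c := Complex.exp (-(2 * Real.pi * Complex.I * (((l' : ℕ) : ℂ) - ((l : ℕ) : ℂ)) / 2)) with hc
  have hterm : ∀ j : Fin (2 ^ (2 * m)), star (shiftedQFT m j l) * shiftedQFT m j l' =
      (2 ^ (2 * m))⁻¹ * c * ζ ^ (j : ℕ) := by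
    intro j
    have hstar : star (Complex.exp (2 * Real.pi * Complex.I * ((l : ℂ) - 2 ^ (2 * m) / 2) *
        ((j : ℂ) - 2 ^ (2 * m) / 2) / 2 ^ (2 * m))) =
        Complex.exp (-(2 * Real.pi * Complex.I * ((l : ℂ) - 2 ^ (2 * m) / 2) *
        ((j : ℂ) - 2 ^ (2 * m) / 2) / 2 ^ (2 * m))) := by
      rw [Complex.star_def, ← Complex.exp_conj]
      congr 1
      have h2 : (starRingEnd ℂ) 2 = 2 := Complex.conj_ofNat 2
      simp only [map_mul, map_div₀, map_sub, map_pow, h2, Complex.conj_I, Complex.conj_ofReal,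
        Complex.conj_natCast]
      ring
    rw [shiftedQFT, shiftedQFT, star_mul', hstar, Complex.star_def, Complex.conj_ofReal]
    have h1 : ∀ a b d : ℂ, a * b * (a * d) = a * a * (b * d) := fun a b d => by ring
    rw [h1, hnorm, ← Complex.exp_add, hζ, hc, ← Complex.exp_nat_mul, mul_assoc ((2 ^ (2 * m))⁻¹ : ℂ),
      ← Complex.exp_add]
    congr 2
    field_simp
    ring
  rw [Finset.sum_congr rfl fun j _ => hterm j, ← Finset.mul_sum,
    Fin.sum_univ_eq_sum_range (fun j => ζ ^ j)]
  split_ifs with h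
  · subst h
    have h1 : ζ = 1 := by rw [hζ]; simp
    have h2 : c = 1 := by rw [hc]; simp
    simp [h1, h2]
  · have h1 : ζ ≠ 1 := by
      rw [hζ, Ne, Complex.exp_eq_one_iff]
      rintro ⟨n, hn⟩
      have h2 : (2 * Real.pi * Complex.I : ℂ) ≠ 0 := Complex.two_pi_I_ne_zero
      have h3 : (((l' : ℕ) : ℂ) - ((l : ℕ) : ℂ)) = n * 2 ^ (2 * m) := by
        rw [div_eq_iff hN] at hn
        refine mul_left_cancel₀ h2 (hn.trans ?_)
        ring
      have h4 : ((l' : ℕ) : ℤ) - ((l : ℕ) : ℤ) = n * 2 ^ (2 * m) := by exact_mod_cast h3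
      have h5 : ((l' : ℕ) : ℤ) < 2 ^ (2 * m) := by exact_mod_cast l'.2
      have h6 : ((l : ℕ) : ℤ) < 2 ^ (2 * m) := by exact_mod_cast l.2
      have h7 : (0 : ℤ) < 2 ^ (2 * m) := by positivity
      have h8 : n = 0 := by
        have h9 : n * 2 ^ (2 * m) < 1 * 2 ^ (2 * m) := by omega
        have h10 : (-1) * 2 ^ (2 * m) < n * 2 ^ (2 * m) := by omega
        have := lt_of_mul_lt_mul_right h9 h7.le
        have := lt_of_mul_lt_mul_right h10 h7.le
        omega
      rw [h8, zero_mul] at h4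
      exact h (Fin.ext (by omega))
    have h2 : ζ ^ 2 ^ (2 * m) = 1 := by
      rw [hζ, ← Complex.exp_nat_mul, Complex.exp_eq_one_iff]
      refine ⟨(l' : ℤ) - (l : ℤ), ?_⟩
      push_cast
      field_simp
    rw [geom_sum_eq h1, h2]; simp

/-- Applying the transform to the readout register preserves sesquilinear sums. -/
lemma sum_shiftedQFT {E : Type*} [AddCommGroup E] [Module ℂ E] (m : ℕ)
    (f : Fin (2 ^ (2 * m)) → Fin (2 ^ (2 * m)) → E) :
    ∑ j, ∑ l, ∑ l', (star (shiftedQFT m j l) * shiftedQFT m j l') • f l l' = ∑ l, f l l := by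
  rw [Finset.sum_comm]
  refine Finset.sum_congr rfl fun l _ => ?_
  rw [Finset.sum_comm]
  simp only [← Finset.sum_smul, shiftedQFT_orthogonal]
  simp

lemma sum_resource_sq {γ : ℝ} (hγ : 0 < γ) {m : ℕ}
    (hZ : 0 < gaussSum (4 * Real.pi ^ 2 * γ ^ 2 * step m ^ 2) m) :
    ∑ l, ‖resource γ m l‖ ^ 2 = 1 := by
  set α := 4 * Real.pi ^ 2 * γ ^ 2 * step m ^ 2 with hα
  have h : ∀ l, ‖resource γ m l‖ ^ 2 =
      (if (l : ℕ) = 0 then 0 else Real.exp (-(2 * α * gridIndex m l ^ 2))) / gaussSum α m := by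
    intro l
    rw [resource_eq hγ, ← hα]
    split_ifs
    · simp
    · rw [Complex.norm_real, Real.norm_eq_abs, sq_abs, div_pow, Real.sq_sqrt hZ.le,
        ← Real.exp_nat_mul]
      congr 2; push_cast; ring
  rw [Finset.sum_congr rfl fun l _ => h l, ← Finset.sum_div, ← gaussSum, div_self hZ.ne']

lemma sum_readoutProb {γ : ℝ} (hγ : 0 < γ) {m : ℕ}
    (hZ : 0 < gaussSum (4 * Real.pi ^ 2 * γ ^ 2 * step m ^ 2) m) (x : ℝ) :
    ∑ j, readoutProb γ m j x = 1 := by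
  set e : Fin (2 ^ (2 * m)) → ℂ := fun l =>
    resource γ m l * Complex.exp (-(Complex.I * ((2 * Real.pi * gridPoint m l * x : ℝ) : ℂ)))
    with he
  have h1 : ∀ j, ((readoutProb γ m j x : ℝ) : ℂ) =
      ∑ l, ∑ l', (star (shiftedQFT m j l) * shiftedQFT m j l') • (star (e l) * e l') := by
    intro j
    have h2 : readoutAmp γ m j x = ∑ l, shiftedQFT m j l * e l := by
      simp only [readoutAmp, he, mul_assoc]
    rw [readoutProb, h2]
    push_cast
    rw [← Complex.conj_mul', ← Complex.star_def, star_sum, Finset.sum_mul_sum]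
    refine Finset.sum_congr rfl fun l _ => Finset.sum_congr rfl fun l' _ => ?_
    rw [star_mul', smul_eq_mul]; ring
  have h3 := sum_shiftedQFT m fun l l' => star (e l) * e l'
  simp only [← h1] at h3
  have h4 : ∀ l, star (e l) * e l = ((‖resource γ m l‖ ^ 2 : ℝ) : ℂ) := by
    intro l
    have hn : ‖Complex.exp (-(Complex.I * ((2 * Real.pi * gridPoint m l * x : ℝ) : ℂ)))‖ = 1 := by
      rw [Complex.norm_exp]
      simp
    have h5 : ‖e l‖ = ‖resource γ m l‖ := by rw [he]; simp only [norm_mul, hn, mul_one]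
    rw [Complex.star_def, Complex.conj_mul', h5]; push_cast; rfl
  simp only [h4] at h3
  rw [← Complex.ofReal_sum, ← Complex.ofReal_sum, sum_resource_sq hγ hZ] at h3
  exact_mod_cast h3

end Isometry

/-! ### The instrument in the eigenbasis of the observable -/

section Instrument

variable {S : Type*} [Fintype S] [DecidableEq S] {V : Matrix S S ℂ}

lemma evolution_diagConj (hV : V ∈ Matrix.unitaryGroup S ℂ) (ev : S → ℝ) (τ : ℝ) :
    evolution (diagConj V fun i => (ev i : ℂ)) τ =
      diagConj V fun i => Complex.exp (-(Complex.I * ((τ * ev i : ℝ) : ℂ))) := by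
  rw [evolution, diagConj_smul, exp_diagConj hV]
  congr 1; ext i; congr 1; push_cast; ring

/-- The Kraus operators are simultaneously diagonal, which reduces all outcome statistics to a
mixture over eigenvalues. -/
lemma krausOp_diagConj (hV : V ∈ Matrix.unitaryGroup S ℂ) (ev : S → ℝ) (κ γ : ℝ) (m : ℕ)
    (j : Fin (2 ^ (2 * m))) :
    krausOp κ γ m (diagConj V fun i => (ev i : ℂ)) j =
      diagConj V fun i => readoutAmp γ m j (ev i / κ) := by
  simp only [krausOp, evolution_diagConj hV, diagConj_smul]
  rw [diagConj_sum]
  congr 1; ext i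
  rw [readoutAmp]
  refine Finset.sum_congr rfl fun l _ => ?_
  congr 4; push_cast; ring

variable {γ : ℝ} {m : ℕ}

lemma isKrausFamily_krausOp (hγ : 0 < γ)
    (hZ : 0 < gaussSum (4 * Real.pi ^ 2 * γ ^ 2 * step m ^ 2) m) (κ : ℝ) {O : Matrix S S ℂ}
    (hO : O.IsHermitian) : IsKrausFamily (krausOp κ γ m O) := by
  obtain ⟨V, hV, ev, _, rfl⟩ := exists_diagConj hO
  have h : ∀ x, ∑ j, star (readoutAmp γ m j x) * readoutAmp γ m j x = 1 := by
    intro x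
    have h1 := sum_readoutProb hγ hZ x
    have h2 : ∀ j, star (readoutAmp γ m j x) * readoutAmp γ m j x =
        ((readoutProb γ m j x : ℝ) : ℂ) := by
      intro j
      rw [Complex.star_def, Complex.conj_mul', readoutProb]; push_cast; rfl
    simp only [h2]
    rw [← Complex.ofReal_sum, h1, Complex.ofReal_one]
  rw [IsKrausFamily]
  simp only [krausOp_diagConj hV, diagConj_conjTranspose, diagConj_mul hV, diagConj_sum, h,
    diagConj_one hV]

/-- Without the outcome a unitary on the register before the measurement has no effect:
orthogonality of its columns removes the cross terms ℓ ≠ ℓ'. The channel is a random evolution with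
the weights of the resource state. -/
lemma krausMap_eq (κ : ℝ) (O ρ : Matrix S S ℂ) :
    krausMap (krausOp κ γ m O) ρ = ∑ l, ((‖resource γ m l‖ ^ 2 : ℝ) : ℂ) •
      (evolution O (2 * Real.pi * gridPoint m l / κ) * ρ *
        (evolution O (2 * Real.pi * gridPoint m l / κ))ᴴ) := by
  set U : Fin (2 ^ (2 * m)) → Matrix S S ℂ := fun l =>
    evolution O (2 * Real.pi * gridPoint m l / κ) with hU
  have h := sum_shiftedQFT m fun l l' =>
    (star (resource γ m l) * resource γ m l') • (U l' * ρ * (U l)ᴴ)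
  have h1 : ∀ l, star (resource γ m l) * resource γ m l = ((‖resource γ m l‖ ^ 2 : ℝ) : ℂ) := by
    intro l
    rw [Complex.star_def, Complex.conj_mul']; push_cast; rfl
  simp only [h1] at h
  rw [← h, krausMap]
  refine Finset.sum_congr rfl fun j _ => ?_
  have h2 : krausOp κ γ m O j = ∑ l, (shiftedQFT m j l * resource γ m l) • U l := rfl
  rw [h2, Matrix.conjTranspose_sum, Finset.mul_sum]
  refine Finset.sum_congr rfl fun l _ => ?_
  rw [Finset.sum_mul, Finset.sum_mul]
  refine Finset.sum_congr rfl fun l' _ => ?_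
  rw [Matrix.conjTranspose_smul, Matrix.smul_mul, Matrix.smul_mul, Matrix.mul_smul, smul_smul,
    smul_smul, star_mul']
  congr 1; ring

/-- Mean, variance and covariance of the outcome of the instrument. -/
lemma outcome_moments (hγ : 0 < γ)
    (hZ : 0 < gaussSum (4 * Real.pi ^ 2 * γ ^ 2 * step m ^ 2) m) {κ : ℝ} (hκ : 0 < κ)
    {β M : ℝ}
    (hβ : ∀ x, |x| ≤ 1 → |∑ j, (recorded m j - x) * readoutProb γ m j x| ≤ β)
    (hM : ∀ x, |x| ≤ 1 → ∑ j, (recorded m j - x) ^ 2 * readoutProb γ m j x ≤ M)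
    {O ρ : Matrix S S ℂ} (hO : O.IsHermitian) (hOκ : ‖O‖ ≤ κ) (hρ : IsState ρ) :
    |outcomeExpectation (krausOp κ γ m O) (outcome κ m) ρ - obsExpectation O ρ| ≤ κ * β ∧
      |outcomeVariance (krausOp κ γ m O) (outcome κ m) ρ - obsVariance O ρ| ≤
        κ ^ 2 * M + 2 * (κ * β) * (2 * κ + κ * β) + (κ * β) ^ 2 ∧
      |outcomeCovariance (krausOp κ γ m O) (outcome κ m) ρ| ≤
        outcomeVariance (krausOp κ γ m O) (outcome κ m) ρ := by
  obtain ⟨V, hV, ev, hev, hOV⟩ := exists_diagConj hO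
  have hx : ∀ i, |ev i / κ| ≤ 1 := by
    intro i
    rw [abs_div, abs_of_pos hκ, div_le_one hκ]
    exact (hev i).trans hOκ
  have hprob : ∀ j, (krausOp κ γ m O j * ρ * (krausOp κ γ m O j)ᴴ).trace.re =
      ∑ i, readoutProb γ m j (ev i / κ) * eigenProb V ρ i := by
    intro j
    conv_lhs => rw [hOV, krausOp_diagConj hV, trace_sandwich hV hρ.1]
    rfl
  have hprob2 : ∀ j k, (krausOp κ γ m O k * krausOp κ γ m O j * ρ * (krausOp κ γ m O j)ᴴ *
      (krausOp κ γ m O k)ᴴ).trace.re =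
      ∑ i, readoutProb γ m j (ev i / κ) * readoutProb γ m k (ev i / κ) * eigenProb V ρ i := by
    intro j k
    have h : krausOp κ γ m O k * krausOp κ γ m O j * ρ * (krausOp κ γ m O j)ᴴ *
        (krausOp κ γ m O k)ᴴ = (krausOp κ γ m O k * krausOp κ γ m O j) * ρ *
          (krausOp κ γ m O k * krausOp κ γ m O j)ᴴ := by
      rw [Matrix.conjTranspose_mul, ← Matrix.mul_assoc]
    rw [h]
    conv_lhs => rw [hOV, krausOp_diagConj hV, krausOp_diagConj hV, diagConj_mul hV,
      trace_sandwich hV hρ.1]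
    refine Finset.sum_congr rfl fun i _ => ?_
    rw [norm_mul, mul_pow, readoutProb, readoutProb, mul_comm (‖readoutAmp γ m k _‖ ^ 2)]
  have hobs : obsExpectation O ρ = ∑ i, ev i * eigenProb V ρ i := by
    rw [obsExpectation, Matrix.trace_mul_comm]
    conv_lhs => rw [hOV, trace_diagConj_mul hρ.1, Complex.re_sum]
    refine Finset.sum_congr rfl fun i _ => ?_
    rw [← Complex.ofReal_mul, Complex.ofReal_re]
  have hvar : obsVariance O ρ = ∑ i, ev i * ev i * eigenProb V ρ i -
      (∑ i, ev i * eigenProb V ρ i) ^ 2 := by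
    rw [obsVariance, hobs]
    congr 1
    conv_lhs => rw [hOV, diagConj_mul hV, trace_diagConj_mul hρ.1, Complex.re_sum]
    refine Finset.sum_congr rfl fun i _ => ?_
    rw [← Complex.ofReal_mul, ← Complex.ofReal_mul, Complex.ofReal_re]
  have hd : ∀ i j, outcome κ m j - ev i = κ * (recorded m j - ev i / κ) := by
    intro i j
    rw [outcome_eq, mul_sub, mul_div_cancel₀ _ hκ.ne']
  have hmain := noisy_moments (p := eigenProb V ρ) (f := ev)
    (P := fun j i => readoutProb γ m j (ev i / κ)) (v := outcome κ m) (β := κ * β)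
    (M := κ ^ 2 * M) (B := κ) (eigenProb_nonneg hρ.1) (sum_eigenProb hV hρ)
    (fun j i => sq_nonneg _) (fun i => sum_readoutProb hγ hZ _) (fun i => (hev i).trans hOκ)
    (fun i => by
      simp only [hd, mul_assoc]
      rw [← Finset.mul_sum, abs_mul, abs_of_pos hκ]
      exact mul_le_mul_of_nonneg_left (hβ _ (hx i)) hκ.le)
    (fun i => by
      simp only [hd, mul_pow, mul_assoc]
      rw [← Finset.mul_sum]
      exact mul_le_mul_of_nonneg_left (hM _ (hx i)) (by positivity))
    (E := outcomeExpectation (krausOp κ γ m O) (outcome κ m) ρ)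
    (by rw [outcomeExpectation]; simp only [hprob])
  rw [outcomeVariance, outcomeCovariance, hvar, hobs]
  simp only [hprob, hprob2]
  exact hmain

end Instrument

/-! ### Trace norm and disturbance -/

section TraceNorm

variable {S : Type*} [Fintype S] [DecidableEq S]

lemma norm_diagConj {V : Matrix S S ℂ} (hV : V ∈ Matrix.unitaryGroup S ℂ) (f : S → ℂ) :
    ‖diagConj V f‖ = ‖f‖ := by
  rw [← Matrix.l2_opNorm_diagonal]
  exact (CStarRing.norm_mul_coe_unitary _ (star (⟨V, hV⟩ : Matrix.unitaryGroup S ℂ))).trans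
    (CStarRing.norm_coe_unitary_mul (⟨V, hV⟩ : Matrix.unitaryGroup S ℂ) _)

/-- The columns of `V` are right singular vectors, so those of A V are orthogonal and their lengths
are the singular values. -/
lemma exists_singular (A : Matrix S S ℂ) :
    ∃ V ∈ Matrix.unitaryGroup S ℂ, ∃ μ : S → ℝ, (∀ i, 0 ≤ μ i) ∧
      (A * V)ᴴ * (A * V) = Matrix.diagonal (fun i => (μ i : ℂ)) ∧ traceNorm A = ∑ i, √(μ i) := by
  have hA := Matrix.isHermitian_conjTranspose_mul_self A
  have hV := hA.eigenvectorUnitary.2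
  have h : Aᴴ * A = diagConj (hA.eigenvectorUnitary : Matrix S S ℂ)
      (fun i => (hA.eigenvalues i : ℂ)) := by
    conv_lhs => rw [hA.spectral_theorem, Unitary.conjStarAlgAut_apply]
    rfl
  refine ⟨hA.eigenvectorUnitary, hV, hA.eigenvalues,
    (Matrix.posSemidef_conjTranspose_mul_self A).eigenvalues_nonneg, ?_, rfl⟩
  set V := (hA.eigenvectorUnitary : Matrix S S ℂ)
  have h1 : Vᴴ * V = 1 := conjTranspose_mul_of_unitary hV
  have key : ∀ d, Aᴴ * A = diagConj V d → (A * V)ᴴ * (A * V) = Matrix.diagonal d := by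
    intro d hd
    calc (A * V)ᴴ * (A * V) = Vᴴ * (Aᴴ * A) * V := by
          rw [Matrix.conjTranspose_mul]; simp only [Matrix.mul_assoc]
      _ = (Vᴴ * V) * Matrix.diagonal d * (Vᴴ * V) := by
          rw [hd, diagConj]; simp only [Matrix.mul_assoc]
      _ = _ := by rw [h1, Matrix.one_mul, Matrix.mul_one]
  exact key _ h

/-- In the basis of right singular vectors each diagonal entry is an entry of a matrix of norm ‖B‖
applied to a column whose length is a singular value. -/
lemma norm_trace_mul_le (B A : Matrix S S ℂ) : ‖(B * A).trace‖ ≤ ‖B‖ * traceNorm A := by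
  obtain ⟨V, hV, μ, hμ, hW, hA⟩ := exists_singular A
  have h1 : (B * A).trace = (Vᴴ * B * (A * V)).trace := by
    symm
    rw [Matrix.mul_assoc Vᴴ, Matrix.trace_mul_comm, ← Matrix.mul_assoc B, Matrix.mul_assoc (B * A),
      mul_conjTranspose_of_unitary hV, Matrix.mul_one]
  set W := A * V
  set C := Vᴴ * B with hC
  have hCn : ‖C‖ = ‖B‖ :=
    CStarRing.norm_coe_unitary_mul (star (⟨V, hV⟩ : Matrix.unitaryGroup S ℂ)) B
  rw [h1, hA, Matrix.trace, Finset.mul_sum]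
  refine (norm_sum_le _ _).trans (Finset.sum_le_sum fun i _ => ?_)
  have h2 : ‖(WithLp.toLp 2 fun k => W k i : EuclideanSpace ℂ S)‖ = √(μ i) := by
    rw [EuclideanSpace.norm_eq]
    congr 1
    have h3 := congrFun (congrFun hW i) i
    rw [Matrix.mul_apply, Matrix.diagonal_apply_eq] at h3
    have h4 : ((∑ k, ‖W k i‖ ^ 2 : ℝ) : ℂ) = (μ i : ℂ) := by
      rw [← h3]; push_cast
      refine Finset.sum_congr rfl fun k _ => ?_
      rw [Matrix.conjTranspose_apply, Complex.star_def, Complex.conj_mul']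
    exact_mod_cast h4
  have h5 := Matrix.l2_opNorm_mulVec C (WithLp.toLp 2 fun k => W k i : EuclideanSpace ℂ S)
  rw [h2, hCn] at h5
  refine le_trans ?_ h5
  have h6 := PiLp.norm_apply_le (WithLp.toLp 2 (C *ᵥ fun k => W k i) : EuclideanSpace ℂ S) i
  exact h6

/-- The adjoint of the partial isometry in the polar decomposition attains the trace norm. -/
lemma exists_contraction (A : Matrix S S ℂ) :
    ∃ B : Matrix S S ℂ, ‖B‖ ≤ 1 ∧ traceNorm A = (B * A).trace.re := by
  obtain ⟨V, hV, μ, hμ, hW, hA⟩ := exists_singular A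
  -- On the kernel of `A` the convention 0⁻¹ = 0 makes this the pseudoinverse, so `B` vanishes on
  -- the corresponding directions.
  set D : S → ℂ := fun i => ((√(μ i))⁻¹ : ℝ) with hD
  refine ⟨V * Matrix.diagonal D * (A * V)ᴴ, ?_, ?_⟩
  · have hsa : star D = D := by
      ext i; simp only [Pi.star_apply, hD, Complex.star_def, Complex.conj_ofReal]
    set B := V * Matrix.diagonal D * (A * V)ᴴ with hB
    have h1 : B * Bᴴ = diagConj V fun i => D i * μ i * D i := by
      calc B * Bᴴ = V * (Matrix.diagonal D * ((A * V)ᴴ * (A * V)) * (Matrix.diagonal D)ᴴ) * Vᴴ := by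
            rw [hB, Matrix.conjTranspose_mul (V * _), Matrix.conjTranspose_mul V,
              Matrix.conjTranspose_conjTranspose]
            simp only [Matrix.mul_assoc]
        _ = _ := by
            rw [hW, Matrix.diagonal_conjTranspose, hsa, Matrix.diagonal_mul_diagonal,
              Matrix.diagonal_mul_diagonal]
            rfl
    have h2 : ‖B‖ * ‖B‖ ≤ 1 := by
      rw [← Matrix.l2_opNorm_conjTranspose B, ← Matrix.l2_opNorm_conjTranspose_mul_self,
        Matrix.conjTranspose_conjTranspose, h1, norm_diagConj hV]
      refine (pi_norm_le_iff_of_nonneg zero_le_one).2 fun i => ?_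
      rw [hD]
      simp only
      rw [← Complex.ofReal_mul, ← Complex.ofReal_mul, Complex.norm_real, Real.norm_eq_abs]
      have hs := Real.mul_self_sqrt (hμ i)
      by_cases h : √(μ i) = 0
      · simp [h]
      · conv_lhs => rw [← hs]
        rw [Real.sqrt_mul_self (Real.sqrt_nonneg _)]
        field_simp
        simp
    nlinarith [norm_nonneg B]
  · have h1 : (V * Matrix.diagonal D * (A * V)ᴴ * A).trace =
        (Matrix.diagonal D * ((A * V)ᴴ * (A * V))).trace := by
      rw [Matrix.mul_assoc, Matrix.mul_assoc, Matrix.trace_mul_comm]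
      simp only [Matrix.mul_assoc]
    rw [h1, hW, Matrix.diagonal_mul_diagonal, Matrix.trace_diagonal, hA, Complex.re_sum]
    refine Finset.sum_congr rfl fun i _ => ?_
    rw [hD]
    simp only
    rw [← Complex.ofReal_mul, Complex.ofReal_re]
    by_cases h : √(μ i) = 0
    · simp [h]
    · have hs := Real.mul_self_sqrt (hμ i)
      field_simp
      linarith

lemma evolution_conjTranspose {O : Matrix S S ℂ} (hO : O.IsHermitian) (τ : ℝ) :
    (evolution O τ)ᴴ = evolution O (-τ) := by
  rw [evolution, evolution, ← Matrix.exp_conjTranspose, Matrix.conjTranspose_smul, hO.eq]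
  congr 2
  simp

lemma evolution_mem_unitaryGroup {O : Matrix S S ℂ} (hO : O.IsHermitian) (τ : ℝ) :
    evolution O τ ∈ Matrix.unitaryGroup S ℂ := by
  rw [Matrix.mem_unitaryGroup_iff, Matrix.star_eq_conjTranspose, evolution_conjTranspose hO,
    ← evolution_add, add_neg_cancel, evolution_zero]

lemma hasDerivAt_evolution (O : Matrix S S ℂ) (τ : ℝ) :
    HasDerivAt (evolution O) (evolution O τ * (-Complex.I • O)) τ := by
  have h : ∀ τ : ℝ, evolution O τ = NormedSpace.exp (τ • (-Complex.I • O)) := by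
    intro τ
    rw [evolution]
    congr 1
    ext i j
    simp only [Matrix.smul_apply, smul_eq_mul, Complex.real_smul]
    ring
  have h1 := hasDerivAt_exp_smul_const (𝕂 := ℝ) (-Complex.I • O) τ
  rw [← h] at h1
  exact h1.congr_of_eventuallyEq (Filter.Eventually.of_forall h)

/-- Conjugation by the time evolution moves a matrix at a speed given by the commutator. -/
lemma norm_trace_evolution_sub_le {O : Matrix S S ℂ} (hO : O.IsHermitian) (ρ B : Matrix S S ℂ)
    (τ : ℝ) :
    ‖(B * (evolution O τ * ρ * (evolution O τ)ᴴ - ρ)).trace‖ ≤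
      ‖B‖ * traceNorm (O * ρ - ρ * O) * |τ| := by
  have hcomm : ∀ τ, evolution O τ * O = O * evolution O τ := by
    intro τ
    rw [evolution]
    exact (((Commute.refl O).smul_left _).exp_left).eq
  set L : Matrix S S ℂ →L[ℝ] ℂ :=
    LinearMap.toContinuousLinearMap ((Matrix.traceLinearMap S ℝ ℂ)) with hL
  have hLa : ∀ A, L A = A.trace := fun A => rfl
  set φ : ℝ → ℂ := fun t => (B * (evolution O t * ρ * evolution O (-t))).trace with hφ
  -- Since evolution and `O` commute, the evolution can be moved onto `B` by cyclicity. The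
  -- derivative then pairs the commutator with a unitary conjugate of `B`, which has the same norm
  -- at all times.
  have hderiv : ∀ t, HasDerivAt φ (-Complex.I * (evolution O (-t) * B * evolution O t *
      (O * ρ - ρ * O)).trace) t := by
    intro t
    have h1 := hasDerivAt_evolution O t
    have h2 : HasDerivAt (fun t => evolution O (-t))
        (-(evolution O (-t) * (-Complex.I • O))) t := by
      refine ((hasDerivAt_evolution O (-t)).scomp t (hasDerivAt_neg t)).congr_deriv ?_
      rw [neg_one_smul]
    have h3 := ((h1.mul_const ρ).mul h2).const_mul B
    have h4 := L.hasFDerivAt.comp_hasDerivAt t h3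
    refine h4.congr_deriv ?_
    rw [hLa]
    have h5 : evolution O t * (-Complex.I • O) * ρ * evolution O (-t) +
        evolution O t * ρ * -(evolution O (-t) * (-Complex.I • O)) =
        -Complex.I • (evolution O t * (O * ρ - ρ * O) * evolution O (-t)) := by
      rw [Matrix.mul_smul, Matrix.mul_smul, hcomm (-t)]
      simp only [Matrix.smul_mul, Matrix.mul_smul, Matrix.mul_add, Matrix.add_mul, smul_add,
        smul_neg, Matrix.mul_assoc, Matrix.mul_neg, Matrix.neg_mul, sub_eq_add_neg]
    rw [h5, Matrix.mul_smul, Matrix.trace_smul, smul_eq_mul]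
    congr 1
    rw [← Matrix.mul_assoc, Matrix.trace_mul_comm]
    simp only [Matrix.mul_assoc]
  have hbound : ∀ t, ‖-Complex.I * (evolution O (-t) * B * evolution O t *
      (O * ρ - ρ * O)).trace‖ ≤ ‖B‖ * traceNorm (O * ρ - ρ * O) := by
    intro t
    rw [norm_mul, norm_neg, Complex.norm_I, one_mul]
    refine (norm_trace_mul_le _ _).trans (le_of_eq ?_)
    congr 1
    exact (CStarRing.norm_mul_coe_unitary _
      (⟨_, evolution_mem_unitaryGroup hO t⟩ : Matrix.unitaryGroup S ℂ)).trans
      (CStarRing.norm_coe_unitary_mul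
        (⟨_, evolution_mem_unitaryGroup hO (-t)⟩ : Matrix.unitaryGroup S ℂ) _)
  have h := Convex.norm_image_sub_le_of_norm_hasDerivWithin_le
    (fun t _ => (hderiv t).hasDerivWithinAt) (fun t _ => hbound t) convex_univ
    (Set.mem_univ 0) (Set.mem_univ τ)
  have h0 : φ τ - φ 0 = (B * (evolution O τ * ρ * (evolution O τ)ᴴ - ρ)).trace := by
    rw [hφ, evolution_conjTranspose hO, Matrix.mul_sub, Matrix.trace_sub]
    simp
  rwa [h0, sub_zero, Real.norm_eq_abs] at h

/-- The disturbance by a mixture of time evolutions. -/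
lemma traceNorm_krausMap_sub_le {O : Matrix S S ℂ} (hO : O.IsHermitian) (ρ : Matrix S S ℂ)
    {κ γ : ℝ} {m : ℕ} (h1 : ∑ l, ‖resource γ m l‖ ^ 2 = 1) {τ : ℝ}
    (hτ : ∑ l, ‖resource γ m l‖ ^ 2 * |2 * Real.pi * gridPoint m l / κ| ≤ τ) :
    traceNorm (krausMap (krausOp κ γ m O) ρ - ρ) ≤ τ * traceNorm (O * ρ - ρ * O) := by
  obtain ⟨B, hB, hA⟩ := exists_contraction (krausMap (krausOp κ γ m O) ρ - ρ)
  have hT : 0 ≤ traceNorm (O * ρ - ρ * O) := Finset.sum_nonneg fun i _ => Real.sqrt_nonneg _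
  have h2 : krausMap (krausOp κ γ m O) ρ - ρ = ∑ l, ((‖resource γ m l‖ ^ 2 : ℝ) : ℂ) •
      (evolution O (2 * Real.pi * gridPoint m l / κ) * ρ *
        (evolution O (2 * Real.pi * gridPoint m l / κ))ᴴ - ρ) := by
    simp only [smul_sub, Finset.sum_sub_distrib]
    rw [krausMap_eq, ← Finset.sum_smul, ← Complex.ofReal_sum, h1, Complex.ofReal_one, one_smul]
  rw [hA]
  refine (Complex.re_le_norm _).trans ?_
  rw [h2, Finset.mul_sum, Matrix.trace_sum]
  refine (norm_sum_le _ _).trans ?_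
  calc ∑ l, ‖(B * ((‖resource γ m l‖ ^ 2 : ℝ) : ℂ) •
        (evolution O (2 * Real.pi * gridPoint m l / κ) * ρ *
          (evolution O (2 * Real.pi * gridPoint m l / κ))ᴴ - ρ)).trace‖
      ≤ ∑ l, ‖resource γ m l‖ ^ 2 * |2 * Real.pi * gridPoint m l / κ| *
          traceNorm (O * ρ - ρ * O) := by
        refine Finset.sum_le_sum fun l _ => ?_
        rw [Matrix.mul_smul, Matrix.trace_smul, norm_smul, Complex.norm_real,
          Real.norm_of_nonneg (sq_nonneg _), mul_assoc (‖resource γ m l‖ ^ 2)]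
        refine mul_le_mul_of_nonneg_left ?_ (sq_nonneg _)
        refine (norm_trace_evolution_sub_le hO ρ B _).trans ?_
        refine (mul_le_mul_of_nonneg_right (mul_le_of_le_one_left hT hB) (abs_nonneg _)).trans ?_
        rw [mul_comm]
    _ ≤ τ * traceNorm (O * ρ - ρ * O) := by
        rw [← Finset.sum_mul]
        exact mul_le_mul_of_nonneg_right hτ hT

end TraceNorm

/-! ### Mean evolution time -/

section MeanTime

open Real

/-- The mean evolution time of the resource state. -/
lemma mean_time_le {s r : ℕ} (hr : 0 < r) {κ : ℝ} (hκ : 0 < κ) :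
    ∑ l, ‖resource (widthOf s) (s + r) l‖ ^ 2 * |2 * π * gridPoint (s + r) l / κ| ≤
      60 * 2 ^ s / κ := by
  have hm : 0 < s + r := by omega
  have hZ := le_gaussSum (s := s) hr
  have hZ0 := gaussSum_pos (s := s) hr
  set Z := gaussSum ((4 : ℝ) ^ (2 * s + r))⁻¹ (s + r) with hZdef
  set α := ((4 : ℝ) ^ (2 * s + r))⁻¹ with hα
  set Q : ℝ := 2 ^ (2 * s + r) with hQ
  have hQ0 : 0 < Q := by positivity
  have hQα : α = (Q ^ 2)⁻¹ := by
    rw [hα, hQ, show (4 : ℝ) = 2 ^ 2 by norm_num, ← pow_mul, ← pow_mul, mul_comm]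
  have hα0 : 0 < α := by positivity
  have hα1 : α ≤ 1 := by
    rw [hα]; exact inv_le_one_of_one_le₀ (one_le_pow₀ (by norm_num))
  have hst := step_pos (s + r)
  have hterm : ∀ l, ‖resource (widthOf s) (s + r) l‖ ^ 2 * |2 * π * gridPoint (s + r) l / κ| ≤
      2 * π * step (s + r) / κ * (Q / Z) * exp (-(α * (gridInt (s + r) l : ℝ) ^ 2)) := by
    intro l
    set k := (gridInt (s + r) l : ℝ) with hk
    have h1 : |2 * π * gridPoint (s + r) l / κ| = 2 * π * step (s + r) / κ * |k| := by
      have : 2 * π * gridPoint (s + r) l / κ = 2 * π * step (s + r) / κ * k := by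
        rw [gridPoint_eq hm]; ring
      rw [this, abs_mul, abs_of_pos (by positivity)]
    have h2 : ‖resource (widthOf s) (s + r) l‖ ^ 2 ≤ exp (-(α * k ^ 2)) * exp (-(α * k ^ 2)) / Z := by
      rw [resource_eq (widthOf_pos s), exponent_eq, ← hα, ← hZdef, gridIndex_eq hm, ← hk]
      split_ifs
      · rw [norm_zero, zero_pow two_ne_zero]; positivity
      · rw [Complex.norm_real, norm_eq_abs, sq_abs, div_pow, sq_sqrt hZ0.le, sq]
    -- One of the two Gaussian factors of the squared amplitude absorbs |k| at the price of the
    -- width Q = α^(-1/2); the other one is summed.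
    have h3 : |k| * exp (-(α * k ^ 2)) ≤ Q := by
      rw [exp_neg, ← div_eq_mul_inv, div_le_iff₀ (exp_pos _)]
      have h4 := add_one_le_exp (α * k ^ 2)
      have h5 : |k| ≤ Q * (α * k ^ 2 + 1) := by
        have : Q * (α * k ^ 2 + 1) = (|k| ^ 2 + Q ^ 2) / Q := by
          rw [hQα, sq_abs]; field_simp
        rw [this, le_div_iff₀ hQ0]
        nlinarith [sq_nonneg (|k| - Q), abs_nonneg k]
      exact h5.trans (by gcongr)
    rw [h1]
    calc ‖resource (widthOf s) (s + r) l‖ ^ 2 * (2 * π * step (s + r) / κ * |k|)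
        ≤ exp (-(α * k ^ 2)) * exp (-(α * k ^ 2)) / Z * (2 * π * step (s + r) / κ * |k|) := by
          gcongr
      _ = 2 * π * step (s + r) / κ * ((|k| * exp (-(α * k ^ 2))) / Z) * exp (-(α * k ^ 2)) := by
          ring
      _ ≤ _ := by gcongr
  refine (Finset.sum_le_sum fun l _ => hterm l).trans ?_
  rw [← Finset.mul_sum]
  have h6 : ∑ l, exp (-(α * (gridInt (s + r) l : ℝ) ^ 2)) ≤ 3 * (√π * Q) := by
    refine (sum_gridInt_le hm (summable_gauss_zero hα0) fun k => (exp_pos _).le).trans ?_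
    have h7 := tsum_gauss_le hα0 hα1 0
    simp only [sub_zero] at h7
    rwa [hQα, div_inv_eq_mul, sqrt_mul pi_pos.le, sqrt_sq hQ0.le, ← hQα] at h7
  have h8 : √π ≤ 1.78 := by
    rw [sqrt_le_left (by norm_num)]; linarith [pi_lt_d2]
  have h9 : Q / Z ≤ 5 / 3 := by
    rw [div_le_iff₀ hZ0]; linarith
  have h10 : step (s + r) * Q = 2 ^ s := by
    rw [step, hQ, show 2 * s + r = s + (s + r) by ring, pow_add]; field_simp; ring
  calc 2 * π * step (s + r) / κ * (Q / Z) * ∑ l, exp (-(α * (gridInt (s + r) l : ℝ) ^ 2))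
      ≤ 2 * π * step (s + r) / κ * (5 / 3) * (3 * (1.78 * Q)) := by
        have := Finset.sum_nonneg (s := Finset.univ) fun l (_ : l ∈ Finset.univ) =>
          (exp_pos (-(α * (gridInt (s + r) l : ℝ) ^ 2))).le
        have h11 : 3 * (√π * Q) ≤ 3 * (1.78 * Q) := by gcongr
        have h12 : 0 ≤ Q / Z := by positivity
        refine mul_le_mul (by gcongr) (h6.trans h11) this (by positivity)
    _ = 17.8 * π * (step (s + r) * Q) / κ := by ring
    _ ≤ 60 * 2 ^ s / κ := by
        rw [h10]
        gcongr
        nlinarith [pi_lt_d2]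

end MeanTime

/-! ### Choice of the scales -/

section ParameterChoice

open Real

/-- The scales `s` and `r` that achieve precision `ε` for observables of norm at most `κ`. -/
structure GoodScales (κ ε : ℝ) (s r : ℕ) : Prop where
  kappa : 1 ≤ κ
  eps_pos : 0 < ε
  eps_le : ε ≤ 1 / 4
  lower_s : κ ^ 2 * log ε⁻¹ ≤ 4 ^ s
  upper_s : (4 : ℝ) ^ s ≤ 4 * (κ ^ 2 * log ε⁻¹)
  lower_r : 2 ^ 20 * (log κ + log ε⁻¹) ≤ 4 ^ r
  upper_r : (4 : ℝ) ^ r ≤ 4 * (2 ^ 20 * (log κ + log ε⁻¹))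

lemma log_inv_ge {ε : ℝ} (h0 : 0 < ε) (h : ε ≤ 1 / 4) : 1.38 ≤ log ε⁻¹ := by
  have h1 : (4 : ℝ) ≤ ε⁻¹ := by
    rw [← one_div, le_div_iff₀ h0]; linarith
  have h2 : log 4 = 2 * log 2 := by
    rw [show (4 : ℝ) = 2 ^ 2 by norm_num, log_pow]; norm_num
  have h3 := log_le_log (by norm_num) h1
  have h4 := log_two_gt_d9
  linarith

lemma exists_goodScales {κ ε : ℝ} (hκ : 1 ≤ κ) (h0 : 0 < ε) (h : ε ≤ 1 / 4) :
    ∃ s r, GoodScales κ ε s r := by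
  have hl := log_inv_ge h0 h
  have hk := log_nonneg hκ
  have hx : 1 ≤ κ ^ 2 * log ε⁻¹ := by nlinarith
  have hy : (1 : ℝ) ≤ 2 ^ 20 * (log κ + log ε⁻¹) := by linarith
  obtain ⟨s, hs1, hs2⟩ := exists_nat_pow_near hx (by norm_num : (1 : ℝ) < 4)
  obtain ⟨r, hr1, hr2⟩ := exists_nat_pow_near hy (by norm_num : (1 : ℝ) < 4)
  -- Both thresholds are rounded up to powers of 4, at the cost of the factor 4 in the upper bounds.
  refine ⟨s + 1, r + 1, hκ, h0, h, hs2.le, ?_, hr2.le, ?_⟩ <;> rw [pow_succ] <;> linarith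

/-- The threshold 2^20 makes half of the spared exponent beat the polynomial prefactors of the bias
with room for their constants. -/
lemma sq_mul_exp_neg_le {R : ℝ} (hR : 2 ^ 20 ≤ R) : R ^ 2 * exp (-(R / 16)) ≤ (2 ^ 16)⁻¹ := by
  have h0 : 0 < R := lt_of_lt_of_le (by norm_num) hR
  have h1 : (R / 64) ^ 4 ≤ exp (R / 16) := by
    have h2 : exp (R / 16) = exp (R / 64) ^ 4 := by rw [← exp_nat_mul]; congr 1; push_cast; ring
    rw [h2]
    exact pow_le_pow_left₀ (by positivity) (by linarith [add_one_le_exp (R / 64)]) 4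
  rw [exp_neg, ← div_eq_mul_inv, div_le_iff₀ (exp_pos _)]
  have h3 : (2 ^ 20 : ℝ) ^ 2 ≤ R ^ 2 := pow_le_pow_left₀ (by norm_num) hR 2
  have h4 : R ^ 2 ≤ (2 ^ 16)⁻¹ * (R / 64) ^ 4 := by
    have h5 : (R / 64) ^ 4 = R ^ 2 * R ^ 2 / 2 ^ 24 := by ring
    rw [h5]
    have h6 : (0 : ℝ) < R ^ 2 := by positivity
    nlinarith
  exact h4.trans (by gcongr)

namespace GoodScales

variable {κ ε : ℝ} {s r : ℕ}

lemma log_kappa_nonneg (h : GoodScales κ ε s r) : 0 ≤ log κ := log_nonneg h.kappa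

lemma log_eps_ge (h : GoodScales κ ε s r) : 1.38 ≤ log ε⁻¹ := log_inv_ge h.eps_pos h.eps_le

lemma two_pow_le (h : GoodScales κ ε s r) : (2 : ℝ) ^ 20 ≤ 4 ^ r := by
  have h1 := h.log_kappa_nonneg
  have h2 := h.log_eps_ge
  have h3 := h.lower_r
  linarith

lemma three_le (h : GoodScales κ ε s r) : 3 ≤ r := by
  have h1 := h.two_pow_le
  by_contra hr
  have h2 : (4 : ℝ) ^ r ≤ 4 ^ 3 := pow_le_pow_right₀ (by norm_num) (by omega)
  linarith

lemma one_le (h : GoodScales κ ε s r) : 1 ≤ s := by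
  have h1 := h.lower_s
  have h2 := h.log_eps_ge
  have h3 := h.kappa
  by_contra hs
  have h4 : s = 0 := by omega
  subst h4
  rw [pow_zero] at h1
  nlinarith

lemma exp_two_mul_log (h : GoodScales κ ε s r) : κ ^ 2 = exp (2 * log κ) := by
  have : exp (2 * log κ) = exp (log κ) ^ 2 := by rw [← exp_nat_mul]; norm_num
  rw [this, exp_log (by linarith [h.kappa])]

lemma eps_eq (h : GoodScales κ ε s r) : ε = exp (-log ε⁻¹) := by
  rw [log_inv, neg_neg, exp_log h.eps_pos]

/-- The three contributions to the bias. -/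
lemma bias_terms (h : GoodScales κ ε s r) :
    κ ^ 2 * (63 * 4 ^ (s + r) * approxError r) ≤ ε / 3 ∧
      κ ^ 2 * (42 * exp (-(9 * 4 ^ s))) ≤ ε / 3 ∧
      κ ^ 2 * (7 * ((4 ^ r) ^ 2 * exp (-(4 ^ r / 2)))) ≤ ε / 3 := by
  have hk := h.log_kappa_nonneg
  have hl := h.log_eps_ge
  have hR := h.two_pow_le
  have hκ2 := h.exp_two_mul_log
  have hκ1 := h.kappa
  have hε := h.eps_eq
  have hq := h.upper_s
  have hq' := h.lower_s
  have hr := h.lower_r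
  have hS := sq_mul_exp_neg_le hR
  rw [approxError, pow_add]
  set k := log κ
  set l := log ε⁻¹
  set q : ℝ := 4 ^ s
  set R : ℝ := 4 ^ r
  have hR0 : 0 < R := lt_of_lt_of_le (by norm_num) hR
  have hκ2k : 1 + 2 * k ≤ κ ^ 2 := by rw [hκ2]; linarith [add_one_le_exp (2 * k)]
  refine ⟨?_, ?_, ?_⟩
  · have h1 : q ≤ 4 * (κ ^ 2 * (R / 2 ^ 20)) := by
      have : l ≤ R / 2 ^ 20 := by rw [le_div_iff₀ (by norm_num)]; linarith
      exact hq.trans (by gcongr)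
    -- R/16 exceeds 4 log κ + log ε⁻¹, which covers κ⁴ and ε; the other R/16 is kept for the factor
    -- R².
    have h2 : κ ^ 2 * κ ^ 2 * exp (-(R / 8)) ≤ ε * exp (-(R / 16)) := by
      rw [hκ2, hε, ← exp_add, ← exp_add, ← exp_add, exp_le_exp]
      linarith
    calc κ ^ 2 * (63 * (q * R) * (11 * exp (-(R / 8))))
        ≤ κ ^ 2 * (63 * (4 * (κ ^ 2 * (R / 2 ^ 20)) * R) * (11 * exp (-(R / 8)))) := by gcongr
      _ = 2772 / 2 ^ 20 * R ^ 2 * (κ ^ 2 * κ ^ 2 * exp (-(R / 8))) := by ring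
      _ ≤ 2772 / 2 ^ 20 * R ^ 2 * (ε * exp (-(R / 16))) := by gcongr
      _ = 2772 / 2 ^ 20 * ε * (R ^ 2 * exp (-(R / 16))) := by ring
      _ ≤ 2772 / 2 ^ 20 * ε * (2 ^ 16)⁻¹ := by have := h.eps_pos; gcongr
      _ ≤ ε / 3 := by have := h.eps_pos; norm_num; linarith
  -- With k = log κ and l = log ε⁻¹, 9q ≥ 9(1 + 2k)l ≥ 2k + l + 8l, and 8l ≥ 8·1.38 > 11.
  · have h1 : κ ^ 2 * exp (-(9 * q)) ≤ ε * exp (-11) := by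
      rw [hκ2, hε, ← exp_add, ← exp_add, exp_le_exp]
      have : (1 + 2 * k) * l ≤ q := (mul_le_mul_of_nonneg_right hκ2k (by linarith)).trans hq'
      nlinarith
    have h2 : exp (-11) ≤ 1 / 126 := by
      have h3 : (2 : ℝ) ^ 11 ≤ exp 11 := by
        have : exp 11 = exp 1 ^ 11 := by rw [← exp_nat_mul]; norm_num
        rw [this]
        exact pow_le_pow_left₀ (by norm_num) (by linarith [add_one_le_exp (1 : ℝ)]) 11
      rw [exp_neg, ← one_div]
      exact one_div_le_one_div_of_le (by norm_num) (by linarith)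
    have h4 := h.eps_pos
    nlinarith
  · have h1 : κ ^ 2 * exp (-(R / 2)) ≤ ε * exp (-(R / 16)) := by
      rw [hκ2, hε, ← exp_add, ← exp_add, exp_le_exp]
      linarith
    calc κ ^ 2 * (7 * (R ^ 2 * exp (-(R / 2)))) = 7 * R ^ 2 * (κ ^ 2 * exp (-(R / 2))) := by ring
      _ ≤ 7 * R ^ 2 * (ε * exp (-(R / 16))) := by gcongr
      _ = 7 * ε * (R ^ 2 * exp (-(R / 16))) := by ring
      _ ≤ 7 * ε * (2 ^ 16)⁻¹ := by have := h.eps_pos; gcongr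
      _ ≤ ε / 3 := by have := h.eps_pos; norm_num; linarith

/-- The bound for the bias of the readout. -/
lemma abs_bias_le (h : GoodScales κ ε s r) {x : ℝ} (hx : |x| ≤ 1) :
    |∑ j, (recorded (s + r) j - x) * readoutProb (widthOf s) (s + r) j x| ≤ ε / κ ^ 2 := by
  obtain ⟨h1, h2, h3⟩ := h.bias_terms
  have hκ : 0 < κ := by linarith [h.kappa]
  refine (GQPE.abs_bias_le h.one_le h.three_le hx).trans ?_
  rw [le_div_iff₀ (by positivity)]
  linarith

lemma second_moment_le (h : GoodScales κ ε s r) {x : ℝ} (hx : |x| ≤ 1) :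
    ∑ j, (recorded (s + r) j - x) ^ 2 * readoutProb (widthOf s) (s + r) j x ≤ 3 / κ ^ 2 := by
  obtain ⟨h1, -, -⟩ := h.bias_terms
  have hκ : 0 < κ := by linarith [h.kappa]
  have hl := h.log_eps_ge
  have hσ := one_le_sharpness s
  have hq := h.lower_s
  have hε := h.eps_le
  refine (GQPE.second_moment_le h.one_le h.three_le hx).trans ?_
  -- Here π² 4^s ≥ 9·1.38 κ², and 21/(9·1.38) < 2.
  have h2 : 21 / (π ^ 2 * 4 ^ s) ≤ 2 / κ ^ 2 := by
    rw [div_le_div_iff₀ (by positivity) (by positivity)]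
    have : κ ^ 2 * 1.38 ≤ κ ^ 2 * log ε⁻¹ := by gcongr
    linarith [sq_nonneg κ]
  have h3 : 189 * 4 ^ (s + r) * approxError r ≤ 1 / κ ^ 2 := by
    rw [le_div_iff₀ (by positivity)]
    linarith
  have h4 : 2 / κ ^ 2 + 1 / κ ^ 2 = 3 / κ ^ 2 := by ring
  linarith

lemma two_pow_s_le (h : GoodScales κ ε s r) : (2 : ℝ) ^ s ≤ 2 * κ * log ε⁻¹ := by
  have hl := h.log_eps_ge
  have hκ := h.kappa
  refine (pow_le_pow_iff_left₀ (by positivity) (by positivity) two_ne_zero).1 ?_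
  have h1 : ((2 : ℝ) ^ s) ^ 2 = 4 ^ s := by rw [← pow_mul, mul_comm, pow_mul]; norm_num
  rw [h1]
  refine h.upper_s.trans ?_
  have h2 : log ε⁻¹ ≤ log ε⁻¹ ^ 2 := by nlinarith
  calc 4 * (κ ^ 2 * log ε⁻¹) ≤ 4 * (κ ^ 2 * log ε⁻¹ ^ 2) := by gcongr
    _ = _ := by ring

lemma four_pow_le (h : GoodScales κ ε s r) :
    (4 : ℝ) ^ (s + r) ≤ (2 ^ 12 * κ * (log κ + log ε⁻¹)) ^ 2 := by
  have hl := h.log_eps_ge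
  have hk := h.log_kappa_nonneg
  have hκ := h.kappa
  rw [pow_add]
  calc (4 : ℝ) ^ s * 4 ^ r
      ≤ (4 * (κ ^ 2 * log ε⁻¹)) * (4 * (2 ^ 20 * (log κ + log ε⁻¹))) :=
        mul_le_mul h.upper_s h.upper_r (by positivity) (by positivity)
    _ ≤ (4 * (κ ^ 2 * (log κ + log ε⁻¹))) * (4 * (2 ^ 20 * (log κ + log ε⁻¹))) := by
        gcongr; linarith
    _ = _ := by ring

lemma two_pow_m_le (h : GoodScales κ ε s r) :
    (2 : ℝ) ^ (s + r) ≤ 2 ^ 12 * κ * (log κ + log ε⁻¹) := by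
  have hl := h.log_eps_ge
  have hk := h.log_kappa_nonneg
  have hκ := h.kappa
  refine (pow_le_pow_iff_left₀ (by positivity) (by positivity) two_ne_zero).1 ?_
  have h1 : ((2 : ℝ) ^ (s + r)) ^ 2 = 4 ^ (s + r) := by
    rw [← pow_mul, mul_comm, pow_mul]; norm_num
  rw [h1]
  exact h.four_pow_le

/-- A positive lower bound is needed to absorb additive constants into a multiple of log κ + log log
ε⁻¹. -/
lemma log_log_ge (h : GoodScales κ ε s r) : 0.27 ≤ log κ + log (log ε⁻¹) := by
  have hl := h.log_eps_ge
  have hk := h.log_kappa_nonneg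
  have h1 := one_sub_inv_le_log_of_pos (by linarith : 0 < log ε⁻¹)
  have h2 : (log ε⁻¹)⁻¹ ≤ 0.73 := by
    rw [← one_div, div_le_iff₀ (by linarith)]; linarith
  linarith

lemma m_le (h : GoodScales κ ε s r) :
    ((s + r : ℕ) : ℝ) ≤ 17 + 4 * (log κ + log (log ε⁻¹)) := by
  have hl := h.log_eps_ge
  have hk := h.log_kappa_nonneg
  have hκ := h.kappa
  have hκ0 : 0 < κ := by linarith
  have h1 := log_le_log (by positivity) h.four_pow_le
  have hL : 0 < log κ + log ε⁻¹ := by linarith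
  rw [log_pow, log_pow, log_mul (by positivity) hL.ne', log_mul (by positivity) hκ0.ne',
    log_pow] at h1
  -- Indeed log κ + l ≤ κ l, because log κ ≤ κ - 1 and l ≥ 1 for l = log ε⁻¹.
  have h2 : log (log κ + log ε⁻¹) ≤ log κ + log (log ε⁻¹) := by
    rw [← log_mul hκ0.ne' (by linarith : 0 < log ε⁻¹).ne']
    refine log_le_log hL ?_
    have := log_le_sub_one_of_pos hκ0
    nlinarith
  have h3 : log 4 = 2 * log 2 := by
    rw [show (4 : ℝ) = 2 ^ 2 by norm_num, log_pow]; norm_num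
  rw [h3] at h1
  have h4 := log_two_gt_d9
  have h5 := log_two_lt_d9
  have h6 := h.log_log_ge
  push_cast at h1 ⊢
  have h7 : (0 : ℝ) ≤ (s : ℝ) + r := by positivity
  have h8 : ((s : ℝ) + r) * 1.38 ≤ ((s : ℝ) + r) * (2 * log 2) := by gcongr; linarith
  have h9 : 0 ≤ log (log ε⁻¹) := log_nonneg (by linarith)
  linarith

end GoodScales

end ParameterChoice

end GQPE

end

/-! ### The theorem -/

theorem theorem6p1 :
    ∃ (C : ℝ) (p : ℕ), ∀ κ ε : ℝ, 1 ≤ κ → 0 < ε → ε ≤ 1 / 4 →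
      ∃ (m w : ℕ) (γ : ℝ) (c : List (GQPE.Op (2 * m + w))),
        0 < γ ∧
        -- implementation cost: ancilla qubits, controlled evolution time, number of operations
        ((2 * m + w : ℕ) : ℝ) ≤ C * (Real.log κ + Real.log (Real.log ε⁻¹)) ∧
        GQPE.evolutionTime c ≤ C * (Real.log κ + Real.log ε⁻¹) ∧
        (c.length : ℝ) ≤ C * ((2 * m + w : ℕ) : ℝ) ^ p ∧
        ∀ (n : ℕ) (O : Matrix (GQPE.Qubits n) (GQPE.Qubits n) ℂ), O.IsHermitian → ‖O‖ ≤ κ →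
          GQPE.IsKrausFamily (GQPE.krausOp κ γ m O) ∧
          GQPE.Implements O c (GQPE.krausOp κ γ m O) ∧
          ∀ ρ : Matrix (GQPE.Qubits n) (GQPE.Qubits n) ℂ, GQPE.IsState ρ →
            |GQPE.outcomeExpectation (GQPE.krausOp κ γ m O) (GQPE.outcome κ m) ρ -
                GQPE.obsExpectation O ρ| ≤ ε ∧
            |GQPE.outcomeVariance (GQPE.krausOp κ γ m O) (GQPE.outcome κ m) ρ -
                GQPE.obsVariance O ρ| ≤ C ∧
            |GQPE.outcomeCovariance (GQPE.krausOp κ γ m O) (GQPE.outcome κ m) ρ| ≤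
                GQPE.outcomeVariance (GQPE.krausOp κ γ m O) (GQPE.outcome κ m) ρ ∧
            (‖O‖ ≤ 1 →
              GQPE.traceNorm (GQPE.krausMap (GQPE.krausOp κ γ m O) ρ - ρ) ≤
                ε⁻¹ * (C * (Real.log ε⁻¹) ^ p) * GQPE.traceNorm (O * ρ - ρ * O) + 5 * ε) := by
  -- The constant is dictated by the evolution time, where 2^13 π < 30000; the exponent 3 is that of
  -- the gate count.
  refine ⟨30000, 3, fun κ ε hκ hε hε4 => ?_⟩
  obtain ⟨s, r, h⟩ := GQPE.exists_goodScales hκ hε hε4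
  have hs := h.one_le
  have hr := h.three_le
  have hr0 : 0 < r := by omega
  have hm : 0 < s + r := by omega
  have hκ0 : 0 < κ := by linarith
  have hl := h.log_eps_ge
  have hk := h.log_kappa_nonneg
  have hγ := GQPE.widthOf_pos s
  have hα := GQPE.exponent_eq s r
  have hZ : 0 < GQPE.gaussSum (4 * Real.pi ^ 2 * GQPE.widthOf s ^ 2 * GQPE.step (s + r) ^ 2)
      (s + r) := by rw [hα]; exact GQPE.gaussSum_pos hr0
  obtain ⟨c, hct, hcl, hc⟩ := GQPE.exists_circuit hm hγ
    (by rw [hα]; exact GQPE.prod_signedWeight_le hr0) hκ0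
  have hw : ((2 * (s + r) + GQPE.workQubits (2 * (s + r)) : ℕ) : ℝ) = 12 * ((s + r : ℕ) : ℝ) + 3 := by
    rw [GQPE.workQubits]; push_cast; ring
  refine ⟨s + r, GQPE.workQubits (2 * (s + r)), GQPE.widthOf s, c, hγ, ?_, ?_, ?_, ?_⟩
  · rw [hw]
    linarith [h.m_le, h.log_log_ge]
  · refine hct.trans ?_
    rw [div_le_iff₀ hκ0]
    have h1 := h.two_pow_m_le
    have hL : 0 ≤ κ * (Real.log κ + Real.log ε⁻¹) := mul_nonneg hκ0.le (by linarith)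
    calc 2 * Real.pi * 2 ^ (s + r)
        ≤ 2 * Real.pi * (2 ^ 12 * κ * (Real.log κ + Real.log ε⁻¹)) := by
          have := Real.pi_pos
          gcongr
      _ = 2 ^ 13 * Real.pi * (κ * (Real.log κ + Real.log ε⁻¹)) := by ring
      _ ≤ 30000 * (κ * (Real.log κ + Real.log ε⁻¹)) := by
          refine mul_le_mul_of_nonneg_right ?_ hL
          linarith [Real.pi_lt_d2]
      _ = _ := by ring
  · have h1 : (c.length : ℝ) ≤ 510 * (2 * ((s + r : ℕ) : ℝ)) ^ 3 := by exact_mod_cast hcl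
    rw [hw]
    have h2 : (2 * ((s + r : ℕ) : ℝ)) ^ 3 ≤ (12 * ((s + r : ℕ) : ℝ) + 3) ^ 3 := by
      have : (0 : ℝ) ≤ ((s + r : ℕ) : ℝ) := Nat.cast_nonneg _
      gcongr
      linarith
    have h3 : (0 : ℝ) ≤ (12 * ((s + r : ℕ) : ℝ) + 3) ^ 3 := by positivity
    linarith
  · intro n O hO hOκ
    refine ⟨GQPE.isKrausFamily_krausOp hγ hZ κ hO, hc O, fun ρ hρ => ?_⟩
    obtain ⟨hE, hV, hC⟩ := GQPE.outcome_moments hγ hZ hκ0 (fun x hx => h.abs_bias_le hx)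
      (fun x hx => h.second_moment_le hx) hO hOκ hρ
    have hβ : κ * (ε / κ ^ 2) = ε / κ := by field_simp
    have hβ1 : ε / κ ≤ ε := div_le_self hε.le hκ
    have hβ0 : 0 ≤ ε / κ := by positivity
    rw [hβ] at hE hV
    refine ⟨hE.trans hβ1, hV.trans ?_, hC, fun _ => ?_⟩
    · have h1 : κ ^ 2 * (3 / κ ^ 2) = 3 := by field_simp
      have h2 : 2 * (ε / κ) * (2 * κ + ε / κ) = 4 * ε + 2 * (ε / κ) ^ 2 := by field_simp; ring
      have h3 : (ε / κ) ^ 2 ≤ 1 := pow_le_one₀ hβ0 (by linarith)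
      rw [h1, h2]
      linarith
    · refine (GQPE.traceNorm_krausMap_sub_le hO ρ (GQPE.sum_resource_sq hγ hZ)
        (GQPE.mean_time_le hr0 hκ0)).trans ?_
      have hT : 0 ≤ GQPE.traceNorm (O * ρ - ρ * O) :=
        Finset.sum_nonneg fun i _ => Real.sqrt_nonneg _
      -- The mean evolution time is at most 120 log ε⁻¹; the factor ε⁻¹, the cube and the summand 5ε
      -- are slack.
      have h1 : 60 * 2 ^ s / κ ≤ ε⁻¹ * (30000 * Real.log ε⁻¹ ^ 3) := by
        have h2 : 60 * 2 ^ s / κ ≤ 120 * Real.log ε⁻¹ := by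
          rw [div_le_iff₀ hκ0]
          linarith [h.two_pow_s_le]
        have h3 : 1 ≤ ε⁻¹ := (one_le_inv₀ hε).2 (by linarith)
        have h4 : Real.log ε⁻¹ ≤ Real.log ε⁻¹ ^ 3 :=
          le_self_pow₀ (by linarith) (by norm_num)
        have h5 : 0 ≤ 30000 * Real.log ε⁻¹ ^ 3 := by positivity
        have h6 := le_mul_of_one_le_left h5 h3
        linarith
      have h7 := mul_le_mul_of_nonneg_right h1 hT
      linarith
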